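/- Let $\Sigma$ be a finite alphabet and $\bot\notin\Sigma$ a padding symbol, $\Sigma_\bot=\Sigma\cup\{\bot\}$. The convolution $w_1\otimes\dots\otimes w_r\in(\Sigma_\bot^r)^*$ of words $w_1,\dots,w_r\in\Sigma^*$ has length $\max_i|w_i|$ (the empty word if $r=0$), and the $i$-th component of its $j$-th letter is the $j$-th letter of $w_i$ if $j\le|w_i|$, and $\bot$ otherwise. An NFA $\mathcal A$ over $\Sigma_\bot^r$ (with finitely many states and possibly with $\varepsilon$-transitions) recognizes a relation $R\subseteq(\Sigma^*)^r$ if $L(\mathcal A)=\{w_1\otimes\dots\otimes w_r \mid (w_1,\dots,w_r)\in R\}$. For $R\subseteq(\Sigma^*)^{k+2}$ let $$\exists^{\mathrm{ram}}R=\{\boldsymbol c\in(\Sigma^*)^k \mid \text{there are pairwise distinct } a_1,a_2,\dots\in\Sigma^* \text{ with } (a_i,a_j,\boldsymbol c)\in R \text{ for all } 1\le i<j\}.$$ **Theorem.** (1) There is a deterministic logarithmic-space Turing transducer which, for every finite alphabet $\Sigma$, every $k\ge 0$ and every NFA $\mathcal A$ that recognizes a relation $R\subseteq(\Sigma^*)^{k+2}$,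 outputs on input $\mathcal A$ an NFA over $\Sigma_\bot^k$ that recognizes $\exists^{\mathrm{ram}}R$. Here $k$ is part of the input, while $\Sigma$ is not fixed and not part of the representation of the automaton. (2) In particular, the infinite clique problem over word-regular relations is in $\mathsf{NL}$: some language in $\mathsf{NL}$ contains, among the NFAs $\mathcal A$ that recognize a binary relation $R\subseteq\Sigma^*\times\Sigma^*$ over some finite alphabet $\Sigma$, exactly those whose relation $R$ has an infinite directed clique, i.e. pairwise distinct words $a_1,a_2,\dots$ with $(a_i,a_j)\in R$ for all $1\le i<j$. -/

import Mathlib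

namespace RamseyWords

section Automata

/-- A nondeterministic finite automaton over `α` as a finite object: states `0, …, numStates - 1`,
one initial state, a finite list of final states and a finite list of transitions.
The label `none` is the empty word. -/
structure FinNFA (α : Type) where
  numStates : ℕ
  start : Fin numStates
  final : List (Fin numStates)
  trans : List (Fin numStates × Option α × Fin numStates)

/-- The automaton denoted by a finite description. -/
def FinNFA.toεNFA {α : Type} (A : FinNFA α) : εNFA α (Fin A.numStates) where
  step p a := {q | (p, a, q) ∈ A.trans}
  start := {A.start}
  accept := {q | q ∈ A.final}

/-- The language accepted by the automaton. -/
def FinNFA.language {α : Type} (A : FinNFA α) : Set (List α) :=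
  {w | w ∈ A.toεNFA.accepts}

/-- Convolution of an `r`-tuple of words; the padding symbol is `none`. -/
def conv {α : Type} {r : ℕ} (w : Fin r → List α) : List (Fin r → Option α) :=
  (List.range (Finset.univ.sup fun i => (w i).length)).map fun j i => (w i)[j]?

/-- `A` recognizes the relation `R`: it accepts exactly the convolutions of the tuples in `R`. -/
def Recognizes {α : Type} {r : ℕ} (A : FinNFA (Fin r → Option α))
    (R : Set (Fin r → List α)) : Prop :=
  A.language = conv '' R

/-- The parameter tuples `c` such that there are pairwise distinct words `a 0, a 1, …` with
`(a i, a j, c) ∈ R` for all `i < j`. -/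
def ramsey {α : Type} {k : ℕ} (R : Set (Fin (k + 2) → List α)) : Set (Fin k → List α) :=
  {c | ∃ a : ℕ → List α, Function.Injective a ∧
    ∀ i j, i < j → Matrix.vecCons (a i) (Matrix.vecCons (a j) c) ∈ R}

/-- The binary relation `R` contains an infinite directed clique. -/
def HasInfiniteClique {α : Type} (R : Set (Fin 2 → List α)) : Prop :=
  ∃ a : ℕ → List α, Function.Injective a ∧ ∀ i j, i < j → ![a i, a j] ∈ R

end Automata

section Encoding

/-- The symbols used to write down automata as strings. -/
inductive Tok where
  | tick | bit0 | bit1 | bot | eps | sep | semi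
  deriving DecidableEq

/-- Binary notation, most significant bit first (zero is the empty string). -/
def encNat (n : ℕ) : List Tok :=
  n.bits.reverse.map fun b => if b then Tok.bit1 else Tok.bit0

/-- A single component of a letter: a symbol of the alphabet, or padding. -/
def encSym {s : ℕ} : Option (Fin s) → List Tok
  | none => [Tok.bot]
  | some a => encNat a

/-- A transition label: the empty word, or a tuple of components. -/
def encLabel {s r : ℕ} : Option (Fin r → Option (Fin s)) → List Tok
  | none => [Tok.eps]
  | some v => ((List.ofFn v).flatMap fun a => encSym a ++ [Tok.sep]) ++ [Tok.semi]

/-- The string that represents an automaton over the alphabet of `r`-tuples of symbols: the arity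
`r` and the number of states in unary, then the initial state, the final states and the transitions
with states and symbols in binary. The size `s` of the alphabet is not part of the representation. -/
def encNFA {s r : ℕ} (A : FinNFA (Fin r → Option (Fin s))) : List Tok :=
  List.replicate r Tok.tick ++ [Tok.sep] ++
  List.replicate A.numStates Tok.tick ++ [Tok.sep] ++
  encNat A.start ++ [Tok.sep] ++
  (A.final.flatMap fun q => encNat q ++ [Tok.sep]) ++ [Tok.semi] ++
  A.trans.flatMap fun e =>
    encNat e.1 ++ [Tok.sep] ++ encLabel e.2.1 ++ encNat e.2.2 ++ [Tok.sep]

end Encoding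

section Machines

inductive Move where
  | left | stay | right

/-- What the input head sees: a symbol of the input or one of the two end markers. -/
inductive InSym (I : Type) where
  | leftEnd
  | sym (a : I)
  | rightEnd

/-- One instruction: next state, move of the input head, symbols written on the work tapes, moves of
the work heads, and at most one symbol appended to the write-only output tape. -/
structure Action (Q Γ O : Type) (t : ℕ) where
  state : Q
  inputMove : Move
  write : Fin t → Γ
  workMove : Fin t → Move
  output : Option O

/-- A (nondeterministic) Turing machine with a two-way read-only input tape, finitely many read-write
work tapes infinite to the right, and a write-only output tape. -/
structure Machine (I O : Type) where
  Q : Type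
  Γ : Type
  tapes : ℕ
  finiteQ : Finite Q
  finiteΓ : Finite Γ
  blank : Γ
  start : Q
  accept : Set Q
  δ : Q → InSym I → (Fin tapes → Γ) → Set (Action Q Γ O tapes)

variable {I O : Type}

structure Config (M : Machine I O) where
  state : M.Q
  inputPos : ℕ
  tape : Fin M.tapes → ℕ → M.Γ
  head : Fin M.tapes → ℕ
  out : List O

/-- The input `x` occupies cells `1, …, x.length` between the end markers. -/
def readInput (x : List I) : ℕ → InSym I
  | 0 => InSym.leftEnd
  | p + 1 => match x[p]? with
    | some a => InSym.sym a
    | none => InSym.rightEnd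

/-- A head at cell `0` does not move further to the left. -/
def Move.apply : Move → ℕ → ℕ
  | .left, p => p - 1
  | .stay, p => p
  | .right, p => p + 1

namespace Machine

def init (M : Machine I O) : Config M where
  state := M.start
  inputPos := 0
  tape := fun _ _ => M.blank
  head := fun _ => 0
  out := []

/-- The configuration after one instruction; the input head stays between the end markers. -/
def next (M : Machine I O) (x : List I) (c : Config M) (a : Action M.Q M.Γ O M.tapes) :
    Config M where
  state := a.state
  inputPos := min (a.inputMove.apply c.inputPos) (x.length + 1)
  tape := fun i => Function.update (c.tape i) (c.head i) (a.write i)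
  head := fun i => (a.workMove i).apply (c.head i)
  out := c.out ++ a.output.toList

/-- The instructions that may be executed in a configuration. -/
def enabled (M : Machine I O) (x : List I) (c : Config M) : Set (Action M.Q M.Γ O M.tapes) :=
  M.δ c.state (readInput x c.inputPos) fun i => c.tape i (c.head i)

def Step (M : Machine I O) (x : List I) (c c' : Config M) : Prop :=
  ∃ a ∈ M.enabled x c, c' = M.next x c a

/-- The configuration can occur in a computation on input `x`. -/
def Reachable (M : Machine I O) (x : List I) (c : Config M) : Prop :=
  Relation.ReflTransGen (M.Step x) M.init c

def Deterministic (M : Machine I O) : Prop :=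
  ∀ q a g, (M.δ q a g).Subsingleton

/-- On inputs of length `n` no computation leaves the first `O(log n)` cells of any work tape. -/
def LogSpace (M : Machine I O) : Prop :=
  ∃ C : ℕ, ∀ x c, M.Reachable x c → ∀ i, c.head i ≤ C * (Nat.log 2 x.length + 1)

end Machine

/-- `f` is computed by a deterministic logarithmic-space Turing machine that halts on every input. -/
def LogSpaceComputable (f : List I → List O) : Prop :=
  ∃ M : Machine I O, M.Deterministic ∧ M.LogSpace ∧
    ∀ x, ∃ c, M.Reachable x c ∧ M.enabled x c = ∅ ∧ c.out = f x

/-- The complexity class NL: languages accepted by a nondeterministic logarithmic-space Turing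
machine. -/
def InNL (L : Set (List I)) : Prop :=
  ∃ M : Machine I Empty, M.LogSpace ∧
    ∀ x, x ∈ L ↔ ∃ c, M.Reachable x c ∧ c.state ∈ M.accept

end Machines

end RamseyWords

/-! A finite pattern characterizes the Ramsey quantifier. Let `a₁, a₂, …` be a clique with
parameters `c`. The alphabet is finite, so the lengths are unbounded along a non-principal
ultrafilter, the words converge letter by letter to an infinite word `β`, and the states in
accepting runs on `aᵢ ⊗ aⱼ ⊗ c` converge too. Cutting at two suitable positions `t < t'` yields a
prefix `U` and the next factor `Y` of `β`, the remainder `X` of one of the words, shorter than `Y`,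
and states `p`, `q` with runs of the automaton from the initial state to `p` on `(U, U, c)`, from
`p` to `p` on `(Y, Y)`, from `p` to `q` on `(X, Y)`, from `q` to `q` on `(⊥, Y)` and from `q` to a
final state on `(⊥, X)`. This is `hasPattern_of_mem_ramsey`. Conversely these runs can be pumped:
with `a i = U Yⁱ X` and `i < j`, the pair `(a i, a j)` is read as `(U, U, c)`, then `i` times `(Y,
Y)`, then `(X, Y)`, then `j - i - 1` times `(⊥, Y)`, then `(⊥, X)`.

The new automaton `CliqueStep` guesses such a pattern. It reads `c` while it follows the run on `(U,
U, c)`; afterwards, without reading, it guesses `p` and `q` and follows the other four runs in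
parallel. Its states are a flag and six states of the given automaton. It never checks that the
guessed letters form a convolution: the given automaton recognizes a relation, so it accepts nothing
but convolutions. This is used in `exists_ramsey_of_lrun`.

A move of the new automaton is determined by one of finitely many kinds and six positions in the
input text, where transitions or states are written. Whether six positions fit together is a formula
built from comparing positions, reading symbols and quantifying over positions; symbols of `Σ` are
only compared as pieces of text, so the alphabet plays no role. Program fragments evaluate such
formulas; they are compiled to register programs whose registers hold positions, and these to a
Turing machine with the registers in binary on one tape. The transducer `cliqueText` runs through
all six-tuples and writes down the moves; the number of a state is a string assembled from pieces of
the input (`stateText`), so it is copied and never computed. That the output is correct is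
`exists_cliqueText_eq`.

For the second claim `k = 0`, and the question is whether the new automaton accepts the empty word.
No composition with the transducer is needed: a nondeterministic machine guesses the accepting run
move by move and keeps six positions at a time (`inNL_of_path`, `CliqueSearch`). -/

namespace RamseyWords

/-! ### Simulations between transition systems -/

section Simulation

variable {α β : Type}

/-- Forced steps lead from the first point to the second, and every point that is left on the way
satisfies `P`. -/
inductive ForcedPath (step : β → β → Prop) (P : β → Prop) : β → β → Prop
  | refl (b : β) : ForcedPath step P b b
  | head {b b₁ b' : β} : P b → (∀ d, step b d ↔ d = b₁) → ForcedPath step P b₁ b' →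
      ForcedPath step P b b'

theorem ForcedPath.trans {step : β → β → Prop} {P : β → Prop} {a b c : β}
    (h : ForcedPath step P a b) (h' : ForcedPath step P b c) : ForcedPath step P a c := by
  induction h with
  | refl => exact h'
  | head hp hs _ ih => exact .head hp hs (ih h')

theorem ForcedPath.single {step : β → β → Prop} {P : β → Prop} {a b : β}
    (hp : P a) (hs : ∀ d, step a d ↔ d = b) : ForcedPath step P a b :=
  .head hp hs (.refl _)

theorem ForcedPath.reflTransGen {step : β → β → Prop} {P : β → Prop} {a b : β}
    (h : ForcedPath step P a b) : Relation.ReflTransGen step a b := by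
  induction h with
  | refl => exact .refl
  | head _ hs _ ih => exact .head ((hs _).2 rfl) ih

/-- Each step of the first system is carried out in the second one by a forced path through
points satisfying `P`, or both systems have matching successors. -/
def Simulates (stepA : α → α → Prop) (stepB : β → β → Prop) (P : β → Prop)
    (Rep : α → β → Prop) : Prop :=
  ∀ a b, Rep a b →
    (∃ a' b₁ b', (∀ d, stepA a d ↔ d = a') ∧ (∀ d, stepB b d ↔ d = b₁) ∧
      ForcedPath stepB P b₁ b' ∧ Rep a' b') ∨
    ((∀ d, stepB b d → ∃ a', stepA a a' ∧ Rep a' d) ∧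
      (∀ a', stepA a a' → ∃ d, stepB b d ∧ Rep a' d))

variable {stepA : α → α → Prop} {stepB : β → β → Prop} {P : β → Prop} {Rep : α → β → Prop}

theorem Simulates.forward (hS : Simulates stepA stepB P Rep) {a₀ a : α} {b₀ : β}
    (h₀ : Rep a₀ b₀) (h : Relation.ReflTransGen stepA a₀ a) :
    ∃ b, Relation.ReflTransGen stepB b₀ b ∧ Rep a b := by
  induction h with
  | refl => exact ⟨b₀, .refl, h₀⟩
  | tail _ hs ih =>
    obtain ⟨b, hb, hr⟩ := ih
    rcases hS _ _ hr with ⟨a', b₁, b', hA, hB, hp, hr'⟩ | ⟨_, h2⟩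
    · obtain rfl := (hA _).1 hs
      exact ⟨b', hb.trans (.head ((hB _).2 rfl) hp.reflTransGen), hr'⟩
    · obtain ⟨d, hd, hr'⟩ := h2 _ hs
      exact ⟨d, hb.tail hd, hr'⟩

/-- A run of the second system may stop inside a forced path. There only `P` is known, so `P` has to
carry whatever is needed of intermediate points, such as a space bound or non-acceptance. -/
theorem Simulates.backward (hS : Simulates stepA stepB P Rep) {a₀ : α} {b₀ b : β}
    (h₀ : Rep a₀ b₀) (h : Relation.ReflTransGen stepB b₀ b) :
    (∃ a, Relation.ReflTransGen stepA a₀ a ∧ Rep a b) ∨ P b := by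
  -- The induction must remember the part of the forced path that still lies ahead.
  suffices H : (∃ a, Relation.ReflTransGen stepA a₀ a ∧ Rep a b) ∨
      (P b ∧ ∃ a b', Relation.ReflTransGen stepA a₀ a ∧ Rep a b' ∧ ForcedPath stepB P b b') from
    H.imp_right And.left
  have key : ∀ a b d, Relation.ReflTransGen stepA a₀ a → Rep a b → stepB b d →
      (∃ a, Relation.ReflTransGen stepA a₀ a ∧ Rep a d) ∨
      (P d ∧ ∃ a b', Relation.ReflTransGen stepA a₀ a ∧ Rep a b' ∧ ForcedPath stepB P d b') := by
    intro a b d ha hr hs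
    rcases hS _ _ hr with ⟨a', b₁, b', hA, hB, hp, hr'⟩ | ⟨h1, _⟩
    · obtain rfl := (hB _).1 hs
      have ha' := ha.tail ((hA _).2 rfl)
      cases hp with
      | refl => exact .inl ⟨a', ha', hr'⟩
      | head p s t => exact .inr ⟨p, a', b', ha', hr', .head p s t⟩
    · obtain ⟨a', hs', hr'⟩ := h1 _ hs
      exact .inl ⟨a', ha.tail hs', hr'⟩
  induction h with
  | refl => exact .inl ⟨a₀, .refl, h₀⟩
  | tail _ hs ih =>
    rcases ih with ⟨a, ha, hr⟩ | ⟨_, a, b', ha, hr, hp⟩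
    · exact key _ _ _ ha hr hs
    · cases hp with
      | refl => exact key _ _ _ ha hr hs
      | head p s t =>
        obtain rfl := (s _).1 hs
        cases t with
        | refl => exact .inl ⟨a, ha, hr⟩
        | head p' s' t' => exact .inr ⟨p', a, b', ha, hr, .head p' s' t'⟩

end Simulation

/-! ### A Turing machine whose work tape is swept by finite transducers -/

section Sweep

/-- Instructions of a machine that keeps a list of digits and passes over the whole list with a
two-state transducer, which may append one digit at the end. -/
inductive SweepInstr (Q D I O : Type) where
  | halt
  | choose (l : List Q)
  | input (f : InSym I → Q × Move × Option O)
  | sweep (t : Bool → D → Bool × D) (s : Bool) (ext : Bool → Option D) (next : Bool → Q)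

structure SweepConf (Q D O : Type) where
  state : Q
  pos : ℕ
  digits : List D
  out : List O

variable {Q D I O : Type}

/-- The run of a sequential transducer: last state and output. -/
def sweepRun (t : Bool → D → Bool × D) : Bool → List D → Bool × List D
  | s, [] => (s, [])
  | s, d :: l => ((sweepRun t (t s d).1 l).1, (t s d).2 :: (sweepRun t (t s d).1 l).2)

theorem length_sweepRun (t : Bool → D → Bool × D) (s : Bool) (l : List D) :
    (sweepRun t s l).2.length = l.length := by
  induction l generalizing s with
  | nil => rfl
  | cons d l ih => simp [sweepRun, ih]

def SweepInstr.Step (x : List I) (c d : SweepConf Q D O) : SweepInstr Q D I O → Prop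
  | .halt => False
  | .choose l => ∃ q ∈ l, d = { c with state := q }
  | .input f => d = ⟨(f (readInput x c.pos)).1,
      min ((f (readInput x c.pos)).2.1.apply c.pos) (x.length + 1), c.digits,
      c.out ++ (f (readInput x c.pos)).2.2.toList⟩
  | .sweep t s ext next => d = ⟨next (sweepRun t s c.digits).1, c.pos,
      (sweepRun t s c.digits).2 ++ (ext (sweepRun t s c.digits).1).toList, c.out⟩

def SweepStep (instr : Q → SweepInstr Q D I O) (x : List I) (c d : SweepConf Q D O) : Prop :=
  (instr c.state).Step x c d

inductive TapeSym (D : Type) where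
  | blank
  | left
  | dig (d : D)

inductive SweepCtl (Q : Type) where
  | boot
  | idle (q : Q)
  | run (q : Q) (s : Bool)
  | back (q : Q)

instance [Finite D] : Finite (TapeSym D) := by
  refine Finite.of_injective (β := Option (Option D)) (fun
    | .blank => none
    | .left => some none
    | .dig d => some (some d)) ?_
  rintro (_ | _ | _) (_ | _ | _) h <;> simp_all

instance [Finite Q] : Finite (SweepCtl Q) := by
  refine Finite.of_injective (β := Option (Q ⊕ (Q × Bool) ⊕ Q)) (fun
    | .boot => none
    | .idle q => some (.inl q)
    | .run q s => some (.inr (.inl (q, s)))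
    | .back q => some (.inr (.inr q))) ?_
  rintro (_ | _ | _ | _) (_ | _ | _ | _) h <;> simp_all

theorem SweepCtl.back_ne_idle (q q' : Q) : SweepCtl.back q ≠ .idle q' := nofun

theorem SweepCtl.run_ne_idle (q : Q) (s : Bool) (q' : Q) : SweepCtl.run q s ≠ .idle q' := nofun

/-- An action of a machine with one work tape. -/
def act (q : SweepCtl Q) (m : Move) (w : TapeSym D) (wm : Move) (o : Option O) :
    Action (SweepCtl Q) (TapeSym D) O 1 :=
  ⟨q, m, fun _ => w, fun _ => wm, o⟩

/-- `boot` puts the end marker into cell `0`; in `idle` the head is on that marker; `run` moves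
right and applies the transducer until it meets the first blank, where the extra digit may go;
`back` returns to the marker. -/
def sweepDelta (instr : Q → SweepInstr Q D I O) (q₀ : Q) :
    SweepCtl Q → InSym I → TapeSym D → Set (Action (SweepCtl Q) (TapeSym D) O 1)
  | .boot, _, _ => {act (.idle q₀) .stay .left .stay none}
  | .idle q, a, g =>
    match instr q with
    | .halt => ∅
    | .choose l => {u | ∃ q' ∈ l, u = act (.idle q') .stay g .stay none}
    | .input f => {act (.idle (f a).1) (f a).2.1 g .stay (f a).2.2}
    | .sweep _ s _ _ => {act (.run q s) .stay g .right none}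
  | .run q s, _, g =>
    match instr q, g with
    | .sweep t _ _ _, .dig d => {act (.run q (t s d).1) .stay (.dig (t s d).2) .right none}
    | .sweep _ _ ext next, .blank =>
      {act (.back (next s)) .stay ((ext s).elim .blank .dig) .left none}
    | _, _ => ∅
  | .back q, _, g =>
    match g with
    | .left => {act (.idle q) .stay .left .stay none}
    | g => {act (.back q) .stay g .left none}

/-- The Turing machine that carries out the sweeps on its work tape, behind an end marker. -/
def sweepTM [Finite Q] [Finite D] (instr : Q → SweepInstr Q D I O) (q₀ : Q) (acc : Set Q) :
    Machine I O where
  Q := SweepCtl Q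
  Γ := TapeSym D
  tapes := 1
  finiteQ := inferInstance
  finiteΓ := inferInstance
  blank := .blank
  start := .boot
  accept := {q | ∃ p ∈ acc, q = .idle p}
  δ q a g := sweepDelta instr q₀ q a (g 0)

def tapeOf (l : List D) : ℕ → TapeSym D
  | 0 => .left
  | i + 1 => (l[i]?).elim .blank .dig

theorem tapeOf_update (l₁ l₂ : List D) (d d' : D) :
    Function.update (tapeOf (l₁ ++ d :: l₂)) (l₁.length + 1) (.dig d') =
      tapeOf (l₁ ++ d' :: l₂) := by
  funext i
  rcases i with _ | i
  · simp [tapeOf]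
  · by_cases h : i = l₁.length
    · subst h; simp [tapeOf]
    · rw [Function.update_of_ne (by omega)]
      simp only [tapeOf, List.getElem?_append]
      split_ifs with h'
      · rfl
      · obtain ⟨j, hj⟩ : ∃ j, i - l₁.length = j + 1 := ⟨i - l₁.length - 1, by omega⟩
        simp [hj]

theorem tapeOf_extend (l : List D) (o : Option D) :
    Function.update (tapeOf l) (l.length + 1) (o.elim .blank .dig) = tapeOf (l ++ o.toList) := by
  funext i
  rcases i with _ | i
  · simp [tapeOf]
  · by_cases h : i = l.length
    · subst h; cases o <;> simp [tapeOf]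
    · rw [Function.update_of_ne (by omega)]
      simp only [tapeOf, List.getElem?_append]
      split_ifs with h'
      · rfl
      · rw [List.getElem?_eq_none (by omega), List.getElem?_eq_none]
        cases o <;> simp; omega

section

variable [Finite Q] [Finite D] (instr : Q → SweepInstr Q D I O) (q₀ : Q) (acc : Set Q)

/-- Configuration of the Turing machine whose work tape holds the digits `l`. -/
def sweepConf (q : SweepCtl Q) (p : ℕ) (l : List D) (h : ℕ) (out : List O) :
    Config (sweepTM instr q₀ acc) where
  state := q
  inputPos := p
  tape := fun _ => tapeOf l
  head := fun _ => h
  out := out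

theorem sweepTM_step_iff (x : List I) (q : SweepCtl Q) (p : ℕ) (l : List D) (h : ℕ)
    (out : List O) (d : Config (sweepTM instr q₀ acc)) :
    (sweepTM instr q₀ acc).Step x (sweepConf instr q₀ acc q p l h out) d ↔
      ∃ a ∈ sweepDelta instr q₀ q (readInput x p) (tapeOf l h),
        d = (sweepTM instr q₀ acc).next x (sweepConf instr q₀ acc q p l h out) a :=
  Iff.rfl

theorem sweepTM_next (x : List I) (q q' : SweepCtl Q) (p : ℕ) (l l' : List D) (h : ℕ)
    (out : List O) (m wm : Move) (w : TapeSym D) (o : Option O)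
    (hw : Function.update (tapeOf l) h w = tapeOf l') :
    (sweepTM instr q₀ acc).next x (sweepConf instr q₀ acc q p l h out) (act q' m w wm o) =
      sweepConf instr q₀ acc q' (min (m.apply p) (x.length + 1)) l' (wm.apply h)
        (out ++ o.toList) := by
  simp only [Machine.next, sweepConf, act]
  congr 1
  funext i
  exact hw

theorem sweepTM_step_of_eq (x : List I) (q q' : SweepCtl Q) (p : ℕ) (l l' : List D) (h : ℕ)
    (out : List O) (m wm : Move) (w : TapeSym D) (o : Option O)
    (hδ : sweepDelta instr q₀ q (readInput x p) (tapeOf l h) = {act q' m w wm o})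
    (hw : Function.update (tapeOf l) h w = tapeOf l') (d : Config (sweepTM instr q₀ acc)) :
    (sweepTM instr q₀ acc).Step x (sweepConf instr q₀ acc q p l h out) d ↔
      d = sweepConf instr q₀ acc q' (min (m.apply p) (x.length + 1)) l' (wm.apply h)
        (out ++ o.toList) := by
  rw [sweepTM_step_iff, hδ, ← sweepTM_next instr q₀ acc x q q' p l l' h out m wm w o hw]
  simp

theorem sweep_back (x : List I) (q : Q) (p : ℕ) (hp : p ≤ x.length + 1) (l : List D) (h : ℕ)
    (out : List O) (B : ℕ) (hB : h ≤ B) :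
    ForcedPath ((sweepTM instr q₀ acc).Step x)
      (fun c => (∀ q', c.state ≠ .idle q') ∧ ∀ i, c.head i ≤ B)
      (sweepConf instr q₀ acc (.back q) p l h out) (sweepConf instr q₀ acc (.idle q) p l 0 out) := by
  induction h with
  | zero =>
    refine .single ⟨SweepCtl.back_ne_idle q, fun i => hB⟩ fun d => ?_
    rw [sweepTM_step_of_eq instr q₀ acc x _ (.idle q) p l l 0 out .stay .stay .left none rfl
      (by rw [show TapeSym.left = tapeOf l 0 from rfl, Function.update_eq_self])]
    simp [Move.apply, hp]
  | succ h ih =>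
    refine .head ⟨SweepCtl.back_ne_idle q, fun i => hB⟩ (fun d => ?_) (ih (by omega))
    rw [sweepTM_step_of_eq instr q₀ acc x _ (.back q) p l l (h + 1) out .stay .left
      (tapeOf l (h + 1)) none ?_ (Function.update_eq_self _ _)]
    · simp [Move.apply, hp]
    · simp only [tapeOf]
      cases l[h]? <;> rfl

/-- Here `l₁` is the part that has been rewritten already. The head is on cell `l₁.length + 1`,
because cell `0` holds the end marker. -/
theorem sweep_run (x : List I) (q : Q) (p : ℕ) (hp : p ≤ x.length + 1)
    (t : Bool → D → Bool × D) (s₀ : Bool) (ext : Bool → Option D) (next : Bool → Q)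
    (hq : instr q = .sweep t s₀ ext next) (s : Bool) (l₁ l : List D)
    (out : List O) (B : ℕ) (hB : (l₁ ++ l).length + 1 ≤ B) :
    ForcedPath ((sweepTM instr q₀ acc).Step x)
      (fun c => (∀ q', c.state ≠ .idle q') ∧ ∀ i, c.head i ≤ B)
      (sweepConf instr q₀ acc (.run q s) p (l₁ ++ l) (l₁.length + 1) out)
      (sweepConf instr q₀ acc (.idle (next (sweepRun t s l).1)) p
        (l₁ ++ (sweepRun t s l).2 ++ (ext (sweepRun t s l).1).toList) 0 out) := by
  induction l generalizing s l₁ with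
  | nil =>
    simp only [sweepRun, List.append_nil]
    refine .head ⟨SweepCtl.run_ne_idle q s, fun i => ?_⟩ (fun d => ?_)
      (sweep_back instr q₀ acc x _ p hp _ l₁.length out B ?_)
    · simpa [sweepConf] using hB
    · rw [sweepTM_step_of_eq instr q₀ acc x _ (.back (next s)) p l₁ (l₁ ++ (ext s).toList) _ out
        .stay .left ((ext s).elim .blank .dig) none ?_ (tapeOf_extend _ _)]
      · simp [Move.apply, hp]
      · simp [sweepDelta, hq, tapeOf]
    · simp at hB; omega
  | cons d l ih =>
    have := ih (t s d).1 (l₁ ++ [(t s d).2]) (by simpa using hB)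
    simp only [sweepRun]
    simp only [List.append_assoc, List.singleton_append, List.length_append, List.length_singleton]
      at this ⊢
    refine .head ⟨SweepCtl.run_ne_idle q s, fun i => ?_⟩ (fun d' => ?_) this
    · simp [sweepConf] at hB ⊢; omega
    · rw [sweepTM_step_of_eq instr q₀ acc x _ (.run q (t s d).1) p _ (l₁ ++ (t s d).2 :: l) _ out
        .stay .right (.dig (t s d).2) none ?_ (tapeOf_update _ _ _ _)]
      · simp [Move.apply, hp]
      · simp [sweepDelta, hq, tapeOf]

/-- The Turing machine simulates the sweep machine as long as the number of digits is bounded. -/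
theorem sweepTM_simulates (x : List I) (B : ℕ) (Inv : SweepConf Q D O → Prop)
    (hInv : ∀ c d, Inv c → SweepStep instr x c d → Inv d)
    (hb : ∀ c, Inv c → c.digits.length ≤ B ∧ c.pos ≤ x.length + 1) :
    Simulates (SweepStep instr x) ((sweepTM instr q₀ acc).Step x)
      (fun c => (∀ q', c.state ≠ .idle q') ∧ ∀ i, c.head i ≤ B + 1)
      (fun c b => Inv c ∧ b = sweepConf instr q₀ acc (.idle c.state) c.pos c.digits 0 c.out) := by
  rintro c b ⟨hc, rfl⟩
  obtain ⟨hB, hp⟩ := hb c hc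
  have upd : Function.update (tapeOf c.digits) 0 (tapeOf c.digits 0) = tapeOf c.digits :=
    Function.update_eq_self _ _
  have hstep : ∀ d, SweepStep instr x c d ↔ (instr c.state).Step x c d := fun d => Iff.rfl
  cases hi : instr c.state with
  | halt =>
    right
    constructor
    · intro d hd
      rw [sweepTM_step_iff] at hd
      simp [sweepDelta, hi] at hd
    · intro d hd
      simp [hstep, hi, SweepInstr.Step] at hd
  | choose l =>
    right
    constructor
    · intro d hd
      rw [sweepTM_step_iff] at hd
      simp only [sweepDelta, hi] at hd
      obtain ⟨a, ⟨q', hq', rfl⟩, rfl⟩ := hd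
      have hs : SweepStep instr x c { c with state := q' } := by
        rw [hstep, hi]; exact ⟨q', hq', rfl⟩
      refine ⟨_, hs, hInv _ _ hc hs, ?_⟩
      rw [sweepTM_next instr q₀ acc x _ _ _ _ _ _ _ _ _ _ _ upd]
      simp [Move.apply, hp]
    · intro d hd
      have hd' := hd
      rw [hstep, hi] at hd
      obtain ⟨q', hq', rfl⟩ := hd
      refine ⟨_, ?_, hInv _ _ hc hd', rfl⟩
      rw [sweepTM_step_iff]
      refine ⟨act (.idle q') .stay (tapeOf c.digits 0) .stay none, ?_, ?_⟩
      · simp only [sweepDelta, hi]; exact ⟨q', hq', rfl⟩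
      · rw [sweepTM_next instr q₀ acc x _ _ _ _ _ _ _ _ _ _ _ upd]
        simp [Move.apply, hp]
  | input f =>
    left
    have hs : ∀ d, SweepStep instr x c d ↔ d = _ := fun d => by rw [hstep, hi, SweepInstr.Step]
    refine ⟨_, _, _, hs, fun d => ?_, .refl _, hInv _ _ hc ((hs _).2 rfl), rfl⟩
    refine sweepTM_step_of_eq instr q₀ acc x _ (.idle (f (readInput x c.pos)).1) _ _ _ _ _
      (f (readInput x c.pos)).2.1 .stay _ (f (readInput x c.pos)).2.2 ?_ upd d
    simp only [sweepDelta, hi]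
  | sweep t s ext next =>
    left
    have hs : ∀ d, SweepStep instr x c d ↔ d = _ := fun d => by rw [hstep, hi, SweepInstr.Step]
    refine ⟨_, sweepConf instr q₀ acc (.run c.state s) c.pos c.digits 1 c.out, _, hs,
      fun d => ?_, ?_, hInv _ _ hc ((hs _).2 rfl), rfl⟩
    · rw [sweepTM_step_of_eq instr q₀ acc x _ (.run c.state s) _ _ c.digits _ _ .stay .right
        (tapeOf c.digits 0) none _ upd]
      · simp [Move.apply, hp]
      · simp only [sweepDelta, hi]
    · exact sweep_run instr q₀ acc x c.state c.pos hp t s ext next hi s [] c.digits c.out (B + 1)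
        (by simpa using hB)

theorem sweepTM_boot (x : List I) :
    ∀ d, (sweepTM instr q₀ acc).Step x (sweepTM instr q₀ acc).init d ↔
      d = sweepConf instr q₀ acc (.idle q₀) 0 [] 0 [] := by
  intro d
  have : ∀ d, (sweepTM instr q₀ acc).Step x (sweepTM instr q₀ acc).init d ↔
      d = (sweepTM instr q₀ acc).next x (sweepTM instr q₀ acc).init
        (act (.idle q₀) .stay .left .stay none) := by
    intro d
    constructor
    · rintro ⟨a, ha, rfl⟩
      obtain rfl : a = _ := ha
      rfl
    · rintro rfl
      exact ⟨_, rfl, rfl⟩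
  rw [this]
  apply Eq.congr_right
  simp only [Machine.next, Machine.init, sweepConf, act, Move.apply]
  congr 1
  · funext i j
    change Function.update (fun _ => TapeSym.blank) 0 TapeSym.left j = tapeOf [] j
    rcases j with _ | j
    · simp [tapeOf]
    · rw [Function.update_of_ne (by omega)]; rfl

theorem sweepTM_deterministic (h : ∀ q l, instr q ≠ .choose l) :
    (sweepTM instr q₀ acc).Deterministic := by
  intro q a g
  change Fin 1 → TapeSym D at g
  change (sweepDelta instr q₀ q a (g 0)).Subsingleton
  unfold sweepDelta
  rcases q with _ | q | ⟨q, s⟩ | q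
  · exact Set.subsingleton_singleton
  · cases hi : instr q <;> simp_all
  · dsimp only
    split <;> simp
  · cases hg : g 0 <;> simp

end

end Sweep

end RamseyWords

namespace RamseyWords

/-! ### Register programs and their compilation -/

noncomputable section Registers

open scoped Classical

set_option linter.unusedSectionVars false

/-- Instructions of a machine whose registers hold positions of the input; the registers in `V`
are read-only, those in `W` are read-write, and `none` stands for the number zero. -/
inductive RegInstr (Q V W I O : Type) where
  | halt
  | choose (l : List Q)
  | emit (o : O) (q : Q)
  | read (i j : Option (V ⊕ W)) (next : Option I → Q)
  | cmp (i j : V ⊕ W) (next : Bool → Q)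
  | assign (g : W → Option (V ⊕ W)) (q : Q)
  | incr (i : W) (q : Q)

structure RegConf (Q W O : Type) where
  state : Q
  regs : W → ℕ
  out : List O

variable {Q V W I O : Type}

def regLookup (v : V → ℕ) (u : W → ℕ) (i : Option (V ⊕ W)) : ℕ := i.elim 0 (Sum.elim v u)

/-- The effect of a deterministic instruction. -/
def RegInstr.exec (x : List I) (v : V → ℕ) (u : W → ℕ) (out : List O) :
    RegInstr Q V W I O → Option (RegConf Q W O)
  | .halt => none
  | .choose _ => none
  | .emit o q => some ⟨q, u, out ++ [o]⟩
  | .read i j next => some ⟨next x[regLookup v u i + regLookup v u j]?, u, out⟩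
  | .cmp i j next => some ⟨next (decide (Sum.elim v u i ≤ Sum.elim v u j)), u, out⟩
  | .assign g q => some ⟨q, fun w => regLookup v u (g w), out⟩
  | .incr i q => some ⟨q, if u i < x.length then Function.update u i (u i + 1) else u, out⟩

def RegStep (instr : Q → RegInstr Q V W I O) (x : List I) (v : V → ℕ) (c d : RegConf Q W O) :
    Prop :=
  match instr c.state with
  | .choose l => ∃ q ∈ l, d = { c with state := q }
  | i => i.exec x v c.regs c.out = some d

theorem regStep_iff_of_exec {instr : Q → RegInstr Q V W I O} {x : List I} {v : V → ℕ}
    {c c' : RegConf Q W O} (h : (instr c.state).exec x v c.regs c.out = some c')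
    (d : RegConf Q W O) : RegStep instr x v c d ↔ d = c' := by
  unfold RegStep
  cases hi : instr c.state <;> simp_all [RegInstr.exec, eq_comm]

/-- With the least significant bit first, carries travel in the direction of a sweep and numbers
grow at the free end of the tape. -/
def bitVal : List Bool → ℕ
  | [] => 0
  | b :: l => b.toNat + 2 * bitVal l

theorem bitVal_lt (l : List Bool) : bitVal l < 2 ^ l.length := by
  induction l with
  | nil => simp [bitVal]
  | cons b l ih => cases b <;> simp [bitVal, pow_succ] <;> omega

/-- The number in track `r` of a list of digits. -/
def trackVal {R : Type} (l : List (R → Bool)) (r : R) : ℕ := bitVal (l.map (· r))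

section Tracks

variable {R : Type} [DecidableEq R]

theorem trackVal_nil (r : R) : trackVal ([] : List (R → Bool)) r = 0 := rfl

theorem trackVal_cons (d : R → Bool) (l : List (R → Bool)) (r : R) :
    trackVal (d :: l) r = (d r).toNat + 2 * trackVal l r := rfl

theorem trackVal_lt (l : List (R → Bool)) (r : R) : trackVal l r < 2 ^ l.length := by
  simpa [trackVal] using bitVal_lt (l.map (· r))

theorem trackVal_concat (l : List (R → Bool)) (d : R → Bool) (r : R) :
    trackVal (l ++ [d]) r = trackVal l r + (d r).toNat * 2 ^ l.length := by
  induction l with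
  | nil => simp [trackVal_cons, trackVal_nil]
  | cons a l ih =>
    rw [List.cons_append, trackVal_cons, trackVal_cons, ih, List.length_cons, pow_succ]
    ring

/-- The transducer state is the carry here and the borrow in `decSweep`. -/
def incSweep (r : R) (c : Bool) (d : R → Bool) : Bool × (R → Bool) :=
  (c && d r, Function.update d r (xor c (d r)))

def decSweep (r : R) (c : Bool) (d : R → Bool) : Bool × (R → Bool) :=
  (c && !d r, Function.update d r (xor c (d r)))

/-- The state compares the digits seen so far; a difference in a later digit is more significant and
overrides it. -/
def leSweep (i j : R) (c : Bool) (d : R → Bool) : Bool × (R → Bool) :=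
  (if d i = d j then c else d j, d)

def mapSweep (g : (R → Bool) → R → Bool) (c : Bool) (d : R → Bool) : Bool × (R → Bool) :=
  (c, g d)

theorem sweepRun_inc (r : R) (c : Bool) (l : List (R → Bool)) :
    trackVal (sweepRun (incSweep r) c l).2 r + (sweepRun (incSweep r) c l).1.toNat * 2 ^ l.length =
      trackVal l r + c.toNat := by
  induction l generalizing c with
  | nil => simp [sweepRun, trackVal_nil]
  | cons d l ih =>
    have := ih (c && d r)
    simp only [sweepRun, incSweep, trackVal_cons, Function.update_self, List.length_cons,
      pow_succ] at this ⊢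
    generalize sweepRun (incSweep r) (c && d r) l = res at this ⊢
    obtain ⟨b, l'⟩ := res
    dsimp only at this ⊢
    cases b <;> cases c <;> cases hd : d r <;> simp [hd] at this ⊢ <;> omega

theorem sweepRun_inc_other (r : R) (c : Bool) (l : List (R → Bool)) {r' : R} (h : r' ≠ r) :
    trackVal (sweepRun (incSweep r) c l).2 r' = trackVal l r' := by
  induction l generalizing c with
  | nil => rfl
  | cons d l ih => simp [sweepRun, trackVal_cons, ih, incSweep, h]

theorem sweepRun_dec (r : R) (c : Bool) (l : List (R → Bool)) :
    trackVal (sweepRun (decSweep r) c l).2 r + c.toNat =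
      trackVal l r + (sweepRun (decSweep r) c l).1.toNat * 2 ^ l.length := by
  induction l generalizing c with
  | nil => simp [sweepRun, trackVal_nil]
  | cons d l ih =>
    have := ih (c && !d r)
    simp only [sweepRun, decSweep, trackVal_cons, Function.update_self, List.length_cons,
      pow_succ] at this ⊢
    generalize sweepRun (decSweep r) (c && !d r) l = res at this ⊢
    obtain ⟨b, l'⟩ := res
    dsimp only at this ⊢
    cases b <;> cases c <;> cases hd : d r <;> simp [hd] at this ⊢ <;> omega

theorem sweepRun_dec_other (r : R) (c : Bool) (l : List (R → Bool)) {r' : R} (h : r' ≠ r) :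
    trackVal (sweepRun (decSweep r) c l).2 r' = trackVal l r' := by
  induction l generalizing c with
  | nil => rfl
  | cons d l ih => simp [sweepRun, trackVal_cons, ih, decSweep, h]

/-- A borrow that leaves the last digit reveals the value zero. The track then contains only ones,
which does no harm: only the scratch track is ever decremented. -/
theorem sweepRun_dec_zero (r : R) (l : List (R → Bool)) (h : trackVal l r = 0) :
    (sweepRun (decSweep r) true l).1 = true := by
  have h1 := sweepRun_dec r true l
  cases hb : (sweepRun (decSweep r) true l).1
  · rw [hb] at h1; simp at h1; omega
  · rfl

theorem sweepRun_dec_succ (r : R) (l : List (R → Bool)) {m : ℕ} (h : trackVal l r = m + 1) :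
    (sweepRun (decSweep r) true l).1 = false ∧
      trackVal (sweepRun (decSweep r) true l).2 r = m := by
  have h1 := sweepRun_dec r true l
  have h2 := trackVal_lt (sweepRun (decSweep r) true l).2 r
  rw [length_sweepRun] at h2
  cases hb : (sweepRun (decSweep r) true l).1
  · rw [hb] at h1; simp at h1; exact ⟨rfl, by omega⟩
  · rw [hb] at h1; simp at h1; omega

theorem sweepRun_le (i j : R) (c : Bool) (l : List (R → Bool)) :
    (sweepRun (leSweep i j) c l).2 = l ∧ (sweepRun (leSweep i j) c l).1 =
      if trackVal l i = trackVal l j then c else decide (trackVal l i < trackVal l j) := by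
  induction l generalizing c with
  | nil => simp [sweepRun, trackVal_nil]
  | cons d l ih =>
    refine ⟨by simp [sweepRun, leSweep, (ih _).1], ?_⟩
    simp only [sweepRun, leSweep, (ih _).2, trackVal_cons]
    rcases Bool.eq_false_or_eq_true (d i) with hi | hi <;>
    rcases Bool.eq_false_or_eq_true (d j) with hj | hj <;>
    simp only [hi, hj, Bool.toNat_true, Bool.toNat_false] <;> split_ifs <;> simp_all <;> omega

theorem sweepRun_map (g : (R → Bool) → R → Bool) (c : Bool) (l : List (R → Bool)) :
    sweepRun (mapSweep g) c l = (c, l.map g) := by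
  induction l with
  | nil => rfl
  | cons d l ih => simp [sweepRun, mapSweep, ih]

theorem trackVal_map (g : (R → Bool) → R → Bool) (l : List (R → Bool)) (r : R) (o : Option R)
    (h : ∀ d, g d r = o.elim false d) :
    trackVal (l.map g) r = o.elim 0 (trackVal l) := by
  induction l with
  | nil => cases o <;> rfl
  | cons d l ih =>
    rw [List.map_cons, trackVal_cons, ih, h]
    cases o <;> simp [trackVal_cons]

end Tracks

/-- The input head cannot jump to a position that is given in binary. From `main` it walks to the
left end; `load` copies a register to the scratch track `none`; `count` and `move` alternately
decrement this track and move the head. The flag tells whether the first or the second summand is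
processed. `look` reads the symbol, and `bump` is the actual increment. -/
inductive SeekCtl (Q : Type) where
  | main (q : Q)
  | load (q : Q) (b : Bool)
  | count (q : Q) (b : Bool)
  | move (q : Q) (b : Bool)
  | look (q : Q)
  | bump (q : Q)

instance [Finite Q] : Finite (SeekCtl Q) := by
  refine Finite.of_injective (β := Fin 6 × Q × Bool) (fun
    | .main q => (0, q, true)
    | .load q b => (1, q, b)
    | .count q b => (2, q, b)
    | .move q b => (3, q, b)
    | .look q => (4, q, true)
    | .bump q => (5, q, true)) ?_
  rintro (_ | _ | _ | _ | _ | _) (_ | _ | _ | _ | _ | _) h <;> simp_all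

def writable : Option (Empty ⊕ W) → Option W
  | some (.inr w) => some w
  | _ => none

theorem regLookup_empty (v : Empty → ℕ) (u : W → ℕ) (i : Option (Empty ⊕ W)) :
    regLookup v u i = (writable i).elim 0 u := by
  rcases i with _ | i | i
  · rfl
  · exact i.elim
  · rfl

/-- The registers whose sum is the position of the input that the instruction looks at. -/
def RegInstr.seekReg : RegInstr Q Empty W I O → Bool → Option W
  | .read i j _, b => writable (if b then j else i)
  | .incr i _, b => if b then none else some i
  | _, _ => none

def InSym.toOption : InSym I → Option I
  | .sym a => some a
  | _ => none

theorem toOption_readInput (x : List I) (p : ℕ) : (readInput x (p + 1)).toOption = x[p]? := by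
  simp only [readInput]
  cases x[p]? <;> rfl

def seekSweep (instr : Q → RegInstr Q Empty W I O) :
    SeekCtl Q → SweepInstr (SeekCtl Q) (Option W → Bool) I O
  | .main q =>
    match instr q with
    | .halt => .halt
    | .choose l => .choose (l.map .main)
    | .emit o q' => .input fun _ => (.main q', .stay, some o)
    | .cmp i j next =>
      .sweep (leSweep (writable (some i)) (writable (some j))) true (fun _ => none)
        fun b => .main (next b)
    | .assign g q' =>
      .sweep (mapSweep fun d r => r.elim false fun w => (writable (g w)).elim false (d ∘ some)) true
        (fun _ => none) fun _ => .main q'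
    | _ => .input fun a =>
      match a with
      | .leftEnd => (.load q false, .right, none)
      | _ => (.main q, .left, none)
  | .load q b =>
    .sweep (mapSweep fun d r =>
      r.elim (((instr q).seekReg b).elim false (d ∘ some)) fun w => d (some w)) true
      (fun _ => none) fun _ => .count q b
  | .count q b =>
    .sweep (decSweep none) true (fun _ => none)
      fun z => if z then (if b then .look q else .load q true) else .move q b
  | .move q b => .input fun _ => (.count q b, .right, none)
  | .look q => .input fun a =>
    match instr q with
    | .read _ _ next => (.main (next a.toOption), .stay, none)
    | .incr _ q' => (if a.toOption.isSome then .bump q else .main q', .stay, none)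
    | _ => (.main q, .stay, none)
  | .bump q =>
    match instr q with
    | .incr i q' =>
      .sweep (incSweep (some i)) true
        (fun c => if c then some fun r => decide (r = some i) else none) fun _ => .main q'
    | _ => .halt

/-- Points of a run of the sweep machine that do not correspond to an accepting state. -/
structure SeekInv (acc : Set Q) (n : ℕ) (b : SweepConf (SeekCtl Q) (Option W → Bool) O) :
    Prop where
  notAcc : ∀ q ∈ acc, b.state ≠ .main q
  length_le : b.digits.length ≤ n.size
  pos_le : b.pos ≤ n + 1

/-- The scratch track is left unconstrained, and so is the input head up to the bound on its
position. -/
structure SeekRep (n : ℕ) (c : RegConf Q W O) (b : SweepConf (SeekCtl Q) (Option W → Bool) O) :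
    Prop where
  state_eq : b.state = .main c.state
  out_eq : b.out = c.out
  regs_eq : ∀ w, trackVal b.digits (some w) = c.regs w
  regs_le : ∀ w, c.regs w ≤ n
  length_le : b.digits.length ≤ n.size
  pos_le : b.pos ≤ n + 1

def SameRegs (l l' : List (Option W → Bool)) : Prop :=
  l'.length = l.length ∧ ∀ w, trackVal l' (some w) = trackVal l (some w)

theorem SameRegs.trans {l₁ l₂ l₃ : List (Option W → Bool)} (h : SameRegs l₁ l₂)
    (h' : SameRegs l₂ l₃) : SameRegs l₁ l₃ :=
  ⟨h'.1.trans h.1, fun w => (h'.2 w).trans (h.2 w)⟩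

section

variable (instr : Q → RegInstr Q Empty W I O) (x : List I) (acc : Set Q)

theorem seek_count (q : Q) (b : Bool) (p : ℕ) (hp : p ≤ x.length + 1)
    (l : List (Option W → Bool)) (hl : l.length ≤ x.length.size) (out : List O) (m : ℕ)
    (hm : trackVal l none = m) :
    ∃ l', SameRegs l l' ∧ ForcedPath (SweepStep (seekSweep instr) x) (SeekInv acc x.length)
      ⟨.count q b, p, l, out⟩
      ⟨if b then .look q else .load q true, min (p + m) (x.length + 1), l', out⟩ := by
  classical
  induction m generalizing p l with
  | zero =>
    refine ⟨(sweepRun (decSweep none) true l).2, ⟨length_sweepRun _ _ _, fun w =>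
      sweepRun_dec_other _ _ _ (by simp)⟩, .single ⟨by simp, hl, hp⟩ fun d => ?_⟩
    have h := sweepRun_dec_zero none l hm
    simp only [SweepStep, seekSweep, SweepInstr.Step]
    convert_to d = _ ↔ _ using 1
    rw [show (sweepRun (decSweep none) true l).1 = true by convert h]
    simp [hp]
  | succ m ih =>
    have h := sweepRun_dec_succ none l hm
    have hlen : (sweepRun (decSweep none) true l).2.length = l.length := length_sweepRun _ _ _
    obtain ⟨l', hl', hpath⟩ := ih (min (p + 1) (x.length + 1)) (by omega)
      (sweepRun (decSweep none) true l).2 (by omega) h.2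
    refine ⟨l', SameRegs.trans ⟨hlen, fun w => sweepRun_dec_other _ _ _ (by simp)⟩ hl', ?_⟩
    have e : min (min (p + 1) (x.length + 1) + m) (x.length + 1) =
      min (p + (m + 1)) (x.length + 1) := by omega
    rw [e] at hpath
    refine .head (b₁ := ⟨.move q b, p, (sweepRun (decSweep none) true l).2, out⟩)
      ⟨by simp, hl, hp⟩ (fun d => ?_) (.head ⟨by simp, by simpa [hlen] using hl, hp⟩
        (fun d => ?_) hpath)
    · simp only [SweepStep, seekSweep, SweepInstr.Step]
      rw [show (sweepRun (decSweep none) true l).1 = false by convert h.1]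
      simp
    · simp [SweepStep, seekSweep, SweepInstr.Step, Move.apply]

theorem seek_load (q : Q) (b : Bool) (p : ℕ) (hp : p ≤ x.length + 1)
    (l : List (Option W → Bool)) (hl : l.length ≤ x.length.size) (out : List O) :
    ∃ l', SameRegs l l' ∧ ForcedPath (SweepStep (seekSweep instr) x) (SeekInv acc x.length)
      ⟨.load q b, p, l, out⟩
      ⟨if b then .look q else .load q true,
        min (p + ((instr q).seekReg b).elim 0 (trackVal l ∘ some)) (x.length + 1), l', out⟩ := by
  classical
  set g : (Option W → Bool) → Option W → Bool := fun d r =>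
      r.elim (((instr q).seekReg b).elim false (d ∘ some)) fun w => d (some w) with hg
  have hmap : SameRegs l (l.map g) := ⟨by simp, fun w =>
    (trackVal_map g l (some w) (some (some w)) (by simp [hg])).trans rfl⟩
  have hnone : trackVal (l.map g) none = ((instr q).seekReg b).elim 0 (trackVal l ∘ some) := by
    rw [trackVal_map g l none (((instr q).seekReg b).map some)]
    · cases (instr q).seekReg b <;> rfl
    · intro d
      cases h : (instr q).seekReg b <;> simp [hg, h]
  obtain ⟨l', hl', hpath⟩ := seek_count instr x acc q b p hp (l.map g) (by simpa using hl) out _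
    hnone
  refine ⟨l', hmap.trans hl', .head ⟨by simp, hl, hp⟩ (fun d => ?_) hpath⟩
  simp only [SweepStep, seekSweep, SweepInstr.Step, sweepRun_map]
  simp [hg]

/-- Induction on the head position covers the walk to the left end; after it, each summand is
counted down once. The final `+ 1` appears because the symbol with index `i` is in cell `i + 1`. The
first step is stated separately, as `Simulates` demands it. -/
theorem seek_look (q : Q) (hq : (∃ i j next, instr q = .read i j next) ∨ ∃ i q', instr q = .incr i q')
    (hacc : ∀ q ∈ acc, instr q = .halt) (p : ℕ) (hp : p ≤ x.length + 1)
    (l : List (Option W → Bool)) (hl : l.length ≤ x.length.size) (out : List O) :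
    ∃ b₁ l', SameRegs l l' ∧
      (∀ d, SweepStep (seekSweep instr) x ⟨.main q, p, l, out⟩ d ↔ d = b₁) ∧
      ForcedPath (SweepStep (seekSweep instr) x) (SeekInv acc x.length) b₁
      ⟨.look q, min (((instr q).seekReg false).elim 0 (trackVal l ∘ some) +
        ((instr q).seekReg true).elim 0 (trackVal l ∘ some)) x.length + 1, l', out⟩ := by
  have hstep : ∀ p d, SweepStep (seekSweep instr) x ⟨.main q, p, l, out⟩ d ↔
      (SweepInstr.input (D := Option W → Bool) (O := O) fun a : InSym I =>
        match a with
        | .leftEnd => (SeekCtl.load q false, Move.right, none)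
        | _ => (.main q, .left, none)).Step x ⟨.main q, p, l, out⟩ d := by
    intro p d
    simp only [SweepStep, seekSweep]
    rcases hq with ⟨i, j, next, h⟩ | ⟨i, q', h⟩ <;> rw [h]
  -- During the walk the state remains `main q`; this is no acceptance, since accepting states halt
  -- and `q` does not.
  have hq' : ∀ q' ∈ acc, SeekCtl.main q ≠ .main q' := by
    rintro q' hq' h
    injection h with h
    have := hacc q' hq'
    rw [← h] at this
    rcases hq with ⟨i, j, next, h⟩ | ⟨i, q', h⟩ <;> rw [h] at this <;> cases this
  induction p with
  | zero =>
    obtain ⟨l₁, hl₁, hpath₁⟩ := seek_load instr x acc q false 1 (by omega) l hl out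
    obtain ⟨l₂, hl₂, hpath₂⟩ := seek_load instr x acc q true
      (min (1 + ((instr q).seekReg false).elim 0 (trackVal l ∘ some)) (x.length + 1)) (by omega) l₁
      (by rw [hl₁.1]; exact hl) out
    have e : trackVal l₁ ∘ some = trackVal l ∘ some := funext hl₁.2
    refine ⟨⟨.load q false, 1, l, out⟩, l₂, hl₁.trans hl₂, fun d => ?_, hpath₁.trans ?_⟩
    · rw [hstep]
      simp [SweepInstr.Step, readInput, Move.apply]
    · rw [e] at hpath₂
      have e' : ∀ a b : ℕ, min (min (1 + a) (x.length + 1) + b) (x.length + 1) =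
        min (a + b) x.length + 1 := fun a b => by omega
      rw [e'] at hpath₂
      exact hpath₂
  | succ p ih =>
    obtain ⟨b₁, l', hl', hs, hpath⟩ := ih (by omega)
    refine ⟨⟨.main q, p, l, out⟩, l', hl', fun d => ?_, .head ⟨hq', hl, by simp; omega⟩ hs hpath⟩
    rw [hstep]
    simp only [SweepInstr.Step, readInput]
    have : min p (x.length + 1) = p := by omega
    cases h : x[p]? <;> simp [Move.apply, this]

theorem seekSweep_simulates (v : Empty → ℕ) (hacc : ∀ q ∈ acc, instr q = .halt) :
    Simulates (RegStep instr x v) (SweepStep (seekSweep instr) x) (SeekInv acc x.length)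
      (SeekRep x.length) := by
  classical
  rintro ⟨q, u, out'⟩ ⟨s, p, l, out⟩ ⟨hs, ho, hu, hun, hl, hp⟩
  dsimp only at hs ho hu hun hl hp
  subst hs ho
  have hlk : ∀ o : Option W, o.elim 0 (trackVal l ∘ some) = o.elim 0 u := by
    rintro (_ | w)
    · rfl
    · exact hu w
  have hel : ∀ o : Empty ⊕ W, trackVal l (writable (some o)) = Sum.elim v u o := by
    rintro (e | w)
    · exact e.elim
    · exact hu w
  have hstep : ∀ d, SweepStep (seekSweep instr) x ⟨.main q, p, l, out⟩ d ↔
    (seekSweep instr (.main q)).Step x ⟨.main q, p, l, out⟩ d := fun d => Iff.rfl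
  have hle : ∀ o, regLookup v u o ≤ x.length := by
    intro o
    rw [regLookup_empty]
    cases writable o with
    | none => simp
    | some w => exact hun w
  cases hi : instr q with
  | halt =>
    right
    constructor
    · intro d hd
      rw [hstep] at hd
      simp [seekSweep, hi, SweepInstr.Step] at hd
    · intro d hd
      simp [RegStep, hi, RegInstr.exec] at hd
  | choose c =>
    right
    constructor
    · intro d hd
      rw [hstep] at hd
      simp only [seekSweep, hi, SweepInstr.Step, List.mem_map] at hd
      obtain ⟨_, ⟨q', hq', rfl⟩, rfl⟩ := hd
      exact ⟨⟨q', u, out⟩, by simp only [RegStep, hi]; exact ⟨q', hq', rfl⟩,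
        ⟨rfl, rfl, hu, hun, hl, hp⟩⟩
    · intro d hd
      simp only [RegStep, hi] at hd
      obtain ⟨q', hq', rfl⟩ := hd
      refine ⟨⟨.main q', p, l, out⟩, ?_, ⟨rfl, rfl, hu, hun, hl, hp⟩⟩
      rw [hstep]
      simp only [seekSweep, hi, SweepInstr.Step, List.mem_map]
      exact ⟨_, ⟨q', hq', rfl⟩, rfl⟩
  | emit o q' =>
    left
    refine ⟨_, ⟨.main q', p, l, out ++ [o]⟩, _, regStep_iff_of_exec (by simp only [hi]; rfl), ?_,
      .refl _, ⟨rfl, rfl, hu, hun, hl, hp⟩⟩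
    intro d
    rw [hstep]
    simp [seekSweep, hi, SweepInstr.Step, Move.apply, hp]
  | cmp i j next =>
    left
    refine ⟨_, ⟨.main (next (decide (Sum.elim v u i ≤ Sum.elim v u j))), p, l, out⟩, _,
      regStep_iff_of_exec (by simp only [hi]; rfl), ?_,
      .refl _, ⟨rfl, rfl, hu, hun, hl, hp⟩⟩
    intro d
    rw [hstep]
    simp only [seekSweep, hi, SweepInstr.Step]
    rw [(sweepRun_le _ _ _ _).1, (sweepRun_le _ _ _ _).2, hel, hel]
    have : (if Sum.elim v u i = Sum.elim v u j then true
        else decide (Sum.elim v u i < Sum.elim v u j)) =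
        decide (Sum.elim v u i ≤ Sum.elim v u j) := by
      split_ifs with h
      · simp [h]
      · simp only [decide_eq_decide]; omega
    rw [this]
    simp
  | assign g q' =>
    left
    refine ⟨_, ⟨.main q', p, l.map (fun d r =>
        r.elim false fun w => (writable (g w)).elim false (d ∘ some)), out⟩, _,
      regStep_iff_of_exec (by simp only [hi]; rfl), fun d => ?_,
      .refl _, ⟨rfl, rfl, fun w => ?_, fun w => hle _, ?_, hp⟩⟩
    · rw [hstep]
      simp only [seekSweep, hi, SweepInstr.Step]
      rw [sweepRun_map]
      simp
    · dsimp only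
      rw [trackVal_map _ l (some w) ((writable (g w)).map some), regLookup_empty, ← hlk]
      · cases writable (g w) <;> rfl
      · intro d
        cases h : writable (g w) <;> simp [h]
    · simpa using hl
  | read i j next =>
    left
    obtain ⟨b₁, l', hl', hs, hpath⟩ := seek_look instr x acc q (.inl ⟨i, j, next, hi⟩) hacc p hp l
      hl out
    refine ⟨_, b₁, ⟨.main (next x[regLookup v u i + regLookup v u j]?),
        min (regLookup v u i + regLookup v u j) x.length + 1, l', out⟩,
      regStep_iff_of_exec (by simp only [hi]; rfl), hs, hpath.trans (.single ⟨by simp,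
        by simpa [hl'.1] using hl, by simp⟩ fun d => ?_), ⟨rfl, rfl, fun w => ?_, hun, ?_, ?_⟩⟩
    · have e : min (regLookup v u i + regLookup v u j) x.length =
          min (((instr q).seekReg false).elim 0 (trackVal l ∘ some) +
        ((instr q).seekReg true).elim 0 (trackVal l ∘ some)) x.length := by
        rw [hlk, hlk, hi, regLookup_empty, regLookup_empty]; rfl
      simp only [SweepStep, seekSweep, SweepInstr.Step]
      rw [← e]
      simp only [hi, toOption_readInput]
      have : x[min (regLookup v u i + regLookup v u j) x.length]? =
          x[regLookup v u i + regLookup v u j]? := by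
        rcases le_total (regLookup v u i + regLookup v u j) x.length with h | h
        · rw [min_eq_left h]
        · rw [min_eq_right h, List.getElem?_eq_none h, List.getElem?_eq_none le_rfl]
      rw [this]
      simp [Move.apply]
    · rw [hl'.2, hu]
    · simpa [hl'.1] using hl
    · simp
  | incr i q' =>
    left
    obtain ⟨b₁, l', hl', hs, hpath⟩ := seek_look instr x acc q (.inr ⟨i, q', hi⟩) hacc p hp l
      hl out
    have e : min (((instr q).seekReg false).elim 0 (trackVal l ∘ some) +
        ((instr q).seekReg true).elim 0 (trackVal l ∘ some)) x.length = u i := by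
      rw [hlk, hlk, hi]
      simp only [RegInstr.seekReg]
      simpa using hun i
    rw [e] at hpath
    have hui : u i + 1 ≤ x.length + 1 := by have := hun i; omega
    have hlook : ∀ d, SweepStep (seekSweep instr) x ⟨.look q, u i + 1, l', out⟩ d ↔
        d = ⟨if u i < x.length then .bump q else .main q', u i + 1, l', out⟩ := by
      intro d
      simp only [SweepStep, seekSweep, SweepInstr.Step, hi, toOption_readInput]
      by_cases h : u i < x.length
      · simp [h, Move.apply, hun i]
      · simp [h, Move.apply, hun i]
    have hexec := regStep_iff_of_exec (instr := instr) (x := x) (v := v) (c := ⟨q, u, out⟩)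
      (c' := ⟨q', if u i < x.length then Function.update u i (u i + 1) else u, out⟩)
      (by simp only [hi]; rfl)
    have hPlook : SeekInv acc x.length
        (⟨.look q, u i + 1, l', out⟩ : SweepConf (SeekCtl Q) (Option W → Bool) O) :=
      ⟨by simp, by simpa [hl'.1] using hl, hui⟩
    by_cases h : u i < x.length
    · simp only [h, if_true] at hlook hexec
      set r := sweepRun (incSweep (some i)) true l' with hr
      have hrlen : r.2.length = l'.length := length_sweepRun _ _ _
      have hinc := sweepRun_inc (some i) true l'
      rw [← hr, hl'.2, hu] at hinc
      have hoth : ∀ w, w ≠ i → trackVal r.2 (some w) = u w := fun w hw => by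
        rw [hr, sweepRun_inc_other _ _ _ (by simpa using hw), hl'.2, hu]
      refine ⟨_, b₁, ⟨.main q', u i + 1,
          r.2 ++ (if r.1 then some (fun r : Option W => decide (r = some i)) else none).toList, out⟩,
        hexec, hs,
        hpath.trans (.head hPlook hlook (.single ⟨by simp,
          by simpa [hl'.1] using hl, hui⟩ fun d => ?_)), ⟨rfl, rfl, fun w => ?_, fun w => ?_,
          ?_, hui⟩⟩
      · simp only [SweepStep, seekSweep, SweepInstr.Step, hi]
        rw [show sweepRun (incSweep (some i)) true l' = r from rfl]
      · dsimp only
        cases hb : r.1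
        · by_cases hw : w = i
          · subst hw
            rw [hb] at hinc
            simpa using hinc
          · simp [hw, hoth]
        · simp only [if_true, Option.toList_some, trackVal_concat]
          by_cases hw : w = i
          · subst hw
            rw [hb] at hinc
            simpa [hrlen] using hinc
          · simp [hw, hoth]
      · dsimp only
        by_cases hw : w = i
        · subst hw; simpa using h
        · simpa [hw] using hun w
      · dsimp only
        cases hb : r.1
        · simpa [hrlen, hl'.1] using hl
        · rw [hb] at hinc
          simp only [if_true, Option.toList_some, List.length_append, List.length_singleton]
          -- An outgoing carry forces `2 ^ l'.length ≤ u i + 1 ≤ x.length`, so one more digit stays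
          -- within the binary size of `x.length`.
          rw [Nat.succ_le_iff, Nat.lt_size, hrlen]
          simp at hinc
          omega
    · simp only [h, if_false] at hlook hexec
      exact ⟨_, b₁, ⟨.main q', u i + 1, l', out⟩, hexec, hs, hpath.trans (.single hPlook hlook),
        ⟨rfl, rfl, fun w => by rw [hl'.2, hu], hun, by simpa [hl'.1] using hl, hui⟩⟩

end

section Compile

variable [Finite Q] [Finite W] (instr : Q → RegInstr Q Empty W I O) (q₀ : Q) (acc : Set Q)

/-- The Turing machine that carries out a register program. -/
def regTM : Machine I O :=
  sweepTM (seekSweep instr) (.main q₀) (SeekCtl.main '' acc)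

theorem seek_reachable_inv (hacc : ∀ q ∈ acc, instr q = .halt) (x : List I)
    (b : SweepConf (SeekCtl Q) (Option W → Bool) O)
    (h : Relation.ReflTransGen (SweepStep (seekSweep instr) x) ⟨.main q₀, 0, [], []⟩ b) :
    (∃ a, Relation.ReflTransGen (RegStep instr x Empty.elim) ⟨q₀, fun _ => 0, []⟩ a ∧
      SeekRep x.length a b) ∨ SeekInv acc x.length b :=
  (seekSweep_simulates instr x acc Empty.elim hacc).backward
    ⟨rfl, rfl, fun _ => rfl, fun _ => Nat.zero_le _, Nat.zero_le _, Nat.zero_le _⟩ h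

theorem seek_reachable_bound (hacc : ∀ q ∈ acc, instr q = .halt) (x : List I)
    (b : SweepConf (SeekCtl Q) (Option W → Bool) O)
    (h : Relation.ReflTransGen (SweepStep (seekSweep instr) x) ⟨.main q₀, 0, [], []⟩ b) :
    b.digits.length ≤ x.length.size ∧ b.pos ≤ x.length + 1 := by
  rcases seek_reachable_inv instr q₀ acc hacc x b h with ⟨a, _, h⟩ | h
  · exact ⟨h.length_le, h.pos_le⟩
  · exact ⟨h.length_le, h.pos_le⟩

theorem regTM_simulates (hacc : ∀ q ∈ acc, instr q = .halt) (x : List I) :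
    Simulates (SweepStep (seekSweep instr) x) ((regTM instr q₀ acc).Step x)
      (fun c => (∀ q', c.state ≠ .idle q') ∧ ∀ i, c.head i ≤ x.length.size + 1)
      (fun c b => Relation.ReflTransGen (SweepStep (seekSweep instr) x) ⟨.main q₀, 0, [], []⟩ c ∧
        b = sweepConf _ _ _ (.idle c.state) c.pos c.digits 0 c.out) :=
  sweepTM_simulates _ _ _ x _ _ (fun _ _ h h' => h.tail h')
    (seek_reachable_bound instr q₀ acc hacc x)

theorem regTM_reachable (hacc : ∀ q ∈ acc, instr q = .halt) (x : List I)
    (d : Config (regTM instr q₀ acc)) (h : (regTM instr q₀ acc).Reachable x d) :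
    d = (regTM instr q₀ acc).init ∨
    (∃ b, Relation.ReflTransGen (SweepStep (seekSweep instr) x) ⟨.main q₀, 0, [], []⟩ b ∧
      d = sweepConf _ _ _ (.idle b.state) b.pos b.digits 0 b.out) ∨
    ((∀ q', d.state ≠ .idle q') ∧ ∀ i, d.head i ≤ x.length.size + 1) := by
  rcases Relation.ReflTransGen.cases_head h with h | ⟨c, hc, h⟩
  · exact .inl h.symm
  · right
    obtain rfl := (sweepTM_boot _ _ _ x _).1 hc
    rcases (regTM_simulates instr q₀ acc hacc x).backward
      (a₀ := ⟨.main q₀, 0, [], []⟩) ⟨.refl, rfl⟩ h with ⟨a, ha, _, h⟩ | h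
    · exact .inl ⟨a, ha, h⟩
    · exact .inr h

theorem regTM_logSpace (hacc : ∀ q ∈ acc, instr q = .halt) :
    (regTM instr q₀ acc).LogSpace := by
  refine ⟨2, fun x d hd i => ?_⟩
  -- The binary size is at most the logarithm plus one, and one more cell is taken by the end
  -- marker.
  have hs : x.length.size + 1 ≤ 2 * (Nat.log 2 x.length + 1) := by
    have : x.length.size ≤ Nat.log 2 x.length + 1 := by
      rw [Nat.size_le]
      exact Nat.lt_pow_succ_log_self (by norm_num) _
    omega
  rcases regTM_reachable instr q₀ acc hacc x d hd with rfl | ⟨b, _, rfl⟩ | h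
  · exact Nat.zero_le _
  · exact Nat.zero_le _
  · exact (h.2 i).trans hs

theorem regTM_forward (hacc : ∀ q ∈ acc, instr q = .halt) (x : List I) (a : RegConf Q W O)
    (h : Relation.ReflTransGen (RegStep instr x Empty.elim) ⟨q₀, fun _ => 0, []⟩ a) :
    ∃ d, (regTM instr q₀ acc).Reachable x d ∧ d.state = .idle (.main a.state) ∧ d.out = a.out := by
  obtain ⟨b, hb, hr⟩ := (seekSweep_simulates instr x acc Empty.elim hacc).forward
    (b₀ := ⟨.main q₀, 0, [], []⟩)
    ⟨rfl, rfl, fun _ => rfl, fun _ => Nat.zero_le _, Nat.zero_le _, Nat.zero_le _⟩ h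
  obtain ⟨d, hd, _, rfl⟩ := (regTM_simulates instr q₀ acc hacc x).forward
    (a₀ := ⟨.main q₀, 0, [], []⟩) ⟨.refl, rfl⟩ hb
  refine ⟨_, .head ((sweepTM_boot _ _ _ x _).2 rfl) hd, ?_, hr.out_eq⟩
  simp only [sweepConf, hr.state_eq]
  rfl

theorem regTM_accepts_iff (hacc : ∀ q ∈ acc, instr q = .halt) (x : List I) :
    (∃ d, (regTM instr q₀ acc).Reachable x d ∧ d.state ∈ (regTM instr q₀ acc).accept) ↔
      ∃ a, Relation.ReflTransGen (RegStep instr x Empty.elim) ⟨q₀, fun _ => 0, []⟩ a ∧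
        a.state ∈ acc := by
  constructor
  · rintro ⟨d, hd, _, ⟨q, hq, rfl⟩, hs⟩
    rcases regTM_reachable instr q₀ acc hacc x d hd with rfl | ⟨b, hb, rfl⟩ | h
    · exact absurd hs nofun
    · simp only [sweepConf, SweepCtl.idle.injEq] at hs
      rcases seek_reachable_inv instr q₀ acc hacc x b hb with ⟨a, ha, hr⟩ | h
      · rw [hr.state_eq] at hs
        injection hs with hs
        exact ⟨a, ha, hs ▸ hq⟩
      · exact absurd hs (h.notAcc q hq)
    · exact absurd hs (h.1 _)
  · rintro ⟨a, ha, hq⟩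
    obtain ⟨d, hd, hs, _⟩ := regTM_forward instr q₀ acc hacc x a ha
    exact ⟨d, hd, _, ⟨_, hq, rfl⟩, hs⟩

theorem regTM_deterministic (h : ∀ q l, instr q ≠ .choose l) :
    (regTM instr q₀ acc).Deterministic := by
  refine sweepTM_deterministic _ _ _ ?_
  rintro (q | _ | _ | _ | _ | q) l <;> simp only [seekSweep, ne_eq, reduceCtorEq, not_false_iff]
  · cases hi : instr q <;> simp_all
  · cases hi : instr q <;> simp

theorem regTM_enabled_empty (x : List I) (d : Config (regTM instr q₀ acc)) (q : Q)
    (hd : d.state = .idle (.main q)) (hq : instr q = .halt) :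
    (regTM instr q₀ acc).enabled x d = ∅ := by
  change sweepDelta (seekSweep instr) _ d.state _ _ = ∅
  rw [hd]
  simp [sweepDelta, seekSweep, hq]

end Compile

end Registers

end RamseyWords

namespace RamseyWords

/-! ### Program fragments and their closure properties -/

noncomputable section Fragments

open scoped Classical

set_option linter.unusedSectionVars false

variable {I O : Type}

/-- Renaming of states and registers of an instruction; registers outside the range of `ι` keep
their contents. -/
def RegInstr.map {Q Q' V V' W W' : Type} (f : Q → Q') (ρ : V → V' ⊕ W') (ι : W → W') :
    RegInstr Q V W I O → RegInstr Q' V' W' I O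
  | .halt => .halt
  | .choose l => .choose (l.map f)
  | .emit o q => .emit o (f q)
  | .read i j next => .read (i.map (Sum.elim ρ (Sum.inr ∘ ι))) (j.map (Sum.elim ρ (Sum.inr ∘ ι)))
      (f ∘ next)
  | .cmp i j next => .cmp (Sum.elim ρ (Sum.inr ∘ ι) i) (Sum.elim ρ (Sum.inr ∘ ι) j) (f ∘ next)
  | .assign g q => .assign (Function.extend ι (fun i => (g i).map (Sum.elim ρ (Sum.inr ∘ ι)))
      fun j => some (.inr j)) (f q)
  | .incr i q => .incr (ι i) (f q)

theorem RegInstr.exec_map {Q Q' V V' W W' : Type} {f : Q → Q'} {ρ : V → V' ⊕ W'} {ι : W → W'}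
    (hι : Function.Injective ι) {x : List I} {v : V → ℕ} {v' : V' → ℕ} {u : W → ℕ} {u' : W' → ℕ}
    (hv : ∀ a, Sum.elim v' u' (ρ a) = v a) (hu : u' ∘ ι = u) {out : List O}
    (ins : RegInstr Q V W I O) {c : RegConf Q W O} (h : ins.exec x v u out = some c) :
    ∃ u'', (ins.map f ρ ι).exec x v' u' out = some ⟨f c.state, u'', c.out⟩ ∧ u'' ∘ ι = c.regs ∧
      ∀ j, j ∉ Set.range ι → u'' j = u' j := by
  subst hu
  have hs : ∀ a, Sum.elim v' u' (Sum.elim ρ (Sum.inr ∘ ι) a) = Sum.elim v (u' ∘ ι) a := by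
    rintro (a | a)
    · exact hv a
    · rfl
  have hlk : ∀ o : Option (V ⊕ W), regLookup v' u' (o.map (Sum.elim ρ (Sum.inr ∘ ι))) =
      regLookup v (u' ∘ ι) o := by
    rintro (_ | a)
    · rfl
    · exact hs a
  cases ins with
  | halt => cases h
  | choose => cases h
  | emit o q =>
    obtain rfl := Option.some.inj h
    exact ⟨u', rfl, rfl, fun _ _ => rfl⟩
  | read i j next =>
    obtain rfl := Option.some.inj h
    refine ⟨u', ?_, rfl, fun _ _ => rfl⟩
    simp only [RegInstr.map, RegInstr.exec, hlk, Function.comp_apply]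
  | cmp i j next =>
    obtain rfl := Option.some.inj h
    refine ⟨u', ?_, rfl, fun _ _ => rfl⟩
    simp only [RegInstr.map, RegInstr.exec, hs, Function.comp_apply]
  | assign g q =>
    obtain rfl := Option.some.inj h
    refine ⟨_, rfl, ?_, ?_⟩
    · funext i
      simp only [Function.comp_apply, hι.extend_apply, hlk]
    · intro j hj
      rw [Function.extend_apply' _ _ _ (by simpa using hj)]
      rfl
  | incr i q =>
    obtain rfl := Option.some.inj h
    refine ⟨_, rfl, ?_, ?_⟩
    · change (if u' (ι i) < x.length then _ else _) ∘ ι = if u' (ι i) < x.length then _ else _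
      split_ifs
      · exact Function.update_comp_eq_of_injective _ hι _ _
      · rfl
    · intro j hj
      split_ifs
      · exact Function.update_of_ne (fun h => hj ⟨i, h.symm⟩) _ _
      · rfl

/-- Computations without choices. -/
def ExecPath {Q V W : Type} (instr : Q → RegInstr Q V W I O) (x : List I) (v : V → ℕ) :
    RegConf Q W O → RegConf Q W O → Prop :=
  Relation.ReflTransGen fun c d => (instr c.state).exec x v c.regs c.out = some d

theorem ExecPath.forcedPath {Q V W : Type} {instr : Q → RegInstr Q V W I O} {x : List I}
    {v : V → ℕ} {c d : RegConf Q W O} (h : ExecPath instr x v c d) :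
    ForcedPath (RegStep instr x v) (fun c => instr c.state ≠ .halt) c d := by
  induction h using Relation.ReflTransGen.head_induction_on with
  | refl => exact .refl _
  | head hs _ ih =>
    refine .head ?_ (regStep_iff_of_exec hs) ih
    intro hh
    rw [hh] at hs
    cases hs

/-- A fragment keeps working inside a larger program, even if its read-only registers become
writable ones there; by `hρ` these are none of the registers that the fragment itself may write. -/
theorem ExecPath.map {Q Q' V V' W W' : Type} {instr : Q → RegInstr Q V W I O}
    {instr' : Q' → RegInstr Q' V' W' I O} {f : Q → Q'} {ρ : V → V' ⊕ W'} {ι : W → W'}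
    (hι : Function.Injective ι) (hρ : ∀ a i, ρ a ≠ .inr (ι i))
    (hf : ∀ q, instr q ≠ .halt → instr' (f q) = (instr q).map f ρ ι) {x : List I} {v : V → ℕ}
    {v' : V' → ℕ} {c d : RegConf Q W O} (h : ExecPath instr x v c d) (u' : W' → ℕ)
    (hv : ∀ a, Sum.elim v' u' (ρ a) = v a) (hu : u' ∘ ι = c.regs) :
    ∃ u'', ExecPath instr' x v' ⟨f c.state, u', c.out⟩ ⟨f d.state, u'', d.out⟩ ∧
      u'' ∘ ι = d.regs ∧ ∀ j, j ∉ Set.range ι → u'' j = u' j := by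
  induction h using Relation.ReflTransGen.head_induction_on generalizing u' with
  | refl => exact ⟨u', .refl, hu, fun _ _ => rfl⟩
  | head hs _ ih =>
    obtain ⟨u₁, h₁, h₂, h₃⟩ := RegInstr.exec_map (f := f) hι hv hu _ hs
    obtain ⟨u₂, h₄, h₅, h₆⟩ := ih u₁ (fun a => by
      rw [← hv a]
      rcases hr : ρ a with b | b
      · rfl
      · exact h₃ _ (by rintro ⟨i, rfl⟩; exact hρ a i hr)) h₂
    refine ⟨u₂, .head ?_ h₄, h₅, fun j hj => (h₆ j hj).trans (h₃ j hj)⟩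
    rw [hf]
    · exact h₁
    · intro hh
      rw [hh] at hs
      cases hs

/-- A deterministic program fragment with read-only registers `V` and exits `S`. -/
structure Frag (V S I O : Type) where
  Q : Type
  W : Type
  finiteQ : Finite Q
  finiteW : Finite W
  instr : Q → RegInstr (Q ⊕ S) V W I O
  start : Q ⊕ S
  det : ∀ q l, instr q ≠ .choose l

def Frag.total {V S : Type} (F : Frag V S I O) : F.Q ⊕ S → RegInstr (F.Q ⊕ S) V F.W I O :=
  Sum.elim F.instr fun _ => .halt

/-- Environments consisting of finitely many natural numbers. -/
class PEnv (E : Type) where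
  V : Type
  finite : Finite V
  get : E → V → ℕ

instance : PEnv Unit := ⟨Empty, inferInstance, fun _ => Empty.elim⟩

instance : PEnv ℕ := ⟨Unit, inferInstance, fun n _ => n⟩

instance (m : ℕ) : PEnv (Fin m → ℕ) := ⟨Fin m, inferInstance, id⟩

instance {E E' : Type} [PEnv E] [PEnv E'] : PEnv (E × E') :=
  ⟨PEnv.V E ⊕ PEnv.V E', @Finite.instSum _ _ PEnv.finite PEnv.finite,
    fun e => Sum.elim (PEnv.get e.1) (PEnv.get e.2)⟩

variable {E E' S S' : Type} [PEnv E] [PEnv E']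

/-- The function reads off a component of the environment. -/
def Ptr (π : E → ℕ) : Prop := ∃ i, ∀ e, PEnv.get e i = π e

theorem Ptr.fst {π : E → ℕ} (h : Ptr π) : Ptr fun e : E × E' => π e.1 :=
  let ⟨i, hi⟩ := h; ⟨.inl i, fun e => hi e.1⟩

theorem Ptr.snd {π : E' → ℕ} (h : Ptr π) : Ptr fun e : E × E' => π e.2 :=
  let ⟨i, hi⟩ := h; ⟨.inr i, fun e => hi e.2⟩

theorem Ptr.last : Ptr fun e : E × ℕ => e.2 := ⟨.inr (), fun _ => rfl⟩

theorem Ptr.coord {m : ℕ} (i : Fin m) : Ptr fun e : Fin m → ℕ => e i := ⟨i, fun _ => rfl⟩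

/-- A program fragment computes a value from a finite set and an output. -/
def Comp (φ : List I → E → S × List O) : Prop :=
  ∃ F : Frag (PEnv.V E) S I O, ∀ x e u out, ∃ u',
    ExecPath F.total x (PEnv.get e) ⟨F.start, u, out⟩ ⟨.inr (φ x e).1, u', out ++ (φ x e).2⟩

theorem Comp.pure (s : S) : Comp (fun (_ : List I) (_ : E) => (s, ([] : List O))) :=
  ⟨⟨Empty, Empty, inferInstance, inferInstance, Empty.elim, .inr s, fun q => q.elim⟩,
    fun _ _ u _ => ⟨u, by rw [List.append_nil]; exact .refl⟩⟩

theorem Comp.emit (o : O) : Comp (fun (_ : List I) (_ : E) => ((), [o])) :=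
  ⟨⟨Unit, Empty, inferInstance, inferInstance, fun _ => .emit o (.inr ()), .inl (), nofun⟩,
    fun _ _ u _ => ⟨u, .single rfl⟩⟩

theorem Comp.read {p q : E → ℕ} (hp : Ptr p) (hq : Ptr q) :
    Comp (fun (x : List I) (e : E) => (x[p e + q e]?, ([] : List O))) := by
  obtain ⟨i, hi⟩ := hp
  obtain ⟨j, hj⟩ := hq
  refine ⟨⟨Unit, Empty, inferInstance, inferInstance,
    fun _ => .read (some (.inl i)) (some (.inl j)) .inr, .inl (), nofun⟩, fun x e u out =>
    ⟨u, .single ?_⟩⟩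
  simp [Frag.total, RegInstr.exec, regLookup, hi, hj]

theorem Comp.readAt {p : E → ℕ} (hp : Ptr p) :
    Comp (fun (x : List I) (e : E) => (x[p e]?, ([] : List O))) := by
  obtain ⟨i, hi⟩ := hp
  refine ⟨⟨Unit, Empty, inferInstance, inferInstance,
    fun _ => .read (some (.inl i)) none .inr, .inl (), nofun⟩, fun x e u out =>
    ⟨u, .single ?_⟩⟩
  simp [Frag.total, RegInstr.exec, regLookup, hi]

theorem Comp.le {p q : E → ℕ} (hp : Ptr p) (hq : Ptr q) :
    Comp (fun (_ : List I) (e : E) => (decide (p e ≤ q e), ([] : List O))) := by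
  obtain ⟨i, hi⟩ := hp
  obtain ⟨j, hj⟩ := hq
  refine ⟨⟨Unit, Empty, inferInstance, inferInstance,
    fun _ => .cmp (.inl i) (.inl j) .inr, .inl (), nofun⟩, fun x e u out =>
    ⟨u, .single ?_⟩⟩
  simp [Frag.total, RegInstr.exec, hi, hj]

theorem RegInstr.map_ne_choose {Q Q' V V' W W' : Type} {f : Q → Q'} {ρ : V → V' ⊕ W'} {ι : W → W'}
    {ins : RegInstr Q V W I O} (h : ∀ l, ins ≠ .choose l) (l : List Q') :
    ins.map f ρ ι ≠ .choose l := by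
  cases ins <;> simp [RegInstr.map] at h ⊢

/-- The value of `φ` is kept in the control state: there is a separate copy of the continuation,
with its own registers, for each of the finitely many values. Fragments work for arbitrary initial
contents of their registers, so nothing has to be cleared in between. -/
theorem Comp.bind [Finite S] {φ : List I → E → S × List O} {ψ : S → List I → E → S' × List O}
    (hφ : Comp φ) (hψ : ∀ s, Comp (ψ s)) :
    Comp fun x e => ((ψ (φ x e).1 x e).1, (φ x e).2 ++ (ψ (φ x e).1 x e).2) := by
  obtain ⟨F, hF⟩ := hφ
  choose G hG using hψ
  have := F.finiteQ
  have := F.finiteW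
  have := fun s => (G s).finiteQ
  have := fun s => (G s).finiteW
  let fG : ∀ s, (G s).Q ⊕ S' → (F.Q ⊕ Σ s, (G s).Q) ⊕ S' :=
    fun s => Sum.map (fun q => .inr ⟨s, q⟩) id
  let fF : F.Q ⊕ S → (F.Q ⊕ Σ s, (G s).Q) ⊕ S' :=
    Sum.elim (fun q => .inl (.inl q)) fun s => fG s (G s).start
  let H : Frag (PEnv.V E) S' I O :=
    { Q := F.Q ⊕ Σ s, (G s).Q
      W := F.W ⊕ Σ s, (G s).W
      finiteQ := inferInstance
      finiteW := inferInstance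
      instr := Sum.elim (fun q => (F.instr q).map fF .inl .inl)
        fun q => ((G q.1).instr q.2).map (fG q.1) .inl fun w => .inr ⟨q.1, w⟩
      start := fF F.start
      det := by
        rintro (q | ⟨s, q⟩) l
        · exact RegInstr.map_ne_choose (F.det q) l
        · exact RegInstr.map_ne_choose ((G s).det q) l }
  refine ⟨H, fun x e u out => ?_⟩
  obtain ⟨u₁, h₁⟩ := hF x e (u ∘ Sum.inl) out
  obtain ⟨u₂, h₂, -, -⟩ := ExecPath.map (instr' := H.total) (f := fF) (ρ := Sum.inl)
    (v' := PEnv.get e) Sum.inl_injective (by simp) (by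
      rintro (q | s) hq
      · rfl
      · exact absurd rfl hq) h₁ u (fun _ => rfl) rfl
  obtain ⟨u₃, h₃⟩ := hG (φ x e).1 x e (u₂ ∘ fun w => .inr ⟨_, w⟩) (out ++ (φ x e).2)
  obtain ⟨u₄, h₄, -, -⟩ := ExecPath.map (instr' := H.total) (f := fG (φ x e).1) (ρ := Sum.inl)
    (ι := fun w => .inr ⟨(φ x e).1, w⟩) (v' := PEnv.get e)
    (fun a b h => by cases h; rfl) (by simp) (by
      rintro (q | s) hq
      · rfl
      · exact absurd rfl hq) h₃ u₂ (fun _ => rfl) rfl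
  refine ⟨u₄, h₂.trans ?_⟩
  rw [← List.append_assoc]
  exact h₄

/-- Iteration of `body` over the elements of a list. -/
def loopFrom (body : S → ℕ → S × List O) : S → List ℕ → S × List O
  | s, [] => (s, [])
  | s, v :: l => ((loopFrom body (body s v).1 l).1, (body s v).2 ++ (loopFrom body (body s v).1 l).2)

/-- One additional register is the loop counter, which the body sees as a read-only component of its
environment. The loop ends when no input symbol is found at the counter, so the counter takes all
values from `0` to `x.length`. -/
theorem Comp.loop [Finite S] {body : S → List I → E → ℕ → S × List O} (s₀ : S)
    (hb : ∀ s, Comp fun x (e : E × ℕ) => body s x e.1 e.2) :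
    Comp fun x e => loopFrom (fun s v => body s x e v) s₀ (List.range (x.length + 1)) := by
  choose B hB using hb
  have := fun s => (B s).finiteQ
  have := fun s => (B s).finiteW
  let Q := Unit ⊕ (S ⊕ S) ⊕ Σ s, (B s).Q
  let W := Unit ⊕ Σ s, (B s).W
  let f : ∀ s, (B s).Q ⊕ S → Q ⊕ S := fun s =>
    Sum.elim (fun q => .inl (.inr (.inr ⟨s, q⟩))) fun s' => .inl (.inr (.inl (.inl s')))
  let ρ : PEnv.V E ⊕ Unit → PEnv.V E ⊕ W := Sum.map id .inl
  let H : Frag (PEnv.V E) S I O :=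
    { Q := Q
      W := W
      finiteQ := inferInstance
      finiteW := inferInstance
      instr := Sum.elim
        (fun _ => .assign (Sum.elim (fun _ => none) fun w => some (.inr (.inr w)))
          (f s₀ (B s₀).start))
        (Sum.elim
          (Sum.elim
            (fun s => .read (some (.inr (.inl ()))) none fun a =>
              if a.isSome then .inl (.inr (.inl (.inr s))) else .inr s)
            fun s => .incr (.inl ()) (f s (B s).start))
          fun q => ((B q.1).instr q.2).map (f q.1) ρ fun w => .inr ⟨q.1, w⟩)
      start := .inl (.inl ())
      det := by
        rintro (q | (q | q) | ⟨s, q⟩) l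
        · simp
        · simp
        · simp
        · exact RegInstr.map_ne_choose ((B s).det q) l }
  refine ⟨H, fun x e u out => ?_⟩
  -- `k` is the number of rounds after the current one.
  have key : ∀ k s (u : W → ℕ) out, k ≤ x.length → u (.inl ()) = x.length - k → ∃ u',
      ExecPath H.total x (PEnv.get e) ⟨f s (B s).start, u, out⟩
        ⟨.inr (loopFrom (fun s v => body s x e v) s (List.range' (x.length - k) (k + 1))).1, u',
          out ++ (loopFrom (fun s v => body s x e v) s (List.range' (x.length - k) (k + 1))).2⟩ := by
    intro k
    induction k with
    | zero =>
      intro s u out _ hu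
      obtain ⟨u₁, h₁⟩ := hB s x (e, u (.inl ())) (u ∘ fun w => .inr ⟨_, w⟩) out
      obtain ⟨u₂, h₂, -, h₃⟩ := ExecPath.map (instr' := H.total) (f := f s) (ρ := ρ)
        (ι := fun w => .inr ⟨s, w⟩) (v' := PEnv.get e)
        (fun a b h => by cases h; rfl) (by rintro (a | a) i <;> simp [ρ]) (by
          rintro (q | s) hq
          · rfl
          · exact absurd rfl hq) h₁ u (by rintro (a | a) <;> rfl) rfl
      have h₄ := h₃ (.inl ()) (by simp)
      refine ⟨u₂, h₂.trans (.single ?_)⟩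
      simp only [f, H, Sum.elim_inr, Frag.total, Sum.elim_inl, RegInstr.exec, regLookup,
        Option.elim_some, Option.elim_none, h₄, hu]
      simp [loopFrom]
    | succ k ih =>
      intro s u out hk hu
      obtain ⟨u₁, h₁⟩ := hB s x (e, u (.inl ())) (u ∘ fun w => .inr ⟨_, w⟩) out
      obtain ⟨u₂, h₂, -, h₃⟩ := ExecPath.map (instr' := H.total) (f := f s) (ρ := ρ)
        (ι := fun w => .inr ⟨s, w⟩) (v' := PEnv.get e)
        (fun a b h => by cases h; rfl) (by rintro (a | a) i <;> simp [ρ]) (by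
          rintro (q | s) hq
          · rfl
          · exact absurd rfl hq) h₁ u (by rintro (a | a) <;> rfl) rfl
      have h₄ := h₃ (.inl ()) (by simp)
      have hlt : x.length - (k + 1) < x.length := by omega
      have hsucc : x.length - (k + 1) + 1 = x.length - k := by omega
      obtain ⟨u₅, h₅⟩ := ih (body s x e (u (.inl ()))).1
        (Function.update u₂ (.inl ()) (x.length - k)) (out ++ (body s x e (u (.inl ()))).2)
        (by omega) (by simp)
      refine ⟨u₅, h₂.trans (.head (b := ⟨.inl (.inr (.inl (.inr (body s x e (u (.inl ()))).1))), u₂,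
        out ++ (body s x e (u (.inl ()))).2⟩) ?_ (.head
          (b := ⟨f _ (B (body s x e (u (.inl ()))).1).start,
            Function.update u₂ (.inl ()) (x.length - k), out ++ (body s x e (u (.inl ()))).2⟩)
          ?_ ?_))⟩
      · simp only [f, H, Sum.elim_inr, Frag.total, Sum.elim_inl, RegInstr.exec, regLookup,
          Option.elim_some, Option.elim_none, h₄, hu]
        simp [hlt]
      · have h₆ : u₂ (.inl ()) = x.length - (k + 1) := h₄.trans hu
        simp only [H, Sum.elim_inr, Frag.total, Sum.elim_inl, RegInstr.exec, h₆, hlt, hsucc,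
          if_true]
        congr!
      · rw [List.range'_succ, hsucc]
        simp only [loopFrom]
        rw [← List.append_assoc, ← hu]
        exact h₅
  obtain ⟨u', h⟩ := key x.length s₀ (fun w => Sum.elim (fun _ => 0) (fun w => u (.inr w)) w) out
    le_rfl (by simp)
  rw [Nat.sub_self, ← List.range_eq_range'] at h
  refine ⟨u', .head ?_ h⟩
  simp only [H, Frag.total, Sum.elim_inl, RegInstr.exec, Option.some.injEq, RegConf.mk.injEq,
    true_and, and_true]
  funext w
  rcases w with w | w <;> rfl

/-- Functions with finitely many values that program fragments can compute. -/
def LFun (φ : List I → E → S) : Prop :=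
  ∀ O : Type, Comp fun x e => (φ x e, ([] : List O))

def LPred (P : List I → E → Prop) : Prop := LFun fun x e => decide (P x e)

/-- Strings that program fragments can write down. -/
def LOut (F : List I → E → List O) : Prop := Comp fun x e => ((), F x e)

theorem LFun.const (s : S) : LFun fun (_ : List I) (_ : E) => s := fun _ => Comp.pure s

theorem LFun.bind [Finite S] {φ : List I → E → S} {ψ : S → List I → E → S'} (hφ : LFun φ)
    (hψ : ∀ s, LFun (ψ s)) : LFun fun x e => ψ (φ x e) x e :=
  fun O => Comp.bind (hφ O) fun s => hψ s O

theorem LFun.map [Finite S] {φ : List I → E → S} (hφ : LFun φ) (f : S → S') :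
    LFun fun x e => f (φ x e) :=
  hφ.bind fun s => .const (f s)

theorem LFun.map₂ {S₁ : Type} [Finite S] [Finite S₁] {φ : List I → E → S} {ψ : List I → E → S₁}
    (hφ : LFun φ) (hψ : LFun ψ) (f : S → S₁ → S') : LFun fun x e => f (φ x e) (ψ x e) :=
  hφ.bind fun s => hψ.map (f s)

theorem LFun.read {p q : E → ℕ} (hp : Ptr p) (hq : Ptr q) :
    LFun fun (x : List I) (e : E) => x[p e + q e]? :=
  fun _ => Comp.read hp hq

theorem LFun.readAt {p : E → ℕ} (hp : Ptr p) : LFun fun (x : List I) (e : E) => x[p e]? :=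
  fun _ => Comp.readAt hp

theorem loopFrom_nil_output (body : S → ℕ → S) (s : S) (l : List ℕ) :
    loopFrom (fun s v => (body s v, ([] : List O))) s l = (l.foldl body s, []) := by
  induction l generalizing s with
  | nil => rfl
  | cons v l ih => simp [loopFrom, ih]

theorem LFun.fold [Finite S] {body : S → List I → E → ℕ → S} (s₀ : S)
    (hb : ∀ s, LFun fun x (e : E × ℕ) => body s x e.1 e.2) :
    LFun fun x e => (List.range (x.length + 1)).foldl (fun s v => body s x e v) s₀ := by
  intro O
  have := Comp.loop (O := O) (body := fun s x e v => (body s x e v, [])) s₀ fun s => hb s O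
  simpa only [loopFrom_nil_output] using this

theorem LPred.congr {P P' : List I → E → Prop} (h : LPred P) (h' : ∀ x e, P' x e ↔ P x e) :
    LPred P' := by
  have : P' = P := by funext x e; exact propext (h' x e)
  rwa [this]

theorem LFun.pred [Finite S] {φ : List I → E → S} (hφ : LFun φ) (P : S → Prop) :
    LPred fun x e => P (φ x e) :=
  hφ.map fun s => decide (P s)

theorem LPred.const (P : Prop) : LPred fun (_ : List I) (_ : E) => P := LFun.const _

theorem LPred.le {p q : E → ℕ} (hp : Ptr p) (hq : Ptr q) :
    LPred fun (_ : List I) (e : E) => p e ≤ q e := by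
  intro O
  convert Comp.le (I := I) (O := O) hp hq

theorem LPred.not {P : List I → E → Prop} (h : LPred P) : LPred fun x e => ¬ P x e := by
  refine (LFun.pred h (fun b => b = false)).congr fun x e => by simp

theorem LPred.and {P P' : List I → E → Prop} (h : LPred P) (h' : LPred P') :
    LPred fun x e => P x e ∧ P' x e := by
  have := LFun.map₂ h h' Bool.and
  unfold LPred
  simpa [Bool.decide_and] using this

theorem LPred.or {P P' : List I → E → Prop} (h : LPred P) (h' : LPred P') :
    LPred fun x e => P x e ∨ P' x e :=
  (h.not.and h'.not).not.congr fun _ _ => by tauto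

theorem LPred.imp {P P' : List I → E → Prop} (h : LPred P) (h' : LPred P') :
    LPred fun x e => P x e → P' x e :=
  (h.not.or h').congr fun _ _ => by tauto

theorem LPred.lt {p q : E → ℕ} (hp : Ptr p) (hq : Ptr q) :
    LPred fun (_ : List I) (e : E) => p e < q e :=
  (LPred.le hq hp).not.congr fun _ _ => by simp

theorem LPred.eq {p q : E → ℕ} (hp : Ptr p) (hq : Ptr q) :
    LPred fun (_ : List I) (e : E) => p e = q e :=
  ((LPred.le hp hq).and (LPred.le hq hp)).congr fun _ _ => le_antisymm_iff

/-- A loop that accumulates a disjunction. With this, `LPred` is closed under first-order logic over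
the positions of the input, and later tests are only written down as formulas. -/
theorem LPred.ex {P : List I → E → ℕ → Prop} (h : LPred fun x (e : E × ℕ) => P x e.1 e.2) :
    LPred fun x e => ∃ v ≤ x.length, P x e v := by
  have := LFun.fold (E := E) (body := fun b x e v => b || decide (P x e v)) false
    fun b => h.map fun b' => b || b'
  unfold LPred
  convert this using 3 with x e
  have : ∀ (l : List ℕ) b, l.foldl (fun b v => b || decide (P x e v)) b =
      (b || decide (∃ v ∈ l, P x e v)) := by
    intro l
    induction l with
    | nil => simp
    | cons a l ih => intro b; rw [List.foldl_cons, ih]; simp [Bool.or_assoc]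
  rw [this]
  simp

theorem LPred.all {P : List I → E → ℕ → Prop} (h : LPred fun x (e : E × ℕ) => P x e.1 e.2) :
    LPred fun x e => ∀ v ≤ x.length, P x e v :=
  (LPred.ex (P := fun x e v => ¬ P x e v) h.not).not.congr fun _ _ => by simp

theorem LPred.finset_all {ι : Type} (s : Finset ι) {P : ι → List I → E → Prop}
    (h : ∀ i ∈ s, LPred (P i)) : LPred fun x e => ∀ i ∈ s, P i x e := by
  classical
  induction s using Finset.induction_on with
  | empty => exact (LPred.const True).congr fun _ _ => by simp
  | insert a s _ ih =>
    exact ((h a (by simp)).and (ih fun i hi => h i (by simp [hi]))).congr fun _ _ => by simp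

theorem LPred.forall {ι : Type} [Fintype ι] {P : ι → List I → E → Prop}
    (h : ∀ i, LPred (P i)) : LPred fun x e => ∀ i, P i x e :=
  (LPred.finset_all Finset.univ fun i _ => h i).congr fun _ _ => by simp

/-- Positions that program fragments can find. -/
def LPtr (π : List I → E → ℕ) : Prop :=
  (∀ x e, π x e ≤ x.length) ∧ LPred fun x (e : E × ℕ) => e.2 = π x e.1

/-- A function on environments that program fragments can evaluate by renaming registers. -/
def Morph (h : E' → E) : Prop := ∀ π : E → ℕ, Ptr π → Ptr fun e => π (h e)

/-- The position is never computed: it is enough to quantify over all positions and to recognize the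
right one. -/
theorem LPred.at_ptr {P : List I → E → ℕ → Prop} (hP : LPred fun x (e : E × ℕ) => P x e.1 e.2)
    {π : List I → E → ℕ} (hπ : LPtr π) : LPred fun x e => P x e (π x e) :=
  (LPred.ex (P := fun x e v => v = π x e ∧ P x e v) (hπ.2.and hP)).congr fun x e =>
    ⟨fun h => ⟨_, hπ.1 x e, rfl, h⟩, by rintro ⟨v, _, rfl, h⟩; exact h⟩

theorem LOut.nil : LOut fun (_ : List I) (_ : E) => ([] : List O) := Comp.pure ()

theorem LOut.append {F G : List I → E → List O} (hF : LOut F) (hG : LOut G) :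
    LOut fun x e => F x e ++ G x e :=
  Comp.bind (S := Unit) hF fun _ => hG

theorem LOut.const (l : List O) : LOut fun (_ : List I) (_ : E) => l := by
  induction l with
  | nil => exact .nil
  | cons o l ih => exact LOut.append (Comp.emit o) ih

theorem LOut.bind [Finite S] {φ : List I → E → S} (hφ : LFun φ) {G : S → List I → E → List O}
    (hG : ∀ s, LOut (G s)) : LOut fun x e => G (φ x e) x e := by
  have := Comp.bind (hφ O) hG
  simp only [List.nil_append] at this
  exact this

theorem LOut.ite {P : List I → E → Prop} [∀ x e, Decidable (P x e)] (hP : LPred P)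
    {F G : List I → E → List O} (hF : LOut F) (hG : LOut G) : LOut fun x e => if P x e then F x e else G x e := by
  have := LOut.bind hP (G := fun b => if b then F else G) fun b => by cases b <;> assumption
  convert this using 3 with x e
  by_cases h : P x e <;> simp [h]

theorem LOut.loop {F : List I → E → ℕ → List O} (hF : LOut fun x (e : E × ℕ) => F x e.1 e.2) :
    LOut fun x e => (List.range (x.length + 1)).flatMap fun v => F x e v := by
  have := Comp.loop (S := Unit) (body := fun _ x e v => ((), F x e v)) () fun _ => hF
  unfold LOut
  convert this using 3 with x e
  have : ∀ l : List ℕ, loopFrom (fun (_ : Unit) v => ((), F x e v)) () l =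
      ((), l.flatMap fun v => F x e v) := by
    intro l
    induction l with
    | nil => rfl
    | cons a l ih => rw [loopFrom, ih]; rfl
  rw [this]

/-- Loop over all positions and write only in the single round in which the counter equals `π x e`.
-/
theorem LOut.at_ptr {F : List I → E → ℕ → List O} (hF : LOut fun x (e : E × ℕ) => F x e.1 e.2)
    {π : List I → E → ℕ} (hπ : LPtr π) : LOut fun x e => F x e (π x e) := by
  have := LOut.loop (F := fun x e v => if v = π x e then F x e v else []) (.ite hπ.2 hF .nil)
  convert this using 3 with x e
  have : ∀ n, π x e < n →
      (List.range n).flatMap (fun v => if v = π x e then F x e v else []) = F x e (π x e) := by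
    intro n
    induction n with
    | zero => simp
    | succ n ih =>
      intro h
      rw [List.range_succ, List.flatMap_append]
      rcases Nat.lt_succ_iff_lt_or_eq.1 h with h | h
      · rw [ih h]
        simp [show n ≠ π x e by omega]
      · subst h
        have : (List.range (π x e)).flatMap (fun v => if v = π x e then F x e v else []) = [] := by
          rw [List.flatMap_eq_nil_iff]
          intro v hv
          rw [if_neg (by rw [List.mem_range] at hv; omega)]
        rw [this]
        simp
  exact (this _ (Nat.lt_succ_of_le (hπ.1 x e))).symm

theorem LOut.flatMap_list {ι : Type} (l : List ι) {F : ι → List I → E → List O}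
    (hF : ∀ i, LOut (F i)) : LOut fun x e => l.flatMap fun i => F i x e := by
  induction l with
  | nil => exact .nil
  | cons a l ih => exact (hF a).append ih

/-- All `m`-tuples of numbers below `n`. -/
def tuples (n : ℕ) : (m : ℕ) → List (Fin m → ℕ)
  | 0 => [![]]
  | m + 1 => (List.range n).flatMap fun v => (tuples n m).map (Fin.cons v)

theorem mem_tuples {n m : ℕ} {z : Fin m → ℕ} : z ∈ tuples n m ↔ ∀ i, z i < n := by
  induction m with
  | zero => simp [tuples, Subsingleton.elim z ![]]
  | succ m ih =>
    simp only [tuples, List.mem_flatMap, List.mem_range, List.mem_map]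
    constructor
    · rintro ⟨v, hv, z, hz, rfl⟩ i
      refine Fin.cases hv (fun i => ?_) i
      simpa using ih.1 hz i
    · intro h
      exact ⟨z 0, h 0, Fin.tail z, ih.2 fun i => h i.succ, Fin.cons_self_tail z⟩

theorem length_tuples (n m : ℕ) : (tuples n m).length = n ^ m := by
  induction m with
  | zero => rfl
  | succ m ih => simp [tuples, ih, pow_succ, mul_comm]

theorem Morph.id : Morph fun e : E => e := fun _ h => h

/-- Nested loops. Each one enlarges the environment, so the hypothesis speaks of all environments
from which the old one and the tuple can be read off. -/
theorem LOut.tuples {m : ℕ} {F : List I → E → (Fin m → ℕ) → List O}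
    (hF : ∀ (E' : Type) [PEnv E'] (h : E' → E) (z : E' → Fin m → ℕ), Morph h →
      (∀ i, Ptr fun e => z e i) → LOut fun x e => F x (h e) (z e)) :
    LOut fun x e => (tuples (x.length + 1) m).flatMap (F x e) := by
  induction m generalizing E with
  | zero =>
    have := hF E id (fun _ => ![]) Morph.id (fun i => i.elim0)
    simpa [RamseyWords.tuples] using this
  | succ m ih =>
    have := LOut.loop (E := E) (F := fun x e v =>
        (RamseyWords.tuples (x.length + 1) m).flatMap fun z => F x e (Fin.cons v z))
      (ih (E := E × ℕ) (F := fun x e z => F x e.1 (Fin.cons e.2 z)) fun E' _ h z hh hz => by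
        refine hF E' (fun e => (h e).1) (fun e => Fin.cons (h e).2 (z e)) ?_ ?_
        · intro π hπ
          exact hh _ hπ.fst
        · intro i
          refine Fin.cases ?_ (fun i => ?_) i
          · exact hh _ Ptr.last
          · simpa using hz i)
    simpa [RamseyWords.tuples, List.flatMap_assoc, List.flatMap_map] using this

theorem LOut.logSpaceComputable {f : List I → List O}
    (hf : LOut fun (x : List I) (_ : Unit) => f x) : LogSpaceComputable f := by
  obtain ⟨F, hF⟩ := hf
  have := F.finiteQ
  have := F.finiteW
  refine ⟨regTM F.total F.start ∅, regTM_deterministic _ _ _ ?_, regTM_logSpace _ _ _ (by simp),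
    fun x => ?_⟩
  · rintro (q | q) l
    · exact F.det q l
    · nofun
  · obtain ⟨u', h⟩ := hF x () (fun _ => 0) []
    obtain ⟨d, hd, hs, ho⟩ := regTM_forward F.total F.start ∅ (by simp) x _
      h.forcedPath.reflTransGen
    exact ⟨d, hd, regTM_enabled_empty _ _ _ x d _ hs rfl, ho⟩

end Fragments

end RamseyWords

namespace RamseyWords

/-! ### Nondeterministic search for a path in logarithmic space -/

noncomputable section Search

open scoped Classical

variable {I T : Type} {m : ℕ}

/-- Stages of a nondeterministic search for a path: the next vertex is guessed component by
component and then tested. -/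
inductive Search (T : Type) (m : ℕ) where
  | main (t : T) (c : Fin m → ℕ)
  | next (t t' : T) (c d : Fin m → ℕ)
  | inc (t t' : T) (i : Fin m) (c d : Fin m → ℕ)
  | test (t t' : T) (c d : Fin m → ℕ)
  | dead
  | acc

def bump (n : ℕ) (c : Fin m → ℕ) (i : Fin m) : Fin m → ℕ :=
  if c i < n then Function.update c i (c i + 1) else c

def SearchStep (Step : T → T → List I → (Fin m → ℕ) × (Fin m → ℕ) → Prop) (tF : T) (x : List I) :
    Search T m → Search T m → Prop
  | .main t c, b => (∃ t', b = .next t t' c 0) ∨ (t = tF ∧ b = .acc)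
  | .next t t' c d, b => (∃ i, b = .inc t t' i c d) ∨ b = .test t t' c d
  | .inc t t' i c d, b => b = .next t t' c (bump x.length d i)
  | .test t t' c d, b => b = if Step t t' x (c, d) then .main t' d else .dead
  | .dead, _ => False
  | .acc, _ => False

/-- Edges of the graph that is searched. -/
def PathStep (Step : T → T → List I → (Fin m → ℕ) × (Fin m → ℕ) → Prop) (x : List I)
    (a b : T × (Fin m → ℕ)) : Prop :=
  (∀ i, b.2 i ≤ x.length) ∧ Step a.1 b.1 x (a.2, b.2)

theorem ite_update_apply {ι : Type} [DecidableEq ι] (n : ℕ) (c : ι → ℕ) (i j : ι) :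
    (if c i < n then Function.update c i (c i + 1) else c) j =
      if j = i ∧ c i < n then c i + 1 else c j := by
  by_cases hj : j = i
  · subst hj
    split_ifs <;> simp_all
  · split_ifs <;> simp_all

variable (Step : T → T → List I → (Fin m → ℕ) × (Fin m → ℕ) → Prop) (t₀ tF : T) (x : List I)

theorem bump_le {n : ℕ} {c : Fin m → ℕ} (h : ∀ i, c i ≤ n) (i j : Fin m) : bump n c i j ≤ n := by
  unfold bump
  split_ifs with h'
  · by_cases hj : j = i
    · subst hj; simpa using h'
    · simpa [hj] using h j
  · exact h j

/-- Unit increments of single components reach every vector within the bounds; the induction is on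
the sum of its entries. -/
theorem searchStep_guess (t t' : T) (c d : Fin m → ℕ) (hd : ∀ i, d i ≤ x.length) :
    Relation.ReflTransGen (SearchStep Step tF x) (.next t t' c 0) (.next t t' c d) := by
  induction hk : ∑ i, d i generalizing d with
  | zero =>
    have : d = 0 := by
      funext i
      simpa using (Finset.sum_eq_zero_iff.1 hk) i (Finset.mem_univ i)
    subst this
    exact .refl
  | succ k ih =>
    obtain ⟨i, hi⟩ : ∃ i, d i ≠ 0 := by
      by_contra! h
      simp [h] at hk
    have hsum : ∑ j, Function.update d i (d i - 1) j = k := by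
      have h1 := Finset.sum_update_of_mem (Finset.mem_univ i) d (d i - 1)
      have h2 := Finset.sum_eq_add_sum_sdiff_singleton_of_mem (Finset.mem_univ i) d
      omega
    have hle := hd i
    refine (ih (Function.update d i (d i - 1)) (fun j => ?_) hsum).trans
      (.head (b := .inc t t' i c (Function.update d i (d i - 1))) (.inl ⟨i, rfl⟩) (.single ?_))
    · by_cases hj : j = i
      · subst hj; simp; omega
      · simpa [hj] using hd j
    · simp only [SearchStep, bump, Function.update_self]
      rw [if_pos (by omega)]
      simp only [Function.update_idem, Search.next.injEq, true_and]
      rw [show d i - 1 + 1 = d i by omega, Function.update_eq_self]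

theorem searchStep_acc_iff :
    Relation.ReflTransGen (SearchStep Step tF x) (.main t₀ 0) .acc ↔
      ∃ e, Relation.ReflTransGen (PathStep Step x) (t₀, 0) (tF, e) := by
  constructor
  · intro h
    -- Invariant: the current vertex has been reached in the graph, and the guessed entries are
    -- within the bounds.
    let Good : Search T m → Prop := fun a => match a with
      | .main t c => Relation.ReflTransGen (PathStep Step x) (t₀, 0) (t, c)
      | .next t _ c d => Relation.ReflTransGen (PathStep Step x) (t₀, 0) (t, c) ∧
          ∀ i, d i ≤ x.length
      | .inc t _ _ c d => Relation.ReflTransGen (PathStep Step x) (t₀, 0) (t, c) ∧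
          ∀ i, d i ≤ x.length
      | .test t _ c d => Relation.ReflTransGen (PathStep Step x) (t₀, 0) (t, c) ∧
          ∀ i, d i ≤ x.length
      | .dead => True
      | .acc => ∃ e, Relation.ReflTransGen (PathStep Step x) (t₀, 0) (tF, e)
    suffices H : ∀ a, Relation.ReflTransGen (SearchStep Step tF x) (.main t₀ 0) a → Good a from
      H _ h
    intro a ha
    induction ha with
    | refl => exact .refl
    | @tail b c _ hs ih =>
      cases b with
      | main t c' =>
        rcases hs with ⟨t', rfl⟩ | ⟨rfl, rfl⟩
        · exact ⟨ih, fun i => Nat.zero_le _⟩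
        · exact ⟨_, ih⟩
      | next t t' c' d =>
        rcases hs with ⟨i, rfl⟩ | rfl
        · exact ih
        · exact ih
      | inc t t' i c' d =>
        obtain rfl : c = _ := hs
        exact ⟨ih.1, bump_le ih.2 i⟩
      | test t t' c' d =>
        simp only [SearchStep] at hs
        split_ifs at hs with h'
        · subst hs
          exact ih.1.tail ⟨ih.2, h'⟩
        · subst hs
          trivial
      | dead => exact hs.elim
      | acc => exact hs.elim
  · rintro ⟨e, h⟩
    suffices H : ∀ a, Relation.ReflTransGen (PathStep Step x) (t₀, 0) a →
        Relation.ReflTransGen (SearchStep Step tF x) (.main t₀ 0) (.main a.1 a.2) from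
      (H _ h).tail (.inr ⟨rfl, rfl⟩)
    intro a ha
    induction ha with
    | refl => exact .refl
    | @tail b c _ hs ih =>
      refine (ih.tail (.inl ⟨c.1, rfl⟩)).trans
        ((searchStep_guess Step tF x b.1 c.1 b.2 c.2 hs.1).trans
          (.head (b := .test b.1 c.1 b.2 c.2) (.inr rfl) (.single ?_)))
      simp only [SearchStep]
      rw [if_pos hs.2]

/-- `run` executes the fragment that tests the guessed edge, and `commit` makes the guessed vertex
the current one. -/
inductive SearchCtl (T : Type) (m : ℕ) (R : T × T → Type) where
  | main (t : T)
  | next (t t' : T)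
  | inc (t t' : T) (i : Fin m)
  | test (t t' : T)
  | run (p : T × T) (q : R p)
  | commit (t' : T)
  | dead
  | acc

instance [Finite T] {R : T × T → Type} [∀ p, Finite (R p)] : Finite (SearchCtl T m R) := by
  refine Finite.of_injective (β := T ⊕ (T × T) ⊕ (T × T × Fin m) ⊕ (T × T) ⊕ (Σ p, R p) ⊕ T ⊕
    Bool) (fun
    | .main t => .inl t
    | .next t t' => .inr (.inl (t, t'))
    | .inc t t' i => .inr (.inr (.inl (t, t', i)))
    | .test t t' => .inr (.inr (.inr (.inl (t, t'))))
    | .run p q => .inr (.inr (.inr (.inr (.inl ⟨p, q⟩))))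
    | .commit t => .inr (.inr (.inr (.inr (.inr (.inl t)))))
    | .dead => .inr (.inr (.inr (.inr (.inr (.inr true)))))
    | .acc => .inr (.inr (.inr (.inr (.inr (.inr false)))))) ?_
  rintro (_ | _ | _ | _ | _ | _ | _ | _) (_ | _ | _ | _ | _ | _ | _ | _) h <;> simp_all

variable [Finite T] (F : T × T → Frag (Fin m ⊕ Fin m) Bool I Empty)

abbrev SearchRegs (F : T × T → Frag (Fin m ⊕ Fin m) Bool I Empty) : Type :=
  (Fin m ⊕ Fin m) ⊕ Σ p, (F p).W

abbrev SearchState (F : T × T → Frag (Fin m ⊕ Fin m) Bool I Empty) : Type :=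
  SearchCtl T m fun p => (F p).Q

def searchEmbed (p : T × T) : (F p).Q ⊕ Bool → SearchState F
  | .inl q => .run p q
  | .inr true => .commit p.2
  | .inr false => .dead

def searchInstr [Fintype T] : SearchState F →
    RegInstr (SearchState F) Empty (SearchRegs F) I Empty
  | .main t => .choose (Finset.univ.toList.map (fun t' => .next t t') ++
      if t = tF then [.acc] else [])
  | .next t t' => .choose (Finset.univ.toList.map (fun i => .inc t t' i) ++ [.test t t'])
  | .inc t t' i => .incr (.inl (.inr i)) (.next t t')
  -- The identical assignment serves as a jump.
  | .test t t' => .assign (fun w => some (.inr w)) (searchEmbed F (t, t') (F (t, t')).start)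
  | .run p q => ((F p).instr q).map (searchEmbed F p) (fun a => .inr (.inl a))
      fun w => .inr ⟨p, w⟩
  | .commit t' => .assign (Sum.elim
      (Sum.elim (fun i => some (.inr (.inl (.inr i)))) fun _ => none)
      fun w => some (.inr (.inr w))) (.main t')
  | .dead => .halt
  | .acc => .halt

structure HoldsRegs (c d : Fin m → ℕ) (u : SearchRegs F → ℕ) : Prop where
  cur : ∀ i, u (.inl (.inl i)) = c i
  new : ∀ i, u (.inl (.inr i)) = d i

def SearchRep : Search T m → RegConf (SearchState F) (SearchRegs F) Empty → Prop
  | .main t c, b => b.state = .main t ∧ HoldsRegs F c 0 b.regs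
  | .next t t' c d, b => b.state = .next t t' ∧ HoldsRegs F c d b.regs
  | .inc t t' i c d, b => b.state = .inc t t' i ∧ HoldsRegs F c d b.regs
  | .test t t' c d, b => b.state = .test t t' ∧ HoldsRegs F c d b.regs
  | .dead, b => b.state = .dead
  | .acc, b => b.state = .acc

-- Choices are matched one by one. A test is a single step on the left and on the right a forced
-- path through the fragment, which leaves the registers with the two vertices alone.
variable {Step} in
theorem searchInstr_simulates [Fintype T] (v : Empty → ℕ)
    (hF : ∀ p : T × T, ∀ x c d u out, ∃ u', ExecPath (F p).total x (Sum.elim c d)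
      ⟨(F p).start, u, out⟩ ⟨.inr (decide (Step p.1 p.2 x (c, d))), u', out⟩) :
    Simulates (SearchStep Step tF x) (RegStep (searchInstr tF F) x v)
      (fun c => searchInstr tF F c.state ≠ .halt) (SearchRep F) := by
  rintro a ⟨q, u, out⟩ hr
  cases a with
  | main t c =>
    obtain ⟨hq, hr⟩ := hr
    dsimp only at hq hr
    subst hq
    right
    constructor
    · rintro d ⟨q, hq, rfl⟩
      simp only [List.mem_append, List.mem_map, Finset.mem_toList, Finset.mem_univ, true_and] at hq
      rcases hq with ⟨t', rfl⟩ | hq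
      · exact ⟨.next t t' c 0, .inl ⟨t', rfl⟩, rfl, hr⟩
      · split_ifs at hq with h
        · obtain rfl := List.mem_singleton.1 hq
          exact ⟨.acc, .inr ⟨h, rfl⟩, rfl⟩
        · simp at hq
    · rintro a' (⟨t', rfl⟩ | ⟨rfl, rfl⟩)
      · exact ⟨⟨.next t t', u, out⟩, ⟨_, by simp, rfl⟩, rfl, hr⟩
      · exact ⟨⟨.acc, u, out⟩, ⟨_, by simp, rfl⟩, rfl⟩
  | next t t' c d =>
    obtain ⟨hq, hr⟩ := hr
    dsimp only at hq hr
    subst hq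
    right
    constructor
    · rintro d' ⟨q, hq, rfl⟩
      simp only [List.mem_append, List.mem_map, Finset.mem_toList, Finset.mem_univ, true_and,
        List.mem_singleton] at hq
      rcases hq with ⟨i, rfl⟩ | rfl
      · exact ⟨.inc t t' i c d, .inl ⟨i, rfl⟩, rfl, hr⟩
      · exact ⟨.test t t' c d, .inr rfl, rfl, hr⟩
    · rintro a' (⟨i, rfl⟩ | rfl)
      · exact ⟨⟨.inc t t' i, u, out⟩, ⟨_, by simp, rfl⟩, rfl, hr⟩
      · exact ⟨⟨.test t t', u, out⟩, ⟨_, by simp, rfl⟩, rfl, hr⟩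
  | inc t t' i c d =>
    obtain ⟨hq, hr⟩ := hr
    dsimp only at hq hr
    subst hq
    left
    refine ⟨_, _, _, fun _ => Iff.rfl, regStep_iff_of_exec rfl, .refl _, rfl, ?_, ?_⟩
    · intro j
      refine (@ite_update_apply _ (fun a b => Classical.propDecidable (a = b)) _ _ _ _).trans ?_
      rw [if_neg (by simp)]
      exact hr.cur j
    · intro j
      refine (@ite_update_apply _ (fun a b => Classical.propDecidable (a = b)) _ _ _ _).trans ?_
      rw [bump, ite_update_apply]
      simp [hr.new]
  | test t t' c d =>
    obtain ⟨hq, hr⟩ := hr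
    dsimp only at hq hr
    subst hq
    left
    obtain ⟨u₁, h₁⟩ := hF (t, t') x c d (u ∘ fun w => .inr ⟨_, w⟩) out
    obtain ⟨u₂, h₂, -, h₃⟩ := ExecPath.map (instr' := searchInstr tF F) (f := searchEmbed F (t, t'))
      (ρ := fun a => .inr (.inl a)) (v' := v) (ι := fun w => .inr ⟨(t, t'), w⟩)
      (fun a b h => by cases h; rfl) (by simp) (by
        rintro (q | s) hq
        · rfl
        · exact absurd rfl hq) h₁ u (by
          rintro (i | i)
          · exact hr.cur i
          · exact hr.new i) rfl
    have hr₂ : HoldsRegs F c d u₂ :=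
      ⟨fun i => (h₃ _ (by simp)).trans (hr.cur i), fun i => (h₃ _ (by simp)).trans (hr.new i)⟩
    by_cases hS : Step t t' x (c, d)
    · refine ⟨_, _, ⟨.main t', Sum.elim (Sum.elim (fun i => u₂ (.inl (.inr i))) fun _ => 0)
          (fun w => u₂ (.inr w)), out⟩, fun _ => Iff.rfl, regStep_iff_of_exec rfl,
        h₂.forcedPath.trans (.single ?_ (regStep_iff_of_exec ?_)), ?_⟩
      · simp [hS, searchEmbed, searchInstr]
      · simp only [hS, decide_true, searchEmbed, searchInstr, RegInstr.exec, Option.some.injEq,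
          RegConf.mk.injEq, true_and, and_true]
        funext w
        rcases w with (w | w) | w <;> rfl
      · rw [if_pos hS]
        exact ⟨rfl, hr₂.new, fun _ => rfl⟩
    · refine ⟨_, _, _, fun _ => Iff.rfl, regStep_iff_of_exec rfl, h₂.forcedPath, ?_⟩
      rw [if_neg hS]
      simp [hS, searchEmbed, SearchRep]
  | dead =>
    obtain rfl : q = _ := hr
    right
    exact ⟨fun d hd => by simp [RegStep, searchInstr, RegInstr.exec] at hd, fun d hd => hd.elim⟩
  | acc =>
    obtain rfl : q = _ := hr
    right
    exact ⟨fun d hd => by simp [RegStep, searchInstr, RegInstr.exec] at hd, fun d hd => hd.elim⟩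

theorem inNL_of_path (hS : ∀ t t', LPred (Step t t')) :
    InNL {x : List I | ∃ e, Relation.ReflTransGen (PathStep Step x) (t₀, 0) (tF, e)} := by
  have := Fintype.ofFinite T
  have hS' : ∀ p : T × T, LPred (Step p.1 p.2) := fun p => hS p.1 p.2
  choose F hF using fun p => hS' p Empty
  have hF' : ∀ p : T × T, ∀ x c d u out, ∃ u', ExecPath (F p).total x (Sum.elim c d)
      ⟨(F p).start, u, out⟩ ⟨.inr (decide (Step p.1 p.2 x (c, d))), u', out⟩ := by
    intro p x c d u out
    obtain ⟨u', h⟩ := hF p x (c, d) u out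
    rw [List.append_nil] at h
    exact ⟨u', h⟩
  have := fun p => (F p).finiteQ
  have := fun p => (F p).finiteW
  have hacc : ∀ q ∈ ({.acc} : Set (SearchState F)), searchInstr tF F q = .halt := by
    rintro q rfl
    rfl
  refine ⟨regTM (searchInstr tF F) (.main t₀) {.acc}, regTM_logSpace _ _ _ hacc, fun x => ?_⟩
  rw [regTM_accepts_iff _ _ _ hacc, Set.mem_ofPred_eq, ← searchStep_acc_iff]
  have hsim := searchInstr_simulates tF x F Empty.elim hF'
  have h₀ : SearchRep F (.main t₀ 0) ⟨.main t₀, fun _ => 0, []⟩ :=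
    ⟨rfl, fun _ => rfl, fun _ => rfl⟩
  constructor
  · intro h
    obtain ⟨b, hb, hr⟩ := hsim.forward h₀ h
    exact ⟨b, hb, hr⟩
  · rintro ⟨b, hb, hq⟩
    rcases hsim.backward h₀ hb with ⟨a, ha, hr⟩ | h
    · rw [Set.mem_singleton_iff] at hq
      cases a with
      | acc => exact ha
      | dead => rw [SearchRep, hq] at hr; cases hr
      | _ => have := hr.1; rw [hq] at this; cases this
    · exact absurd (hacc _ hq) h

end Search

end RamseyWords

namespace RamseyWords

/-! ### Runs, accepted words and convolutions -/

section Runs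

/-- Runs of a labelled transition system, where the label `none` reads nothing. -/
inductive LRun {S α : Type} (step : S → Option α → S → Prop) : S → List α → S → Prop
  | nil (p : S) : LRun step p [] p
  | cons {p q r : S} {l : Option α} {w : List α} : step p l q → LRun step q w r →
      LRun step p (l.toList ++ w) r

variable {S α : Type} {step : S → Option α → S → Prop}

theorem LRun.trans {p q r : S} {w w' : List α} (h : LRun step p w q) (h' : LRun step q w' r) :
    LRun step p (w ++ w') r := by
  induction h with
  | nil => exact h'
  | cons hs _ ih => rw [List.append_assoc]; exact .cons hs (ih h')

theorem LRun.single {p q : S} {l : Option α} (h : step p l q) : LRun step p l.toList q := by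
  simpa using LRun.cons h (.nil q)

theorem LRun.snoc {p q r : S} {w : List α} {l : Option α} (h : LRun step p w q)
    (h' : step q l r) : LRun step p (w ++ l.toList) r :=
  h.trans (.single h')

theorem LRun.snoc_induction {s₀ : S} (M : List α → S → Prop) (h₀ : M [] s₀)
    (hs : ∀ w s l s', M w s → step s l s' → M (w ++ l.toList) s') {w : List α} {s : S}
    (h : LRun step s₀ w s) : M w s := by
  suffices H : ∀ p w q, LRun step p w q → ∀ w₀, M w₀ p → M (w₀ ++ w) q from H _ _ _ h [] h₀
  intro p w q h
  induction h with
  | nil => intro w₀ h; simpa using h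
  | cons hst _ ih =>
    intro w₀ h
    rw [← List.append_assoc]
    exact ih _ (hs _ _ _ _ h hst)

theorem LRun.cons_split {p q : S} {a : α} {w : List α} (h : LRun step p (a :: w) q) :
    ∃ r r', LRun step p [] r ∧ step r (some a) r' ∧ LRun step r' w q := by
  generalize hv : a :: w = v at h
  induction h with
  | nil => cases hv
  | @cons p q' r l w' hs hr ih =>
    cases l with
    | none =>
      obtain ⟨r₁, r₂, h₁, h₂, h₃⟩ := ih (by simpa using hv)
      exact ⟨r₁, r₂, .cons (l := none) hs h₁, h₂, h₃⟩
    | some b =>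
      simp only [Option.toList_some, List.singleton_append, List.cons.injEq] at hv
      obtain ⟨rfl, rfl⟩ := hv
      exact ⟨p, q', .nil p, hs, hr⟩

/-- One state per prefix is fixed once and for all, so that segments of the same run between
different positions fit together in spite of silent transitions. -/
theorem LRun.exists_states {p q : S} {w : List α} (h : LRun step p w q) :
    ∃ ρ : ℕ → S, (∀ j ≤ w.length, LRun step p (w.take j) (ρ j)) ∧
      (∀ i j, i ≤ j → j ≤ w.length → LRun step (ρ i) ((w.take j).drop i) (ρ j)) ∧
      ∀ i ≤ w.length, LRun step (ρ i) (w.drop i) q := by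
  induction w generalizing p with
  | nil =>
    refine ⟨fun _ => p, fun j _ => by simpa using .nil p, fun i j _ _ => by simpa using .nil p,
      fun i _ => by simpa using h⟩
  | cons a w ih =>
    obtain ⟨r, r', h₁, h₂, h₃⟩ := LRun.cons_split h
    obtain ⟨ρ, hρ₁, hρ₂, hρ₃⟩ := ih h₃
    have hpa : LRun step p [a] r' := by simpa using h₁.trans (.single h₂)
    have hp : ∀ j ≤ w.length, LRun step p (a :: w.take j) (ρ j) := fun j hj => by
      simpa using hpa.trans (hρ₁ j hj)
    refine ⟨fun j => Nat.casesOn j p ρ, ?_, ?_, ?_⟩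
    · rintro (_ | j) hj
      · exact .nil p
      · exact hp j (by simpa using hj)
    · rintro (_ | i) (_ | j) hij hj
      · exact .nil p
      · exact hp j (by simpa using hj)
      · omega
      · exact hρ₂ i j (by omega) (by simpa using hj)
    · rintro (_ | i) hi
      · exact h
      · exact hρ₃ i (by simpa using hi)

theorem LRun.flatten_replicate {p : S} {w : List α} (h : LRun step p w p) (n : ℕ) :
    LRun step p (List.replicate n w).flatten p := by
  induction n with
  | zero => exact .nil p
  | succ n ih => rw [List.replicate_succ, List.flatten_cons]; exact h.trans ih

end Runs

section Language

variable {α : Type}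

def FinNFA.step (A : FinNFA α) (p : Fin A.numStates) (l : Option α) (q : Fin A.numStates) : Prop :=
  (p, l, q) ∈ A.trans

theorem FinNFA.isPath_lrun (A : FinNFA α) {p q : Fin A.numStates} {w : List (Option α)}
    (h : A.toεNFA.IsPath p q w) : LRun A.step p w.reduceOption q := by
  induction h with
  | nil => exact .nil _
  | cons t s u a x h₁ _ ih =>
    have : (a :: x).reduceOption = a.toList ++ x.reduceOption := by cases a <;> rfl
    rw [this]
    exact .cons h₁ ih

theorem FinNFA.mem_language_iff (A : FinNFA α) (w : List α) :
    w ∈ A.language ↔ ∃ f ∈ A.final, LRun A.step A.start w f := by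
  change w ∈ A.toεNFA.accepts ↔ _
  rw [εNFA.mem_accepts_iff_exists_path]
  constructor
  · rintro ⟨s, f, x, hs, hf, rfl, h⟩
    obtain rfl : s = A.start := hs
    exact ⟨f, hf, A.isPath_lrun h⟩
  · rintro ⟨f, hf, h⟩
    suffices H : ∀ p q w, LRun A.step p w q →
        ∃ x : List (Option α), x.reduceOption = w ∧ A.toεNFA.IsPath p q x by
      obtain ⟨x, hx, h⟩ := H _ _ _ h
      exact ⟨A.start, f, x, rfl, hf, hx, h⟩
    intro p q w h
    induction h with
    | nil => exact ⟨[], rfl, .nil _⟩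
    | @cons p q r l w hs _ ih =>
      obtain ⟨x, rfl, hx⟩ := ih
      exact ⟨l :: x, by cases l <;> rfl, .cons _ _ _ _ _ hs hx⟩


end Language

section Convolution

variable {α : Type} {r : ℕ}

theorem length_conv (w : Fin r → List α) :
    (conv w).length = Finset.univ.sup fun i => (w i).length := by
  simp [conv]

theorem length_le_length_conv (w : Fin r → List α) (i : Fin r) :
    (w i).length ≤ (conv w).length := by
  rw [length_conv]
  exact Finset.le_sup (f := fun i => (w i).length) (Finset.mem_univ i)

theorem range_map_filterMap (l : List α) (n : ℕ) (h : l.length ≤ n) :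
    (List.range n).filterMap (fun j => l[j]?) = l := by
  induction n generalizing l with
  | zero => simp at h; simp [h]
  | succ n ih =>
    rw [List.range_succ_eq_map, List.filterMap_cons, List.filterMap_map]
    cases l with
    | nil => simp
    | cons a l => simpa [Function.comp_def] using ih l (by simpa using h)

/-- The words can be recovered from their convolution by erasing the padding. -/
theorem filterMap_conv (w : Fin r → List α) (i : Fin r) : (conv w).filterMap (· i) = w i := by
  rw [conv, List.filterMap_map]
  refine range_map_filterMap (w i) _ ?_
  rw [← length_conv]
  exact length_le_length_conv w i

theorem exists_ne_none_of_mem_conv {w : Fin r → List α} {l : Fin r → Option α} (h : l ∈ conv w) :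
    ∃ i, l i ≠ none := by
  simp only [conv, List.mem_map, List.mem_range] at h
  obtain ⟨j, hj, rfl⟩ := h
  rw [Finset.lt_sup_iff] at hj
  obtain ⟨i, -, hi⟩ := hj
  exact ⟨i, by simpa using hi⟩

/-- Without the first two components, pure padding can occur, but only behind the end of all
remaining words. -/
theorem filter_tail_conv [DecidableEq (Fin r → Option α)] (w : Fin (r + 2) → List α) :
    (((conv w).map fun l (i : Fin r) => l i.succ.succ).filter (· ≠ fun _ => none)) =
      conv fun i => w i.succ.succ := by
  have hle : (Finset.univ.sup fun i : Fin r => (w i.succ.succ).length) ≤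
      Finset.univ.sup fun i => (w i).length :=
    Finset.sup_le fun i _ => Finset.le_sup (f := fun i => (w i).length) (Finset.mem_univ _)
  obtain ⟨d, hd⟩ := Nat.exists_eq_add_of_le hle
  rw [conv, hd, List.range_add, List.map_append, List.map_append, List.filter_append]
  have h₁ : List.filter (· ≠ fun _ => none) (List.map (fun l (i : Fin r) => l i.succ.succ)
      (List.map (fun j i => (w i)[j]?)
        (List.range (Finset.univ.sup fun i : Fin r => (w i.succ.succ).length)))) =
      conv fun i => w i.succ.succ := by
    rw [List.filter_eq_self.2]
    · simp [conv, Function.comp_def]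
    · intro l hl
      simp only [List.map_map] at hl
      obtain ⟨i, hi⟩ := exists_ne_none_of_mem_conv (w := fun i => w i.succ.succ) hl
      simp only [decide_eq_true_eq]
      rintro rfl
      exact hi rfl
  rw [h₁, List.filter_eq_nil_iff.2, List.append_nil]
  intro l hl
  simp only [List.map_map, List.mem_map, List.mem_range, Function.comp_apply] at hl
  obtain ⟨j, hj, rfl⟩ := hl
  simp only [ne_eq, decide_not, Bool.not_eq_true', decide_eq_false_iff_not, not_not]
  funext i
  rw [List.getElem?_eq_none_iff]
  exact le_trans (Finset.le_sup (f := fun i : Fin r => (w i.succ.succ).length) (Finset.mem_univ i))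
    (Nat.le_add_right _ _)

end Convolution

/-! ### From a clique to a pumpable pattern -/

section Cliques

variable {α : Type} {k : ℕ}

/-- The letter with two distinguished components. -/
def pairLetter (x y : Option α) (v : Fin k → Option α) : Fin (k + 2) → Option α :=
  Matrix.vecCons x (Matrix.vecCons y v)

def noLetter : Fin k → Option α := fun _ => none

@[simp] theorem pairLetter_zero (x y : Option α) (v : Fin k → Option α) :
    pairLetter x y v 0 = x := rfl

@[simp] theorem pairLetter_one (x y : Option α) (v : Fin k → Option α) :
    pairLetter x y v 1 = y := rfl

@[simp] theorem pairLetter_succ_succ (x y : Option α) (v : Fin k → Option α) (i : Fin k) :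
    pairLetter x y v i.succ.succ = v i := rfl

theorem eq_pairLetter (l : Fin (k + 2) → Option α) :
    l = pairLetter (l 0) (l 1) fun i => l i.succ.succ := by
  funext i
  refine Fin.cases rfl (fun i => Fin.cases rfl (fun i => rfl) i) i

theorem getElem?_vecCons (a b : List α) (c : Fin k → List α) (j : ℕ) :
    (fun i => (Matrix.vecCons a (Matrix.vecCons b c) i)[j]?) =
      pairLetter a[j]? b[j]? fun i => (c i)[j]? := by
  funext i
  refine Fin.cases rfl (fun i => Fin.cases rfl (fun i => rfl) i) i

/-- Two words, a state `p` that loops on the second one and a state `q`, such that the words can be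
pumped to a clique with parameters `c`. -/
def HasPattern (A : FinNFA (Fin (k + 2) → Option α)) (c : Fin k → List α) : Prop :=
  ∃ p q f, f ∈ A.final ∧ ∃ (n : ℕ) (u : ℕ → Option α) (Z : List (Option α × Option α)),
    (∀ i, (c i).length ≤ n) ∧
    LRun A.step A.start ((List.range n).map fun j => pairLetter (u j) (u j) fun i => (c i)[j]?) p ∧
    Z ≠ [] ∧
    LRun A.step p (Z.map fun z => pairLetter z.2 z.2 noLetter) p ∧
    LRun A.step p (Z.map fun z => pairLetter z.1 z.2 noLetter) q ∧
    LRun A.step q (Z.map fun z => pairLetter none z.2 noLetter) q ∧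
    LRun A.step q ((Z.filterMap Prod.fst).map fun x => pairLetter none (some x) noLetter) f

/-- Such limits replace the repeated passage to subsequences in a Ramsey argument. -/
theorem exists_ultra_limit {ι S : Type} [Finite S] (U : Ultrafilter ι) (f : ι → S) :
    ∃ s, ∀ᶠ i in (U : Filter ι), f i = s := by
  have h : ∀ᶠ i in (U : Filter ι), ∃ s ∈ (Set.univ : Set S), f i = s :=
    Filter.Eventually.of_forall fun i => ⟨f i, trivial, rfl⟩
  obtain ⟨s, -, hs⟩ := (Ultrafilter.eventually_exists_mem_iff Set.finite_univ).1 h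
  exact ⟨s, hs⟩

/-- All limits are taken along one non-principal ultrafilter. Each limit statement holds for almost
all indices, hence finitely many of them hold simultaneously at some index; indices and cut
positions are picked in this way, one after the other. -/
theorem hasPattern_of_mem_ramsey [Finite α] {A : FinNFA (Fin (k + 2) → Option α)}
    {R : Set (Fin (k + 2) → List α)} (hA : Recognizes A R) {c : Fin k → List α}
    (hc : c ∈ ramsey R) : HasPattern A c := by
  obtain ⟨a, ha, hR⟩ := hc
  set U := Filter.hyperfilter ℕ with hU
  have hcof : ∀ P : ℕ → Prop, {i | ¬ P i}.Finite → ∀ᶠ i in (U : Filter ℕ), P i := fun P hP =>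
    Filter.hyperfilter_le_cofinite hP.compl_mem_cofinite |> fun h => by
      filter_upwards [h] with i hi
      simpa using hi
  have hgt : ∀ n, ∀ᶠ i in (U : Filter ℕ), n < i := fun n =>
    hcof _ ((Set.finite_Iic n).subset fun i hi => by simpa using hi)
  -- Over a finite alphabet there are finitely many words of bounded length, and the `a i` are
  -- distinct.
  have hlen : ∀ n, ∀ᶠ i in (U : Filter ℕ), n < (a i).length := fun n =>
    hcof _ (((List.finite_length_le α n).preimage ha.injOn).subset fun i hi => by simpa using hi)
  have hrun : ∀ i j, ∃ f, ∃ ρ : ℕ → Fin A.numStates, i < j → f ∈ A.final ∧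
      let W := conv (Matrix.vecCons (a i) (Matrix.vecCons (a j) c))
      (∀ t ≤ W.length, LRun A.step A.start (W.take t) (ρ t)) ∧
      (∀ t t', t ≤ t' → t' ≤ W.length → LRun A.step (ρ t) ((W.take t').drop t) (ρ t')) ∧
      ∀ t ≤ W.length, LRun A.step (ρ t) (W.drop t) f := by
    intro i j
    by_cases h : i < j
    · have : conv (Matrix.vecCons (a i) (Matrix.vecCons (a j) c)) ∈ A.language := by
        rw [hA]
        exact ⟨_, hR i j h, rfl⟩
      obtain ⟨f, hf, hr⟩ := (A.mem_language_iff _).1 this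
      obtain ⟨ρ, h₁, h₂, h₃⟩ := hr.exists_states
      exact ⟨f, ρ, fun _ => ⟨hf, h₁, h₂, h₃⟩⟩
    · exact ⟨A.start, fun _ => A.start, fun h' => absurd h' h⟩
  choose fin st hst using hrun
  -- `β` is the limit word. `S w t` is the limit, over the second word, of the state after `t`
  -- letters; `P t` is its limit over `w`, and `Q w` its limit over `t`. The two iterated limits are
  -- `p` and `q`.
  choose β hβ using fun t : ℕ => exists_ultra_limit U fun i => (a i)[t]?
  choose S hS using fun w t : ℕ => exists_ultra_limit U fun w' => st w w' t
  choose P hP using fun t : ℕ => exists_ultra_limit U fun w => S w t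
  obtain ⟨p, hp⟩ := exists_ultra_limit U P
  choose Q hQ using fun w : ℕ => exists_ultra_limit U fun t => S w t
  obtain ⟨q, hq⟩ := exists_ultra_limit U Q
  have hpre : ∀ n, ∀ᶠ i in (U : Filter ℕ), ∀ t < n, (a i)[t]? = β t := fun n =>
    (Filter.eventually_all_finite (Set.finite_lt_nat n)).2 fun t _ => hβ t
  -- The word `a v` will end before `t`, and `a w` between `t` and `t'`; the indices `x`, `x'` and
  -- `w'` are so far out that their words agree with `β` up to `t'`.
  obtain ⟨v, hv⟩ := hq.exists
  obtain ⟨t, hvt, hPt, hat, hct⟩ := ((hQ v).and (hp.and ((hgt (a v).length).and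
    (hgt (conv c).length)))).exists
  rw [hv] at hvt
  obtain ⟨w, hw₁, hw₂, hw₃, hw₄, hw₆⟩ := ((hS v t).and ((hP t).and (hq.and
    ((hgt v).and (hlen t))))).exists
  rw [hvt] at hw₁
  rw [hPt] at hw₂
  obtain ⟨t', ht₁, ht₂, ht₃, ht₄, ht₅⟩ := ((hQ w).and ((hQ v).and (hp.and ((hgt t).and
    (hgt (a w).length))))).exists
  rw [hw₃] at ht₁
  rw [hv] at ht₂
  obtain ⟨x, hx₁, hx₂, hx₃, hx₄⟩ := ((hP t).and ((hP t').and ((hpre t').and (hlen t')))).exists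
  rw [hPt] at hx₁
  rw [ht₃] at hx₂
  obtain ⟨x', hx'₁, hx'₂, hx'₃, hx'₄, hx'₅⟩ := ((hgt x).and ((hS x t).and ((hS x t').and
    ((hpre t').and (hlen t'))))).exists
  rw [hx₁] at hx'₂
  rw [hx₂] at hx'₃
  obtain ⟨w', hw'₁, hw'₂, hw'₃, hw'₄, hw'₅, hw'₆, hw'₇, hw'₈⟩ := ((hgt w).and ((hgt v).and
    ((hS w t).and ((hS w t').and ((hS v t).and ((hS v t').and ((hpre t').and
      (hlen t')))))))).exists
  rw [hw₂] at hw'₃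
  rw [ht₁] at hw'₄
  rw [hvt] at hw'₅
  rw [ht₂] at hw'₆
  have hcnone : ∀ j, t ≤ j → (fun i => (c i)[j]?) = noLetter := fun j hj => by
    funext i
    have := length_le_length_conv c i
    simp only [noLetter, List.getElem?_eq_none_iff]
    omega
  have hle : ∀ i j, (a j).length ≤
      (conv (Matrix.vecCons (a i) (Matrix.vecCons (a j) c))).length := fun i j =>
    length_le_length_conv (Matrix.vecCons (a i) (Matrix.vecCons (a j) c)) 1
  have htake : ∀ i j n, n ≤ (a j).length →
      (conv (Matrix.vecCons (a i) (Matrix.vecCons (a j) c))).take n =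
        (List.range n).map fun m => pairLetter (a i)[m]? (a j)[m]? fun i => (c i)[m]? := by
    intro i j n hn
    have := hle i j
    rw [length_conv] at this
    rw [conv, ← List.map_take, List.take_range, min_eq_left (hn.trans this)]
    refine List.map_congr_left fun m _ => ?_
    exact getElem?_vecCons _ _ _ _
  have hdrop : ∀ n, (List.range n).drop t = List.range' t (n - t) := fun n => by
    rw [List.range_eq_range', List.drop_range']
    simp
  have hmem : ∀ j, j ∈ List.range' t (t' - t) → t ≤ j ∧ j < t' := fun j hj => by
    rw [List.mem_range'_1] at hj
    omega
  -- The pair `(x, x')` provides the prefix and the loop at `p`, the pair `(w, w')` the way from `p`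
  -- to `q`, the pair `(v, w')` the loop at `q`, and the pair `(v, w)` the final part.
  obtain ⟨-, hxx₁, hxx₂, -⟩ := hst x x' hx'₁
  obtain ⟨-, -, hww, -⟩ := hst w w' hw'₁
  obtain ⟨-, -, hvw', -⟩ := hst v w' hw'₂
  obtain ⟨hfin, -, -, hvw⟩ := hst v w hw₄
  have e₁ := hle x x'
  have e₂ := hle w w'
  have e₃ := hle v w'
  have e₄ := hle v w
  -- Since `a w` ends before `t'`, its remainder appears in `Z` padded to the length of the factor
  -- of `β`.
  refine ⟨p, q, fin v w, hfin, t, β, (List.range' t (t' - t)).map fun j => ((a w)[j]?, β j),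
    fun i => (length_le_length_conv c i).trans hct.le, ?_, ?_, ?_, ?_, ?_, ?_⟩
  · have := hxx₁ t (by omega)
    rw [hx'₂, htake _ _ _ (by omega)] at this
    convert this using 1
    refine List.map_congr_left fun j hj => ?_
    rw [List.mem_range] at hj
    rw [hx₃ j (by omega), hx'₄ j (by omega)]
  · simp only [ne_eq, List.map_eq_nil_iff, List.range'_eq_nil_iff]
    omega
  · have := hxx₂ t t' ht₄.le (by omega)
    rw [hx'₂, hx'₃, htake _ _ _ (by omega), ← List.map_drop, hdrop] at this
    convert this using 1
    rw [List.map_map]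
    refine List.map_congr_left fun j hj => ?_
    obtain ⟨h₁, h₂⟩ := hmem j hj
    rw [hx₃ j h₂, hx'₄ j h₂, hcnone j h₁]
    rfl
  · have := hww t t' ht₄.le (by omega)
    rw [hw'₃, hw'₄, htake _ _ _ (by omega), ← List.map_drop, hdrop] at this
    convert this using 1
    rw [List.map_map]
    refine List.map_congr_left fun j hj => ?_
    obtain ⟨h₁, h₂⟩ := hmem j hj
    rw [hw'₇ j h₂, hcnone j h₁]
    rfl
  · have := hvw' t t' ht₄.le (by omega)
    rw [hw'₅, hw'₆, htake _ _ _ (by omega), ← List.map_drop, hdrop] at this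
    convert this using 1
    rw [List.map_map]
    refine List.map_congr_left fun j hj => ?_
    obtain ⟨h₁, h₂⟩ := hmem j hj
    rw [hw'₇ j h₂, hcnone j h₁, List.getElem?_eq_none (l := a v) (by omega)]
    rfl
  · have := hvw t (by omega)
    have hlenW : (conv (Matrix.vecCons (a v) (Matrix.vecCons (a w) c))).length =
        (a w).length := by
      refine le_antisymm ?_ e₄
      rw [length_conv]
      refine Finset.sup_le fun i _ => Fin.cases ?_ (fun i => Fin.cases le_rfl (fun i => ?_) i) i
      · simp only [Matrix.cons_val_zero]; omega
      · have := length_le_length_conv c i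
        simp only [Matrix.cons_val_succ]; omega
    rw [hw₁, ← List.take_length (l := conv _), hlenW, htake _ _ _ le_rfl, ← List.map_drop,
      hdrop] at this
    convert this using 1
    rw [List.filterMap_map]
    have h₁ : List.filterMap (Prod.fst ∘ fun j => ((a w)[j]?, β j)) (List.range' t (t' - t)) =
        (a w).drop t := by
      have h₂ := range_map_filterMap ((a w).drop t) (t' - t) (by simp; omega)
      rw [← h₂, List.range'_eq_map_range, List.filterMap_map]
      simp [Function.comp_def]
    rw [h₁]
    apply List.ext_getElem
    · simp
    · intro i h₁ h₂
      simp only [List.length_map, List.length_range'] at h₂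
      simp only [List.getElem_map, List.getElem_drop, List.getElem_range', one_mul]
      rw [hcnone _ (by omega), List.getElem?_eq_none (l := a v) (by omega),
        List.getElem?_eq_getElem (by omega)]

end Cliques

end RamseyWords

namespace RamseyWords

/-! ### The automaton for the Ramsey quantifier -/

section CliqueAutomaton

/-- The kinds of moves of the automaton for the Ramsey quantifier. In the first phase it follows a
run on `(u, u, c)`; then it guesses two states and follows four runs in parallel. -/
inductive MoveKind where
  | silent | blank | letter | guess
  | eps (b : Bool) (g : Fin 6 → Bool)
  | read (b : Bool)
  | tail (b : Bool)
  deriving Fintype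

namespace MoveKind

/-- Which of the six tracks move along a transition; the others stay at a state. -/
def go : MoveKind → Fin 6 → Bool
  | silent | blank | letter => ![true, false, false, false, false, false]
  | guess => fun _ => false
  | eps _ g => g
  | read _ => ![false, false, true, true, true, true]
  | tail _ => ![false, false, true, true, true, false]

/-- The flag `none` marks the first phase. In the second phase the Boolean records whether a letter
of the loops has been read, since `Z` must not be empty. -/
def srcFlag : MoveKind → Option Bool
  | silent | blank | letter | guess => none
  | eps b _ | read b | tail b => some b

def tgtFlag : MoveKind → Option Bool
  | silent | blank | letter => none
  | guess => some false
  | eps b _ => some b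
  | read _ | tail _ => some true

def src : MoveKind → Fin 6 → Fin 6
  | silent | blank | letter | guess => fun _ => 0
  | eps _ _ | read _ | tail _ => id

/-- In the first phase all six components equal the state on track `0`. At `guess` the edges `0` and
`1` stand for `p` and `q`: tracks `2`, `3` start at `p` and tracks `4`, `5` at `q`. -/
def tgt : MoveKind → Fin 6 → Fin 6
  | silent | blank | letter => fun _ => 0
  | guess => ![0, 1, 0, 0, 1, 1]
  | eps _ _ | read _ | tail _ => id

/-- The condition on the labels `L` of the six tracks and on the label `l` of the move. -/
def Fits {α : Type} {k : ℕ} (L : Fin 6 → Option (Fin (k + 2) → Option α))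
    (l : Option (Fin k → Option α)) : MoveKind → Prop
  | silent => L 0 = none ∧ l = none
  | blank => (∃ x, L 0 = some (pairLetter x x noLetter)) ∧ l = none
  | letter => ∃ x v, L 0 = some (pairLetter x x v) ∧ v ≠ noLetter ∧ l = some v
  | guess => l = none
  | eps _ g => (∀ i, L i = none) ∧ g 0 = false ∧ g 1 = false ∧ l = none
  | read _ => (∃ x y, L 2 = some (pairLetter y y noLetter) ∧ L 3 = some (pairLetter x y noLetter) ∧
      L 4 = some (pairLetter none y noLetter) ∧ L 5 = some (pairLetter none x noLetter)) ∧ l = none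
  | tail _ => (∃ y, L 2 = some (pairLetter y y noLetter) ∧
      L 3 = some (pairLetter none y noLetter) ∧ L 4 = some (pairLetter none y noLetter)) ∧ l = none

end MoveKind

variable {α : Type} {k : ℕ}

/-- A program represents a state by a position where it is written, so idle tracks are restricted to
states that occur in the text as the initial state or in a transition. -/
def FinNFA.Mentioned {β : Type} (A : FinNFA β) (q : Fin A.numStates) : Prop :=
  q = A.start ∨ ∃ e ∈ A.trans, e.1 = q ∨ e.2.2 = q

/-- A transition, or a state that occurs in the automaton, seen as a loop. -/
def FinNFA.Edge {β : Type} (A : FinNFA β) (b : Bool)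
    (e : Fin A.numStates × Option β × Fin A.numStates) : Prop :=
  if b then e ∈ A.trans else A.Mentioned e.1 ∧ e.2 = (none, e.1)

variable (A : FinNFA (Fin (k + 2) → Option α))

/-- The states of the automaton for the Ramsey quantifier: a phase and six states. -/
abbrev CliqueState (n : ℕ) : Type := Option Bool × (Fin 6 → Fin n)

def CliqueStep (s : CliqueState A.numStates) (l : Option (Fin k → Option α))
    (s' : CliqueState A.numStates) : Prop :=
  ∃ (m : MoveKind) (z : Fin 6 →
      Fin A.numStates × Option (Fin (k + 2) → Option α) × Fin A.numStates),
    (∀ i, A.Edge (m.go i) (z i)) ∧ m.Fits (fun i => (z i).2.1) l ∧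
    s = (m.srcFlag, fun i => (z (m.src i)).1) ∧ s' = (m.tgtFlag, fun i => (z (m.tgt i)).2.2)

/-- Tracks `0` and `1` have preserved `p` and `q`. Track `2` must be back at `p`, track `3` has come
from `p` to `q`, track `4` must be back at `q`, and track `5` has to end in a final state. -/
def CliqueFinal (s : CliqueState A.numStates) : Prop :=
  ∃ p q f, A.Mentioned p ∧ A.Mentioned q ∧ f ∈ A.final ∧ s = (some true, ![p, q, p, q, q, f])

variable {A}

theorem FinNFA.Edge.lrun {β : Type} {A : FinNFA β} {b : Bool}
    {e : Fin A.numStates × Option β × Fin A.numStates} (h : A.Edge b e) :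
    LRun A.step e.1 e.2.1.toList e.2.2 := by
  cases b
  · obtain ⟨-, h⟩ := h
    simp only [h]
    exact .nil _
  · exact .single h

/-! ### Soundness: accepting runs yield cliques -/

section Soundness

/-- `W₁` is the word followed on track `0` in the first phase; `Z` collects the letters guessed for
tracks `2` to `4`, and `W₂` is the word of track `5`. Letters of pure padding are not excluded here,
so `W₂` is tied to `Z` only after padding has been erased. -/
def SoundInv (A : FinNFA (Fin (k + 2) → Option α)) (w : List (Fin k → Option α))
    (s : CliqueState A.numStates) : Prop :=
  ∃ W₁ : List (Fin (k + 2) → Option α), (∀ l ∈ W₁, l 0 = l 1) ∧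
    (∃ W : List (Fin k → Option α), W₁.map (fun l (i : Fin k) => l i.succ.succ) = W ∧
      ∀ [DecidablePred fun l : Fin k → Option α => l ≠ noLetter], W.filter (· ≠ noLetter) = w) ∧
    LRun A.step A.start W₁ (s.2 0) ∧ (s.1 = none → ∀ i, s.2 i = s.2 0) ∧
    (s.1 ≠ none → ∃ (Z : List (Option α × Option α)) (W₂ : List (Fin (k + 2) → Option α)),
      LRun A.step (s.2 0) (Z.map fun z => pairLetter z.2 z.2 noLetter) (s.2 2) ∧
      LRun A.step (s.2 0) (Z.map fun z => pairLetter z.1 z.2 noLetter) (s.2 3) ∧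
      LRun A.step (s.2 1) (Z.map fun z => pairLetter none z.2 noLetter) (s.2 4) ∧
      LRun A.step (s.2 1) W₂ (s.2 5) ∧
      (∀ l ∈ W₂, l 0 = none ∧ (fun i : Fin k => l i.succ.succ) = noLetter) ∧
      W₂.filterMap (· 1) = Z.filterMap Prod.fst ∧ (s.1 = some true → Z ≠ []))

theorem soundInv_step {w : List (Fin k → Option α)} {s s' : CliqueState A.numStates}
    {l : Option (Fin k → Option α)} (h : SoundInv A w s) (hs : CliqueStep A s l s') :
    SoundInv A (w ++ l.toList) s' := by
  obtain ⟨W₁, hd, ⟨W, hW, hw⟩, hr, h₀, h₁⟩ := h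
  obtain ⟨m, z, hz, hf, rfl, rfl⟩ := hs
  have step : ∀ {p u i}, LRun A.step p u (z i).1 → LRun A.step p (u ++ (z i).2.1.toList) (z i).2.2 :=
    fun h => h.trans (hz _).lrun
  have phase_one : ∀ m' : MoveKind, m'.srcFlag = none → m'.tgt = (fun _ => 0) → m'.tgtFlag = none →
      LRun A.step A.start W₁ (z 0).1 →
      (∀ l ∈ (z 0).2.1.toList, l 0 = l 1) →
      (∀ [DecidablePred fun l : Fin k → Option α => l ≠ noLetter],
        ((z 0).2.1.toList.map (fun l (i : Fin k) => l i.succ.succ)).filter (· ≠ noLetter) =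
          l.toList) →
      SoundInv A (w ++ l.toList) (m'.tgtFlag, fun i => (z (m'.tgt i)).2.2) := by
    intro m' _ ht htf hr' hl hll
    refine ⟨W₁ ++ (z 0).2.1.toList, ?_, ⟨_, rfl, ?_⟩, ?_, ?_, ?_⟩
    · intro l hl'
      rcases List.mem_append.1 hl' with h | h
      · exact hd l h
      · exact hl l h
    · intro inst
      rw [List.map_append, List.filter_append, hll, hW, hw]
    · simp only [ht]
      exact step hr'
    · intro _ i
      simp only [ht]
    · intro h
      exact absurd htf h
  cases m with
  | silent =>
    obtain ⟨h, rfl⟩ := hf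
    dsimp only at h
    refine phase_one .silent rfl rfl rfl hr ?_ ?_ <;> simp [h]
  | blank =>
    obtain ⟨⟨x, h⟩, rfl⟩ := hf
    dsimp only at h
    refine phase_one .blank rfl rfl rfl hr ?_ ?_ <;> simp [h]
  | letter =>
    obtain ⟨x, v, h, hv, rfl⟩ := hf
    dsimp only at h
    refine phase_one .letter rfl rfl rfl hr ?_ ?_ <;> simp [h, hv]
  | guess =>
    obtain rfl := hf
    have hstay : ∀ i, (z i).2.2 = (z i).1 := fun i => by
      have := (hz i).2
      rw [this]
    refine ⟨W₁, hd, ⟨W, hW, ?_⟩, ?_, ?_, ?_⟩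
    · intro _
      simpa using hw
    · simpa [MoveKind.tgt, hstay, MoveKind.src] using hr
    · simp [MoveKind.tgtFlag]
    · intro _
      refine ⟨[], [], .nil _, .nil _, .nil _, .nil _, by simp, rfl, by simp [MoveKind.tgtFlag]⟩
  | eps b g =>
    obtain ⟨hl, hg₀, hg₁, rfl⟩ := hf
    dsimp only at hl
    have hstay : ∀ i, g i = false → (z i).2.2 = (z i).1 := fun i hi => by
      have := hz i
      simp only [MoveKind.go, hi] at this
      rw [this.2]
    have heps : ∀ {p u i}, LRun A.step p u (z i).1 → LRun A.step p u (z i).2.2 := fun {p u i} h => by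
      simpa [hl] using step h
    obtain ⟨Z, W₂, h₂, h₃, h₄, h₅, h₆, h₇, h₈⟩ := h₁ (by simp [MoveKind.srcFlag])
    simp only [MoveKind.src, id] at h₂ h₃ h₄ h₅ hr
    refine ⟨W₁, hd, ⟨W, hW, by intro _; simpa using hw⟩, heps hr, by simp [MoveKind.tgtFlag],
      fun _ => ⟨Z, W₂, ?_, ?_, ?_, ?_, h₆, h₇, h₈⟩⟩
    all_goals simp only [MoveKind.tgt, id, hstay 0 hg₀, hstay 1 hg₁]
    exacts [heps h₂, heps h₃, heps h₄, heps h₅]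
  | read b =>
    obtain ⟨⟨x, y, hl₂, hl₃, hl₄, hl₅⟩, rfl⟩ := hf
    dsimp only at hl₂ hl₃ hl₄ hl₅
    have hs₀ : (z 0).2.2 = (z 0).1 := by rw [(hz 0).2]
    have hs₁ : (z 1).2.2 = (z 1).1 := by rw [(hz 1).2]
    obtain ⟨Z, W₂, h₂, h₃, h₄, h₅, h₆, h₇, h₈⟩ := h₁ (by simp [MoveKind.srcFlag])
    simp only [MoveKind.src, id] at h₂ h₃ h₄ h₅ hr
    refine ⟨W₁, hd, ⟨W, hW, by intro _; simpa using hw⟩, by simpa [MoveKind.tgt, hs₀] using hr,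
      by simp [MoveKind.tgtFlag],
      fun _ => ⟨Z ++ [(x, y)], W₂ ++ [pairLetter none x noLetter], ?_, ?_, ?_, ?_, ?_, ?_, by simp⟩⟩
    · simpa [MoveKind.tgt, hs₀, hl₂] using step h₂
    · simpa [MoveKind.tgt, hs₀, hl₃] using step h₃
    · simpa [MoveKind.tgt, hs₁, hl₄] using step h₄
    · simpa [MoveKind.tgt, hs₁, hl₅] using step h₅
    · intro l hl
      rcases List.mem_append.1 hl with h | h
      · exact h₆ l h
      · obtain rfl := List.mem_singleton.1 h
        exact ⟨rfl, rfl⟩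
    · rw [List.filterMap_append, List.filterMap_append, h₇]
      cases x <;> simp
  | tail b =>
    obtain ⟨⟨y, hl₂, hl₃, hl₄⟩, rfl⟩ := hf
    dsimp only at hl₂ hl₃ hl₄
    have hs₀ : (z 0).2.2 = (z 0).1 := by rw [(hz 0).2]
    have hs₁ : (z 1).2.2 = (z 1).1 := by rw [(hz 1).2]
    have hs₅ : (z 5).2.2 = (z 5).1 := by rw [(hz 5).2]
    obtain ⟨Z, W₂, h₂, h₃, h₄, h₅, h₆, h₇, h₈⟩ := h₁ (by simp [MoveKind.srcFlag])
    simp only [MoveKind.src, id] at h₂ h₃ h₄ h₅ hr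
    refine ⟨W₁, hd, ⟨W, hW, by intro _; simpa using hw⟩, by simpa [MoveKind.tgt, hs₀] using hr,
      by simp [MoveKind.tgtFlag],
      fun _ => ⟨Z ++ [(none, y)], W₂, ?_, ?_, ?_, ?_, h₆, ?_, by simp⟩⟩
    · simpa [MoveKind.tgt, hs₀, hl₂] using step h₂
    · simpa [MoveKind.tgt, hs₀, hl₃] using step h₃
    · simpa [MoveKind.tgt, hs₁, hl₄] using step h₄
    · simpa [MoveKind.tgt, hs₁, hs₅] using h₅
    · rw [List.filterMap_append, h₇]
      simp

/-- Every pumped word `V i d` is accepted, hence it is the convolution of a tuple in `R`; by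
`filterMap_conv` this tuple is found by erasing padding. So it does not matter that the moves never
check whether padding occurs only at the ends of words. -/
theorem exists_ramsey_of_lrun {R : Set (Fin (k + 2) → List α)} (hA : Recognizes A R)
    {w : List (Fin k → Option α)} {s : CliqueState A.numStates}
    (h : LRun (CliqueStep A) (none, fun _ => A.start) w s) (hs : CliqueFinal A s) :
    ∃ c ∈ ramsey R, conv c = w := by
  classical
  have hinv : SoundInv A w s := by
    refine LRun.snoc_induction (SoundInv A) ?_ (fun w s l s' h h' => soundInv_step h h') h
    exact ⟨[], by simp, ⟨_, rfl, by simp⟩, .nil _, by simp, by simp⟩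
  obtain ⟨p, q, f, -, -, hf, rfl⟩ := hs
  obtain ⟨W₁, hd, ⟨W, hW, hw⟩, hr, -, h₁⟩ := hinv
  obtain ⟨Z, W₂, h₂, h₃, h₄, h₅, h₆, h₇, h₈⟩ := h₁ (by simp)
  have hZ := h₈ rfl
  change LRun A.step A.start W₁ p at hr
  change LRun A.step p _ p at h₂
  change LRun A.step p _ q at h₃
  change LRun A.step q _ q at h₄
  change LRun A.step q _ f at h₅
  set U := W₁.filterMap (· 0) with hU
  have hU' : W₁.filterMap (· 1) = U := by
    rw [hU]
    exact List.filterMap_congr fun l hl => (hd l hl).symm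
  set Y := Z.filterMap Prod.snd with hY
  set X := Z.filterMap Prod.fst with hX
  set a : ℕ → List α := fun i => U ++ (List.replicate i Y).flatten ++ X with ha
  set c : Fin k → List α := fun i => W₁.filterMap (· i.succ.succ) with hc
  -- The word for the pair with indices `i` and `i + d + 1`.
  set V : ℕ → ℕ → List (Fin (k + 2) → Option α) := fun i d =>
    W₁ ++ (List.replicate i (Z.map fun z => pairLetter z.2 z.2 noLetter)).flatten ++
      (Z.map fun z => pairLetter z.1 z.2 noLetter) ++
      (List.replicate d (Z.map fun z => pairLetter none z.2 noLetter)).flatten ++ W₂ with hV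
  have hrun : ∀ i d, LRun A.step A.start (V i d) f := fun i d =>
    (((hr.trans (h₂.flatten_replicate i)).trans h₃).trans (h₄.flatten_replicate d)).trans h₅
  have hflat : ∀ {β γ : Type} (n : ℕ) (L : List β) (g : β → Option γ),
      (List.replicate n L).flatten.filterMap g = (List.replicate n (L.filterMap g)).flatten := by
    intro β γ n L g
    induction n with
    | zero => rfl
    | succ n ih => simp [List.replicate_succ, ih]
  have hsnone : ∀ (n : ℕ), (List.replicate n ([] : List α)).flatten = [] := fun n => by simp
  have hmem : ∀ i d, ∃ v ∈ R, conv v = V i d ∧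
      v = Matrix.vecCons (a i) (Matrix.vecCons (a (i + d + 1)) c) := by
    intro i d
    have hl : V i d ∈ A.language := (A.mem_language_iff _).2 ⟨f, hf, hrun i d⟩
    rw [hA] at hl
    obtain ⟨v, hv, hvV⟩ := hl
    refine ⟨v, hv, hvV, ?_⟩
    have hcomp : ∀ j, v j = (V i d).filterMap (· j) := fun j => by rw [← hvV, filterMap_conv]
    have h0 : W₂.filterMap (· 0) = [] := by
      rw [List.filterMap_eq_nil_iff]
      exact fun l hl => (h₆ l hl).1
    have hss : ∀ j : Fin k, W₂.filterMap (· j.succ.succ) = [] := fun j => by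
      rw [List.filterMap_eq_nil_iff]
      exact fun l hl => congrFun (h₆ l hl).2 j
    funext j
    rw [hcomp]
    refine Fin.cases ?_ (fun j => Fin.cases ?_ (fun j => ?_) j) j
    · simp only [hV, List.filterMap_append, hflat, List.filterMap_map, h0, Function.comp_def,
        pairLetter_zero, Matrix.cons_val_zero, ha, List.append_nil]
      simp only [List.filterMap_none, hsnone, List.append_nil]
      rfl
    · simp only [hV, List.filterMap_append, hflat, List.filterMap_map, Function.comp_def]
      simp only [show (Fin.succ (0 : Fin (k + 1))) = 1 from rfl, pairLetter_one, hU', h₇,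
        Matrix.cons_val_one, Matrix.cons_val_zero, ha]
      -- The second component reads `Y` in the loop at `p`, once on the way to `q`, and in the loop
      -- at `q`.
      have : List.replicate (i + d + 1) Y = List.replicate i Y ++ [Y] ++ List.replicate d Y := by
        rw [show [Y] = List.replicate 1 Y from rfl, ← List.replicate_add, ← List.replicate_add]
        congr 1
        omega
      rw [this, List.flatten_append, List.flatten_append]
      simp [hY, List.append_assoc]
    · simp only [hV, List.filterMap_append, hflat, List.filterMap_map, Function.comp_def,
        pairLetter_succ_succ, hss]
      simp [noLetter, hc]
  -- A letter `(⊥, ⊥, …)` never occurs in a convolution, so the first pair in `Z` already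
  -- contributes a symbol to `Y`. Hence the lengths of the `a i` are strictly increasing.
  have hYne : Y ≠ [] := by
    obtain ⟨z, Z', rfl⟩ := List.exists_cons_of_ne_nil hZ
    obtain ⟨v, -, hv, -⟩ := hmem 1 0
    have : pairLetter z.2 z.2 noLetter ∈ conv v := by
      rw [hv, hV]
      simp
    obtain ⟨i, hi⟩ := exists_ne_none_of_mem_conv this
    have hz : z.2 ≠ none := by
      intro h
      rw [h] at hi
      refine hi ?_
      refine Fin.cases rfl (fun j => Fin.cases rfl (fun j => rfl) j) i
    obtain ⟨y, hy⟩ := Option.ne_none_iff_exists'.1 hz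
    simp [hY, hy]
  refine ⟨c, ⟨a, ?_, ?_⟩, ?_⟩
  · intro i j hij
    have := congrArg List.length hij
    simp only [ha, List.length_append, List.length_flatten, List.map_replicate,
      List.sum_replicate, smul_eq_mul] at this
    have hpos := List.length_pos_iff.2 hYne
    exact Nat.eq_of_mul_eq_mul_right hpos (by omega)
  · intro i j hij
    obtain ⟨v, hv, -, rfl⟩ := hmem i (j - i - 1)
    rwa [show i + (j - i - 1) + 1 = j by omega] at hv
  -- Any pair would do: outside `W₁` the parameter components are pure padding.
  · obtain ⟨v, -, hv, hvc⟩ := hmem 0 0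
    have h := filter_tail_conv v
    rw [hv] at h
    have hc' : (fun i : Fin k => v i.succ.succ) = c := by rw [hvc]; rfl
    rw [hc'] at h
    rw [← h, ← hw]
    have hz : ∀ (L : List (Fin (k + 2) → Option α)),
        (∀ l ∈ L, (fun i : Fin k => l i.succ.succ) = noLetter) →
        (L.map fun l (i : Fin k) => l i.succ.succ).filter (· ≠ fun _ => none) = [] := by
      intro L hL
      rw [List.filter_eq_nil_iff]
      intro l hl
      obtain ⟨l', hl', rfl⟩ := List.mem_map.1 hl
      rw [hL l' hl']
      simp only [ne_eq, decide_not, Bool.not_eq_true', decide_eq_false_iff_not, not_not]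
      rfl
    simp only [hV, List.map_append, List.filter_append]
    rw [hz W₂ fun l hl => (h₆ l hl).2, hz (Z.map _) fun l hl => by
      obtain ⟨z, -, rfl⟩ := List.mem_map.1 hl
      rfl, hW]
    simp only [List.replicate_zero, List.flatten_nil, List.map_nil, List.filter_nil,
      List.append_nil]
    rfl

end Soundness

/-! ### Completeness: patterns yield accepting runs -/

section Completeness

theorem FinNFA.mentioned_of_step {β : Type} {A : FinNFA β} {p q : Fin A.numStates} {l : Option β}
    (h : A.step p l q) : A.Mentioned p ∧ A.Mentioned q :=
  ⟨.inr ⟨_, h, .inl rfl⟩, .inr ⟨_, h, .inr rfl⟩⟩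

theorem FinNFA.mentioned_of_lrun {β : Type} {A : FinNFA β} {p q : Fin A.numStates} {w : List β}
    (h : LRun A.step p w q) (hp : A.Mentioned p) : A.Mentioned q := by
  induction h with
  | nil => exact hp
  | cons hs _ ih => exact ih (mentioned_of_step hs).2

theorem FinNFA.edge_true {β : Type} {A : FinNFA β} {p q : Fin A.numStates} {l : Option β}
    (h : A.step p l q) : A.Edge true (p, l, q) := h

theorem FinNFA.edge_false {β : Type} {A : FinNFA β} {p : Fin A.numStates}
    (h : A.Mentioned p) : A.Edge false (p, none, p) := ⟨h, rfl⟩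

theorem FinNFA.mentioned_start {β : Type} (A : FinNFA β) : A.Mentioned A.start := .inl rfl

theorem phase_one_step {p q : Fin A.numStates} {l : Option (Fin (k + 2) → Option α)}
    {l' : Option (Fin k → Option α)} (m : MoveKind)
    (hm : m = .silent ∨ m = .blank ∨ m = .letter)
    (h : A.step p l q) (hf : ∀ L, L 0 = l → m.Fits L l') :
    CliqueStep A (none, fun _ => p) l' (none, fun _ => q) := by
  -- Only track `0` counts in the first phase; the others idle at the initial state, which always
  -- occurs in the text.
  refine ⟨m, fun i => if i = 0 then (p, l, q) else (A.start, none, A.start), ?_, hf _ rfl, ?_⟩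
  · intro i
    have hgo : m.go = ![true, false, false, false, false, false] := by
      rcases hm with rfl | rfl | rfl <;> rfl
    rw [hgo]
    fin_cases i
    · exact FinNFA.edge_true h
    all_goals exact FinNFA.edge_false A.mentioned_start
  · rcases hm with rfl | rfl | rfl <;> exact ⟨rfl, rfl⟩

theorem lrun_phase_one_eps {p q : Fin A.numStates} {w : List (Fin (k + 2) → Option α)}
    (h : LRun A.step p w q) (hw : w = []) :
    LRun (CliqueStep A) (none, fun _ => p) [] (none, fun _ => q) := by
  induction h with
  | nil => exact .nil _
  | @cons p q r l w hs _ ih =>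
    obtain ⟨hl, hw⟩ := List.append_eq_nil_iff.1 hw
    obtain rfl : l = none := by simpa using hl
    exact .cons (l := none) (phase_one_step .silent (.inl rfl) hs fun L hL => ⟨hL, rfl⟩) (ih hw)

theorem lrun_phase_one [DecidablePred fun l : Fin k → Option α => l ≠ noLetter]
    {p q : Fin A.numStates} {W : List (Option α × (Fin k → Option α))}
    (h : LRun A.step p (W.map fun l => pairLetter l.1 l.1 l.2) q) :
    LRun (CliqueStep A) (none, fun _ => p) ((W.map Prod.snd).filter (· ≠ noLetter))
      (none, fun _ => q) := by
  induction W generalizing p with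
  | nil => exact lrun_phase_one_eps h rfl
  | cons l W ih =>
    obtain ⟨r, r', h₁, h₂, h₃⟩ := LRun.cons_split h
    have h₁' := lrun_phase_one_eps h₁ rfl
    by_cases hl : l.2 = noLetter
    · rw [List.map_cons, List.filter_cons_of_neg (by simpa using hl)]
      exact h₁'.trans (.cons (l := none) (phase_one_step .blank (.inr (.inl rfl)) h₂
        fun L hL => ⟨⟨l.1, by rw [hL, ← hl]⟩, rfl⟩) (ih h₃))
    · rw [List.map_cons, List.filter_cons_of_pos (by simpa using hl)]
      exact h₁'.trans (.cons (l := some l.2) (phase_one_step .letter (.inr (.inr rfl)) h₂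
        fun L hL => ⟨l.1, l.2, hL, hl, rfl⟩) (ih h₃))

/-- The four runs need not make their silent transitions simultaneously, so these are carried out on
one track at a time. Tracks `0` and `1` are excluded because they store `p` and `q`. -/
theorem lrun_track_eps (b : Bool) (i : Fin 6) (hi₀ : i ≠ 0) (hi₁ : i ≠ 1)
    {w : List (Fin (k + 2) → Option α)} {p r : Fin A.numStates} (h : LRun A.step p w r)
    (hw : w = []) (g : Fin 6 → Fin A.numStates) (hg : ∀ i, A.Mentioned (g i)) (hp : g i = p) :
    LRun (CliqueStep A) (some b, g) [] (some b, Function.update g i r) := by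
  induction h generalizing g with
  | nil p => rw [← hp, Function.update_eq_self]; exact .nil _
  | @cons p q r l w hs _ ih =>
    obtain ⟨hl, hw⟩ := List.append_eq_nil_iff.1 hw
    obtain rfl : l = none := by simpa using hl
    have := ih hw (Function.update g i q) (fun j => by
      by_cases hj : j = i
      · subst hj; simpa using (FinNFA.mentioned_of_step hs).2
      · simpa [hj] using hg j) (by simp)
    rw [Function.update_idem] at this
    refine .cons (l := none) ⟨.eps b fun j => decide (j = i),
      fun j => (g j, none, Function.update g i q j), fun j => ?_, ⟨by simp, by simpa using hi₀.symm,
        by simpa using hi₁.symm, rfl⟩, rfl, rfl⟩ this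
    by_cases hj : j = i
    · subst hj
      simp only [MoveKind.go, decide_true, Function.update_self, hp]
      exact FinNFA.edge_true hs
    · simp only [MoveKind.go, hj, decide_false]
      rw [Function.update_of_ne hj]
      exact FinNFA.edge_false (hg j)

theorem lrun_tracks_eps (b : Bool) {p q a₂ a₃ a₄ a₅ b₂ b₃ b₄ b₅ : Fin A.numStates}
    (hp : A.Mentioned p) (hq : A.Mentioned q) (h₂ : A.Mentioned a₂) (h₃ : A.Mentioned a₃)
    (h₄ : A.Mentioned a₄) (h₅ : A.Mentioned a₅) (r₂ : LRun A.step a₂ [] b₂)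
    (r₃ : LRun A.step a₃ [] b₃) (r₄ : LRun A.step a₄ [] b₄) (r₅ : LRun A.step a₅ [] b₅) :
    LRun (CliqueStep A) (some b, ![p, q, a₂, a₃, a₄, a₅]) [] (some b, ![p, q, b₂, b₃, b₄, b₅]) := by
  have m₂ := FinNFA.mentioned_of_lrun r₂ h₂
  have m₃ := FinNFA.mentioned_of_lrun r₃ h₃
  have m₄ := FinNFA.mentioned_of_lrun r₄ h₄
  have t₂ := lrun_track_eps b 2 (by decide) (by decide) r₂ rfl ![p, q, a₂, a₃, a₄, a₅]
    (fun i => by fin_cases i <;> assumption) rfl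
  have t₃ := lrun_track_eps b 3 (by decide) (by decide) r₃ rfl ![p, q, b₂, a₃, a₄, a₅]
    (fun i => by fin_cases i <;> assumption) rfl
  have t₄ := lrun_track_eps b 4 (by decide) (by decide) r₄ rfl ![p, q, b₂, b₃, a₄, a₅]
    (fun i => by fin_cases i <;> assumption) rfl
  have t₅ := lrun_track_eps b 5 (by decide) (by decide) r₅ rfl ![p, q, b₂, b₃, b₄, a₅]
    (fun i => by fin_cases i <;> assumption) rfl
  have e₂ : Function.update ![p, q, a₂, a₃, a₄, a₅] 2 b₂ = ![p, q, b₂, a₃, a₄, a₅] := by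
    ext i; fin_cases i <;> rfl
  have e₃ : Function.update ![p, q, b₂, a₃, a₄, a₅] 3 b₃ = ![p, q, b₂, b₃, a₄, a₅] := by
    ext i; fin_cases i <;> rfl
  have e₄ : Function.update ![p, q, b₂, b₃, a₄, a₅] 4 b₄ = ![p, q, b₂, b₃, b₄, a₅] := by
    ext i; fin_cases i <;> rfl
  have e₅ : Function.update ![p, q, b₂, b₃, b₄, a₅] 5 b₅ = ![p, q, b₂, b₃, b₄, b₅] := by
    ext i; fin_cases i <;> rfl
  rw [e₂] at t₂
  rw [e₃] at t₃
  rw [e₄] at t₄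
  rw [e₅] at t₅
  exact ((t₂.trans t₃).trans t₄).trans t₅

/-- A pair with a symbol in its first component becomes a `read` move; for a padded one, track `5`
waits in a `tail` move. All tracks therefore finish together. -/
theorem lrun_tracks (Z : List (Option α × Option α)) (b : Bool)
    {p q a₂ a₃ a₄ a₅ b₂ b₃ b₄ b₅ : Fin A.numStates}
    (hp : A.Mentioned p) (hq : A.Mentioned q) (h₂ : A.Mentioned a₂) (h₃ : A.Mentioned a₃)
    (h₄ : A.Mentioned a₄) (h₅ : A.Mentioned a₅)
    (r₂ : LRun A.step a₂ (Z.map fun z => pairLetter z.2 z.2 noLetter) b₂)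
    (r₃ : LRun A.step a₃ (Z.map fun z => pairLetter z.1 z.2 noLetter) b₃)
    (r₄ : LRun A.step a₄ (Z.map fun z => pairLetter none z.2 noLetter) b₄)
    (r₅ : LRun A.step a₅ ((Z.filterMap Prod.fst).map fun x => pairLetter none (some x) noLetter)
      b₅) :
    LRun (CliqueStep A) (some b, ![p, q, a₂, a₃, a₄, a₅]) []
      (some (b || !Z.isEmpty), ![p, q, b₂, b₃, b₄, b₅]) := by
  induction Z generalizing b a₂ a₃ a₄ a₅ with
  | nil => simpa using lrun_tracks_eps b hp hq h₂ h₃ h₄ h₅ r₂ r₃ r₄ r₅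
  | cons z Z ih =>
    obtain ⟨c₂, d₂, u₂, v₂, w₂⟩ := LRun.cons_split r₂
    obtain ⟨c₃, d₃, u₃, v₃, w₃⟩ := LRun.cons_split r₃
    obtain ⟨c₄, d₄, u₄, v₄, w₄⟩ := LRun.cons_split r₄
    have n₂ := (FinNFA.mentioned_of_step v₂).2
    have n₃ := (FinNFA.mentioned_of_step v₃).2
    have n₄ := (FinNFA.mentioned_of_step v₄).2
    obtain ⟨x, y⟩ := z
    cases x with
    | none =>
      have t := lrun_tracks_eps b hp hq h₂ h₃ h₄ h₅ u₂ u₃ u₄ (.nil a₅)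
      have t' := ih true n₂ n₃ n₄ h₅ w₂ w₃ w₄ r₅
      have s : CliqueStep A (some b, ![p, q, c₂, c₃, c₄, a₅]) none
          (some true, ![p, q, d₂, d₃, d₄, a₅]) := by
        refine ⟨.tail b, ![(p, none, p), (q, none, q), (c₂, _, d₂), (c₃, _, d₃), (c₄, _, d₄),
          (a₅, none, a₅)], ?_, ⟨⟨y, rfl, rfl, rfl⟩, rfl⟩, ?_, ?_⟩
        · intro i
          fin_cases i
          exacts [FinNFA.edge_false hp, FinNFA.edge_false hq, FinNFA.edge_true v₂,
            FinNFA.edge_true v₃, FinNFA.edge_true v₄, FinNFA.edge_false h₅]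
        · refine Prod.ext rfl ?_
          ext i; fin_cases i <;> rfl
        · refine Prod.ext rfl ?_
          ext i; fin_cases i <;> rfl
      simpa using t.trans (.cons (l := none) s t')
    | some x =>
      obtain ⟨c₅, d₅, u₅, v₅, w₅⟩ := LRun.cons_split r₅
      have n₅ := (FinNFA.mentioned_of_step v₅).2
      have t := lrun_tracks_eps b hp hq h₂ h₃ h₄ h₅ u₂ u₃ u₄ u₅
      have t' := ih true n₂ n₃ n₄ n₅ w₂ w₃ w₄ w₅
      have s : CliqueStep A (some b, ![p, q, c₂, c₃, c₄, c₅]) none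
          (some true, ![p, q, d₂, d₃, d₄, d₅]) := by
        refine ⟨.read b, ![(p, none, p), (q, none, q), (c₂, _, d₂), (c₃, _, d₃), (c₄, _, d₄),
          (c₅, _, d₅)], ?_, ⟨⟨some x, y, rfl, rfl, rfl, rfl⟩, rfl⟩, ?_, ?_⟩
        · intro i
          fin_cases i
          exacts [FinNFA.edge_false hp, FinNFA.edge_false hq, FinNFA.edge_true v₂,
            FinNFA.edge_true v₃, FinNFA.edge_true v₄, FinNFA.edge_true v₅]
        · refine Prod.ext rfl ?_
          ext i; fin_cases i <;> rfl
        · refine Prod.ext rfl ?_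
          ext i; fin_cases i <;> rfl
      simpa using t.trans (.cons (l := none) s t')

theorem exists_lrun_of_hasPattern {c : Fin k → List α} (h : HasPattern A c) :
    ∃ s, CliqueFinal A s ∧ LRun (CliqueStep A) (none, fun _ => A.start) (conv c) s := by
  classical
  obtain ⟨p, q, f, hf, n, u, Z, hn, r₁, hZ, r₂, r₃, r₄, r₅⟩ := h
  have hp := FinNFA.mentioned_of_lrun r₁ A.mentioned_start
  have hq := FinNFA.mentioned_of_lrun r₃ hp
  refine ⟨_, ⟨p, q, f, hp, hq, hf, rfl⟩, ?_⟩
  have t₁ := lrun_phase_one (A := A) (p := A.start) (q := p)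
    (W := (List.range n).map fun j => (u j, fun i => (c i)[j]?))
    (by simpa [Function.comp_def] using r₁)
  have s : CliqueStep A (none, fun _ => p) none (some false, ![p, q, p, p, q, q]) := by
    -- The last four entries are fillers; the target takes its components from the first two.
    refine ⟨.guess, ![(p, none, p), (q, none, q), (p, none, p), (p, none, p), (p, none, p),
      (p, none, p)], ?_, rfl, rfl, ?_⟩
    · intro i
      fin_cases i
      exacts [FinNFA.edge_false hp, FinNFA.edge_false hq, FinNFA.edge_false hp,
        FinNFA.edge_false hp, FinNFA.edge_false hp, FinNFA.edge_false hp]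
    · refine Prod.ext rfl ?_
      ext i; fin_cases i <;> rfl
  have t₂ := lrun_tracks Z false hp hq hp hp hq hq r₂ r₃ r₄ r₅
  have hconv : ((((List.range n).map fun j => (u j, fun i => (c i)[j]?)).map Prod.snd).filter
      (· ≠ noLetter)) = conv c := by
    rw [List.map_map]
    have hle : (conv c).length ≤ n := by
      rw [length_conv]
      exact Finset.sup_le fun i _ => hn i
    obtain ⟨d, rfl⟩ := Nat.exists_eq_add_of_le hle
    rw [List.range_add, List.map_append, List.filter_append, List.filter_eq_self.2,
      List.filter_eq_nil_iff.2, List.append_nil, length_conv]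
    · rfl
    · intro l hl
      simp only [List.map_map, List.mem_map, List.mem_range, Function.comp_apply] at hl
      obtain ⟨j, -, rfl⟩ := hl
      simp only [ne_eq, decide_not, Bool.not_eq_true', decide_eq_false_iff_not, not_not]
      funext i
      have := length_le_length_conv c i
      simp only [noLetter, List.getElem?_eq_none_iff]
      omega
    · intro l hl
      rw [length_conv] at hl
      obtain ⟨i, hi⟩ := exists_ne_none_of_mem_conv (w := c) hl
      simp only [decide_eq_true_eq]
      rintro rfl
      exact hi rfl
  rw [hconv] at t₁
  have := t₁.trans (.cons (l := none) s t₂)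
  have hZ' : (false || !Z.isEmpty) = true := by simpa using hZ
  rw [hZ'] at this
  simpa using this

end Completeness

/-- The runs of the automaton for the Ramsey quantifier. -/
theorem exists_lrun_cliqueStep_iff [Finite α] {R : Set (Fin (k + 2) → List α)}
    (hA : Recognizes A R) (w : List (Fin k → Option α)) :
    (∃ s, CliqueFinal A s ∧ LRun (CliqueStep A) (none, fun _ => A.start) w s) ↔
      w ∈ conv '' ramsey R := by
  constructor
  · rintro ⟨s, hs, h⟩
    exact exists_ramsey_of_lrun hA h hs
  · rintro ⟨c, hc, rfl⟩
    exact exists_lrun_of_hasPattern (hasPattern_of_mem_ramsey hA hc)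

end CliqueAutomaton

end RamseyWords

namespace RamseyWords

/-! ### Definable functions and relations on positions -/

section Positions

open scoped Classical

variable {I : Type}

/-- Functions, predicates and relations on positions that program fragments can evaluate. -/
def PosFun (g : List I → ℕ → ℕ) : Prop :=
  (∀ x n, g x n ≤ x.length) ∧ ∀ (E : Type) [PEnv E] (p q : E → ℕ), Ptr p → Ptr q →
    LPred fun x e => q e = g x (p e)

def PosPred (P : List I → ℕ → Prop) : Prop :=
  ∀ (E : Type) [PEnv E] (p : E → ℕ), Ptr p → LPred fun x e => P x (p e)

def PosRel (R : List I → ℕ → ℕ → Prop) : Prop :=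
  ∀ (E : Type) [PEnv E] (p q : E → ℕ), Ptr p → Ptr q → LPred fun x e => R x (p e) (q e)

variable {g g' : List I → ℕ → ℕ} {E : Type} [PEnv E]

theorem PosFun.lptr (hg : PosFun g) {p : E → ℕ} (hp : Ptr p) : LPtr fun x e => g x (p e) :=
  ⟨fun _ _ => hg.1 _ _, hg.2 _ _ _ (Ptr.fst hp) Ptr.last⟩

theorem PosPred.comp {P : List I → ℕ → Prop} (hP : PosPred P) (hg : PosFun g) :
    PosPred fun x n => P x (g x n) :=
  fun _ _ _ hp => LPred.at_ptr (P := fun x _ v => P x v) (hP _ _ Ptr.last) (hg.lptr hp)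

theorem PosRel.comp_left {R : List I → ℕ → ℕ → Prop} (hR : PosRel R) (hg : PosFun g) :
    PosRel fun x n m => R x (g x n) m :=
  fun _ _ _ q hp hq => LPred.at_ptr (P := fun x e v => R x v (q e))
    (hR _ _ _ Ptr.last (Ptr.fst hq)) (hg.lptr hp)

theorem PosRel.swap {R : List I → ℕ → ℕ → Prop} (hR : PosRel R) : PosRel fun x n m => R x m n :=
  fun _ _ _ _ hp hq => hR _ _ _ hq hp

theorem PosRel.comp {R : List I → ℕ → ℕ → Prop} (hR : PosRel R) (hg : PosFun g) (hg' : PosFun g') :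
    PosRel fun x n m => R x (g x n) (g' x m) :=
  ((hR.comp_left hg).swap.comp_left hg').swap

theorem PosFun.comp (hg : PosFun g) (hg' : PosFun g') : PosFun fun x n => g x (g' x n) :=
  ⟨fun _ _ => hg.1 _ _, fun E _ p q hp hq =>
    PosRel.comp_left (R := fun x n m => m = g x n) (fun E _ p q hp hq => hg.2 E p q hp hq) hg'
      E p q hp hq⟩

/-- Values are truncated at `x.length`, which is definable as the largest value within reach of a
quantifier. -/
theorem PosFun.id : PosFun fun (x : List I) n => min n x.length := by
  refine ⟨fun _ _ => min_le_right _ _, fun E _ p q hp hq => ?_⟩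
  refine ((LPred.eq hq hp).and (LPred.ex (P := fun _ e v => p e ≤ v)
    (LPred.le (Ptr.fst hp) Ptr.last)) |>.or (((LPred.all (P := fun _ e v => v ≤ q e)
      (LPred.le Ptr.last (Ptr.fst hq))).and (LPred.ex (P := fun _ e v => q e = v)
      (LPred.eq (Ptr.fst hq) Ptr.last))).and (LPred.le hq hp))).congr fun x e => ?_
  dsimp only
  constructor
  · intro h
    rcases le_total (p e) x.length with h' | h'
    · exact .inl ⟨by omega, _, h', le_rfl⟩
    · exact .inr ⟨⟨fun v hv => by omega, q e, by omega, rfl⟩, by omega⟩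
  · rintro (⟨h, v, hv, hv'⟩ | ⟨⟨h, v, hv, hv'⟩, h'⟩)
    · omega
    · have := h _ le_rfl
      omega

theorem exists_takeWhile_eq_take (P : I → Bool) (l : List I) :
    ∃ m ≤ l.length, (∀ d < m, l[d]?.any P) ∧ ¬ l[m]?.any P ∧ l.takeWhile P = l.take m := by
  induction l with
  | nil => exact ⟨0, le_rfl, by simp, by simp, rfl⟩
  | cons a l ih =>
    by_cases h : P a
    · obtain ⟨m, h₁, h₂, h₃, h₄⟩ := ih
      refine ⟨m + 1, by simpa using h₁, fun d hd => ?_, by simpa using h₃, by simp [h, h₄]⟩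
      cases d with
      | zero => simpa using h
      | succ d => simpa using h₂ d (by omega)
    · exact ⟨0, Nat.zero_le _, by simp, by simpa using h, by simp [h]⟩

theorem eq_of_takeWhile_bounds {P : I → Bool} {l : List I} {m m' : ℕ}
    (h : ∀ d < m, l[d]?.any P) (h₁ : ¬ l[m]?.any P) (h' : ∀ d < m', l[d]?.any P)
    (h₁' : ¬ l[m']?.any P) : m = m' := by
  rcases lt_trichotomy m m' with hm | hm | hm
  · exact absurd (h' _ hm) h₁
  · exact hm
  · exact absurd (h _ hm) h₁'

/-- The two prefixes have a common end `m` and agree before it. The bound `N` makes both quantifiers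
admissible in `LPred`. -/
theorem takeWhile_eq_takeWhile_iff (P : I → Bool) (l l' : List I) (N : ℕ) (hN : l.length ≤ N) :
    l.takeWhile P = l'.takeWhile P ↔ ∃ m ≤ N, (∀ d ≤ N, d < m → l[d]?.any P ∧ l[d]? = l'[d]?) ∧
      ¬ l[m]?.any P ∧ ¬ l'[m]?.any P := by
  obtain ⟨m, h₁, h₂, h₃, h₄⟩ := exists_takeWhile_eq_take P l
  obtain ⟨m', h₁', h₂', h₃', h₄'⟩ := exists_takeWhile_eq_take P l'
  constructor
  · intro h
    have hm : m = m' := by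
      have := congrArg List.length h
      rw [h₄, h₄', List.length_take, List.length_take] at this
      omega
    subst hm
    refine ⟨m, h₁.trans hN, fun d _ hd => ⟨h₂ d hd, ?_⟩, h₃, h₃'⟩
    have := congrArg (·[d]?) h
    simp only [h₄, h₄', List.getElem?_take, hd, if_true] at this
    exact this
  · rintro ⟨n, hn, hd, hn₁, hn₂⟩
    have e₁ := eq_of_takeWhile_bounds h₂ h₃ (fun d h => (hd d (by omega) h).1) hn₁
    have e₂ := eq_of_takeWhile_bounds h₂' h₃'
      (fun d h => (hd d (by omega) h).2 ▸ (hd d (by omega) h).1) hn₂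
    subst e₁ e₂
    rw [h₄, h₄']
    refine List.ext_getElem? fun d => ?_
    rw [List.getElem?_take, List.getElem?_take]
    split_ifs with h
    · exact (hd d (by omega) h).2
    · rfl

/-- The position of the first symbol from `n` on that violates `P`. -/
def skip (P : I → Bool) (x : List I) (n : ℕ) : ℕ :=
  min n x.length + ((x.drop n).takeWhile P).length

theorem skip_le (P : I → Bool) (x : List I) (n : ℕ) : skip P x n ≤ x.length := by
  have := (List.takeWhile_prefix (l := x.drop n) P).length_le
  rw [List.length_drop] at this
  unfold skip
  omega

theorem drop_length_takeWhile (P : I → Bool) (l : List I) :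
    l.drop (l.takeWhile P).length = l.dropWhile P := by
  conv_lhs => rw [← List.takeWhile_append_dropWhile (p := P) (l := l)]
  rw [List.takeWhile_append_dropWhile]
  induction l with
  | nil => rfl
  | cons a l ih => by_cases h : P a <;> simp [h, ih]

theorem drop_min_length (x : List I) (n : ℕ) : x.drop (min n x.length) = x.drop n := by
  rcases le_total n x.length with h | h
  · rw [min_eq_left h]
  · rw [min_eq_right h, List.drop_length, List.drop_eq_nil_of_le h]

theorem drop_skip (P : I → Bool) (x : List I) (n : ℕ) :
    x.drop (skip P x n) = (x.drop n).dropWhile P := by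
  rw [skip, ← List.drop_drop, drop_min_length, drop_length_takeWhile]

theorem PosFun.skip [Finite I] (P : I → Bool) : PosFun (skip P) := by
  refine ⟨skip_le P, fun E _ p q hp hq => ?_⟩
  have key : PosRel fun (x : List I) m q => m ≤ q ∧ (∀ v ≤ x.length, m ≤ v ∧ v < q → x[v]?.any P) ∧
      ¬ x[q]?.any P ∧ ∃ v ≤ x.length, q = v := fun E _ m q hm hq =>
    (LPred.le hm hq).and ((LPred.all (P := fun x e v => m e ≤ v ∧ v < q e → x[v]?.any P)
      (((LPred.le (Ptr.fst hm) Ptr.last).and (LPred.lt Ptr.last (Ptr.fst hq))).imp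
        (LFun.pred (LFun.readAt Ptr.last) fun o => o.any P))).and
      ((LFun.pred (LFun.readAt hq) fun o => o.any P).not.and
        (LPred.ex (P := fun x e v => q e = v) (LPred.eq (Ptr.fst hq) Ptr.last))))
  refine (key.comp_left PosFun.id E p q hp hq).congr fun x e => ?_
  obtain ⟨m, h₁, h₂, h₃, h₄⟩ := exists_takeWhile_eq_take P (x.drop (p e))
  rw [List.length_drop] at h₁
  have hs : RamseyWords.skip P x (p e) = min (p e) x.length + m := by
    rw [RamseyWords.skip, h₄, List.length_take, List.length_drop]
    omega
  rw [hs]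
  simp only [← drop_min_length x (p e), List.getElem?_drop] at h₂ h₃
  dsimp only
  constructor
  · intro h
    refine ⟨by omega, fun v hv hv' => ?_, by rwa [h], _, by omega, rfl⟩
    have := h₂ (v - min (p e) x.length) (by omega)
    rwa [Nat.add_sub_cancel' hv'.1] at this
  · rintro ⟨h, h', h'', v, hv, rfl⟩
    have := eq_of_takeWhile_bounds (l := x.drop (min (p e) x.length)) (P := P) (m := m)
      (m' := q e - min (p e) x.length) (fun d hd => by simpa using h₂ d hd) (by simpa using h₃)
      (fun d hd => by
        rw [List.getElem?_drop]
        exact h' _ (by omega) ⟨by omega, by omega⟩) (by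
        rw [List.getElem?_drop, Nat.add_sub_cancel' h]
        exact h'')
    omega

/-- The successor is definable from the order alone. -/
theorem PosFun.succ : PosFun fun (x : List I) n => min (n + 1) x.length := by
  refine ⟨fun _ _ => min_le_right _ _, fun E _ p q hp hq => ?_⟩
  have key : PosRel fun (x : List I) m q => (∃ v ≤ x.length, q = v) ∧
      ((m < q ∧ ∀ v ≤ x.length, v ≤ m ∨ q ≤ v) ∨ ((∀ v ≤ x.length, v ≤ q) ∧ q ≤ m)) :=
    fun E _ m q hm hq => (LPred.ex (P := fun x e v => q e = v) (LPred.eq (Ptr.fst hq) Ptr.last)).and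
      (((LPred.lt hm hq).and (LPred.all (P := fun x e v => v ≤ m e ∨ q e ≤ v)
        ((LPred.le Ptr.last (Ptr.fst hm)).or (LPred.le (Ptr.fst hq) Ptr.last)))).or
      ((LPred.all (P := fun x e v => v ≤ q e) (LPred.le Ptr.last (Ptr.fst hq))).and
        (LPred.le hq hm)))
  refine (key E p q hp hq).congr fun x e => ?_
  dsimp only
  constructor
  · intro h
    refine ⟨⟨_, by omega, rfl⟩, ?_⟩
    rcases Nat.lt_or_ge (p e) x.length with h' | h'
    · exact .inl ⟨by omega, fun v hv => by omega⟩
    · exact .inr ⟨fun v hv => by omega, by omega⟩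
  · rintro ⟨⟨v, hv, rfl⟩, ⟨h₁, h₂⟩ | ⟨h₁, h₂⟩⟩
    · have := h₂ (p e + 1) (by omega)
      omega
    · have := h₁ _ le_rfl
      omega

/-- The position behind the first symbol from `n` on that violates `P`. -/
def after (P : I → Bool) (x : List I) (n : ℕ) : ℕ := min (skip P x n + 1) x.length

theorem PosFun.after [Finite I] (P : I → Bool) : PosFun (after P) := PosFun.succ.comp (.skip P)

theorem drop_after (P : I → Bool) (x : List I) (n : ℕ) :
    x.drop (after P x n) = ((x.drop n).dropWhile P).tail := by
  rw [after, drop_min_length, ← List.drop_drop, drop_skip, List.drop_one]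

theorem PosPred.read [Finite I] (P : Option I → Prop) : PosPred fun x n => P x[n]? :=
  fun _ _ _ hp => LFun.pred (LFun.readAt hp) P

/-- Comparing two pieces of text at the same offset is the purpose of reading at the sum of two
registers. -/
theorem PosRel.takeWhile_eq [Finite I] (P : I → Bool) :
    PosRel fun x n m => (x.drop n).takeWhile P = (x.drop m).takeWhile P := by
  intro E _ p q hp hq
  have step : ∀ {E : Type} [PEnv E] {p q v : E → ℕ}, Ptr p → Ptr q → Ptr v →
      LPred fun (x : List I) (e : E) =>
        x[p e + v e]?.any P ∧ x[p e + v e]? = x[q e + v e]? := fun hp hq hv =>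
    LPred.congr (P := fun x e => decide (x[_]?.any P = true ∧ x[_]? = x[_]?) = true)
      (LFun.pred (LFun.map₂ (LFun.read hp hv) (LFun.read hq hv)
        fun o o' => decide (o.any P = true ∧ o = o')) (· = true)) fun x e => by simp
  refine (LPred.ex (P := fun x e m => (∀ d ≤ x.length, d < m →
      x[p e + d]?.any P ∧ x[p e + d]? = x[q e + d]?) ∧ ¬ x[p e + m]?.any P ∧ ¬ x[q e + m]?.any P)
    ((LPred.all (P := fun x e d => d < e.2 →
      x[p e.1 + d]?.any P ∧ x[p e.1 + d]? = x[q e.1 + d]?) ((LPred.lt Ptr.last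
        (Ptr.fst Ptr.last)).imp (step (Ptr.fst (Ptr.fst hp)) (Ptr.fst (Ptr.fst hq))
          Ptr.last))).and
      ((LFun.pred (LFun.read (Ptr.fst hp) Ptr.last) fun o => o.any P).not.and
        (LFun.pred (LFun.read (Ptr.fst hq) Ptr.last) fun o => o.any P).not))).congr fun x e => ?_
  dsimp only
  rw [takeWhile_eq_takeWhile_iff P _ _ x.length (by simp)]
  simp only [List.getElem?_drop]

/-- The symbols at the positions that satisfy `Q`. -/
noncomputable def select (x : List I) (Q : ℕ → Prop) : List I :=
  (List.range (x.length + 1)).filterMap fun v => if Q v then x[v]? else none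

theorem select_take (x : List I) (b : ℕ) : select x (· < b) = x.take b := by
  rw [← range_map_filterMap (x.take b) (x.length + 1) (by simp), select]
  simp only [List.getElem?_take]
  congr!

theorem select_drop (x : List I) (a : ℕ) : select x (a ≤ ·) = x.drop a := by
  have h : ∀ n, (x.length ≤ n) → ((List.range n).filterMap fun v => if a ≤ v then x[v]? else none) =
      x.drop a := by
    intro n hn
    rcases Nat.lt_or_ge n a with h | h
    · rw [List.drop_eq_nil_of_le (by omega), List.filterMap_eq_nil_iff]
      intro v hv
      rw [List.mem_range] at hv
      rw [if_neg (by omega)]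
    · obtain ⟨d, rfl⟩ := Nat.exists_eq_add_of_le h
      rw [List.range_add, List.filterMap_append, List.filterMap_eq_nil_iff.2, List.nil_append,
        List.filterMap_map]
      · simpa [Function.comp_def] using range_map_filterMap (x.drop a) d (by simp; omega)
      · intro v hv
        rw [List.mem_range] at hv
        rw [if_neg (by omega)]
  rw [← h _ (Nat.le_succ _), select]
  congr!

theorem select_slice (x : List I) (a b : ℕ) : (select x fun v => a ≤ v ∧ v < b) =
    (x.take b).drop a := by
  rw [← select_drop (x.take b) a, select, select]
  rw [List.filterMap_congr (g := fun v => if a ≤ v then (x.take b)[v]? else none) fun v _ => by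
    rw [List.getElem?_take]
    split_ifs <;> first | rfl | omega]
  obtain ⟨d, hd⟩ := Nat.exists_eq_add_of_le (show (x.take b).length + 1 ≤ x.length + 1 by simp)
  rw [hd, List.range_add, List.filterMap_append,
    (List.filterMap_eq_nil_iff (l := List.map _ _)).2, List.append_nil]
  · congr!
  · simp only [List.mem_map, List.mem_range]
    rintro v ⟨w, -, rfl⟩
    rw [List.getElem?_eq_none (by omega), ite_self]

theorem select_word (P : I → Bool) (x : List I) (n : ℕ) :
    (select x fun v => n ≤ v ∧ v < skip P x n) = (x.drop n).takeWhile P := by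
  rw [select_slice, skip, List.drop_take]
  rcases le_total n x.length with h | h
  · rw [min_eq_left h, Nat.add_sub_cancel_left]
    exact (List.prefix_iff_eq_take.1 (List.takeWhile_prefix P)).symm
  · rw [List.drop_eq_nil_of_le h]
    simp

/-- Finite automata can be run on a definable part of the input. -/
theorem LFun.foldl_select [Finite I] {S : Type} [Finite S] (step : S → I → S) (s₀ : S)
    {Q : List I → E → ℕ → Prop} (hQ : LPred fun x (e : E × ℕ) => Q x e.1 e.2) :
    LFun fun x e => (select x (Q x e)).foldl step s₀ := by
  have := LFun.fold (E := E) (body := fun s x e v =>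
    (if Q x e v then x[v]? else none).elim s (step s)) s₀ fun s => by
      have := (LFun.map₂ hQ (LFun.readAt Ptr.last)
        fun b o => (if b = true then o else none).elim s (step s)).bind
        (ψ := fun s _ _ => s) fun s => .const s
      simpa only [decide_eq_true_eq] using this
  convert this using 3 with x e
  · rw [select, List.foldl_filterMap]
    congr 1
    funext s v
    cases (if Q x e v then x[v]? else none) <;> rfl

theorem LOut.flatMap_select [Finite I] {O : Type} (f : I → List O) {Q : List I → E → ℕ → Prop}
    (hQ : LPred fun x (e : E × ℕ) => Q x e.1 e.2) :
    LOut fun x e => (select x (Q x e)).flatMap f := by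
  have := LOut.loop (E := E) (F := fun x e v => (if Q x e v then x[v]? else none).elim [] f) (by
    have := LOut.bind (LFun.map₂ hQ (LFun.readAt Ptr.last) fun b o => if b = true then o else none)
      (G := fun o _ _ => o.elim [] f) fun o => .const _
    simpa only [decide_eq_true_eq] using this)
  convert this using 3 with x e
  rw [select]
  induction List.range (x.length + 1) with
  | nil => rfl
  | cons v l ih =>
    rw [List.filterMap_cons, List.flatMap_cons, ← ih]
    cases (if Q x e v then x[v]? else none) <;> simp

end Positions

end RamseyWords

namespace RamseyWords

/-! ### Unique readability of the encoding -/

section Tokens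

instance : Finite Tok :=
  Finite.of_surjective (![.tick, .bit0, .bit1, .bot, .eps, .sep, .semi] : Fin 7 → Tok) (by
    rintro ⟨⟩
    exacts [⟨0, rfl⟩, ⟨1, rfl⟩, ⟨2, rfl⟩, ⟨3, rfl⟩, ⟨4, rfl⟩, ⟨5, rfl⟩, ⟨6, rfl⟩])

/-- The tokens that words and components are made of. -/
def Tok.isWord : Tok → Bool
  | .bit0 | .bit1 | .bot => true
  | _ => false

/-- The tokens that do not end a label. -/
def Tok.isInner : Tok → Bool
  | .eps | .semi => false
  | _ => true

def Tok.notSep : Tok → Bool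
  | .sep => false
  | _ => true

def Tok.isTick : Tok → Bool
  | .tick => true
  | _ => false

theorem mem_encNat {n : ℕ} {t : Tok} (h : t ∈ encNat n) : t = .bit0 ∨ t = .bit1 := by
  simp only [encNat, List.mem_map, List.mem_reverse] at h
  obtain ⟨b, -, rfl⟩ := h
  cases b <;> simp

theorem encNat_injective : Function.Injective encNat := by
  intro m n h
  have hinj : Function.Injective fun b : Bool => if b then Tok.bit1 else Tok.bit0 := by
    intro b b' h
    cases b <;> cases b' <;> simp_all
  have h' := List.reverse_injective (List.map_injective_iff.2 hinj h)
  refine Nat.digits.injective 2 ?_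
  rw [Nat.digits_two_eq_bits, Nat.digits_two_eq_bits, h']

theorem isWord_of_mem_encNat {n : ℕ} : ∀ t ∈ encNat n, t.isWord := fun t ht => by
  rcases mem_encNat ht with rfl | rfl <;> rfl

theorem isWord_of_mem_encSym {s : ℕ} {a : Option (Fin s)} : ∀ t ∈ encSym a, t.isWord := by
  cases a with
  | none => simp [encSym, Tok.isWord]
  | some a => exact isWord_of_mem_encNat

theorem encSym_injective {s : ℕ} : Function.Injective (encSym (s := s)) := by
  intro a b h
  cases a <;> cases b
  · rfl
  · have := mem_encNat (t := .bot) (by rw [encSym, encSym] at h; rw [← h]; simp)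
    simp at this
  · have := mem_encNat (t := .bot) (by rw [encSym, encSym] at h; rw [h]; simp)
    simp at this
  · rw [Option.some.injEq]
    exact Fin.ext (encNat_injective h)

theorem takeWhile_word {W : List Tok} (hW : ∀ t ∈ W, t.isWord) (r : List Tok) :
    (W ++ .sep :: r).takeWhile Tok.isWord = W := by
  rw [List.takeWhile_append_of_pos hW]
  simp [Tok.isWord]

theorem dropWhile_word {W : List Tok} (hW : ∀ t ∈ W, t.isWord) (r : List Tok) :
    ((W ++ .sep :: r).dropWhile Tok.isWord).tail = r := by
  rw [List.dropWhile_append_of_pos hW]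
  simp [Tok.isWord]

theorem word_inj {W W' r r' : List Tok} (hW : ∀ t ∈ W, t.isWord) (hW' : ∀ t ∈ W', t.isWord)
    (h : W ++ .sep :: r = W' ++ .sep :: r') : W = W' ∧ r = r' := by
  have h₁ := takeWhile_word hW r
  have h₂ := dropWhile_word hW r
  rw [h, takeWhile_word hW'] at h₁
  rw [h, dropWhile_word hW'] at h₂
  exact ⟨h₁.symm, h₂.symm⟩

def encComps {s : ℕ} (l : List (Option (Fin s))) : List Tok :=
  l.flatMap fun a => encSym a ++ [.sep]

theorem encComps_cons {s : ℕ} (a : Option (Fin s)) (l : List (Option (Fin s))) (r : List Tok) :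
    encComps (a :: l) ++ r = encSym a ++ .sep :: (encComps l ++ r) := by
  simp [encComps]

theorem encLabel_some {s r : ℕ} (v : Fin r → Option (Fin s)) (y : List Tok) :
    encLabel (some v) ++ y = encComps (List.ofFn v) ++ .semi :: y := by
  simp [encLabel, encComps]

theorem isInner_of_mem_encComps {s : ℕ} {l : List (Option (Fin s))} :
    ∀ t ∈ encComps l, t.isInner := by
  intro t ht
  simp only [encComps, List.mem_flatMap, List.mem_append, List.mem_singleton] at ht
  obtain ⟨a, -, h | rfl⟩ := ht
  · have := isWord_of_mem_encSym t h
    cases t <;> simp_all [Tok.isWord, Tok.isInner]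
  · rfl

theorem encComps_inj {s : ℕ} {l l' : List (Option (Fin s))} {r r' : List Tok}
    (hl : l.length = l'.length) (h : encComps l ++ r = encComps l' ++ r') : l = l' ∧ r = r' := by
  induction l generalizing l' with
  | nil =>
    obtain rfl := List.length_eq_zero_iff.1 hl.symm
    exact ⟨rfl, h⟩
  | cons a l ih =>
    cases l' with
    | nil => simp at hl
    | cons a' l' =>
      rw [encComps_cons, encComps_cons] at h
      obtain ⟨h₁, h₂⟩ := word_inj isWord_of_mem_encSym isWord_of_mem_encSym h
      obtain ⟨rfl, rfl⟩ := ih (by simpa using hl) h₂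
      rw [encSym_injective h₁]
      exact ⟨rfl, rfl⟩

/-- The first token distinguishes the empty label from a letter. A letter may begin with a
separator, as the symbol `0` is written as the empty string. -/
theorem head_encLabel_some {s r : ℕ} (v : Fin r → Option (Fin s)) (y : List Tok) :
    (encLabel (some v) ++ y).head? ≠ some .eps := by
  rw [encLabel_some]
  intro h
  rw [List.head?_append] at h
  cases hc : encComps (List.ofFn v) with
  | nil => simp [hc] at h
  | cons t l =>
    have := isInner_of_mem_encComps (l := List.ofFn v) t (by simp [hc])
    rw [hc] at h
    simp only [List.head?_cons, Option.some_or, Option.some.injEq] at h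
    rw [h] at this
    exact absurd this (by decide)

theorem encLabel_inj {s r : ℕ} {L L' : Option (Fin r → Option (Fin s))} {y y' : List Tok}
    (h : encLabel L ++ y = encLabel L' ++ y') : L = L' ∧ y = y' := by
  cases L with
  | none =>
    cases L' with
    | none => exact ⟨rfl, by simpa [encLabel] using h⟩
    | some v =>
      refine absurd (congrArg List.head? h).symm ?_
      exact head_encLabel_some v y'
  | some v =>
    cases L' with
    | none => exact absurd (congrArg List.head? h) (head_encLabel_some v y)
    | some v' =>
      rw [encLabel_some, encLabel_some] at h
      obtain ⟨h₁, h₂⟩ := encComps_inj (by simp) h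
      rw [List.ofFn_injective h₁]
      exact ⟨rfl, by simpa using h₂⟩

theorem dropWhile_label {s r : ℕ} (L : Option (Fin r → Option (Fin s))) (y : List Tok) :
    ((encLabel L ++ y).dropWhile Tok.isInner).tail = y := by
  cases L with
  | none => simp [encLabel, Tok.isInner]
  | some v =>
    rw [encLabel_some, List.dropWhile_append_of_pos isInner_of_mem_encComps]
    simp [Tok.isInner]

end Tokens

section BlankLabels

inductive BotScan where
  | fresh | pad | good | bad

instance : Finite BotScan :=
  Finite.of_surjective (![.fresh, .pad, .good, .bad] : Fin 4 → BotScan) (by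
    rintro ⟨⟩
    exacts [⟨0, rfl⟩, ⟨1, rfl⟩, ⟨2, rfl⟩, ⟨3, rfl⟩])

/-- Checks whether all components of a label are padding. -/
def BotScan.step : BotScan → Tok → BotScan
  | fresh, .bot => pad
  | fresh, .semi => good
  | fresh, _ => bad
  | pad, .sep => fresh
  | pad, _ => bad
  | good, _ => good
  | bad, _ => bad

theorem BotScan.foldl_good (l : List Tok) : l.foldl step good = good := by
  induction l with
  | nil => rfl
  | cons t l ih => exact ih

theorem BotScan.foldl_bad (l : List Tok) : l.foldl step bad = bad := by
  induction l with
  | nil => rfl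
  | cons t l ih => exact ih

/-- The verdict is final at the semicolon at the latest, so the scan may simply continue to the end
of the input. -/
theorem BotScan.foldl_encComps {s : ℕ} (l : List (Option (Fin s))) (y : List Tok) :
    (encComps l ++ .semi :: y).foldl step fresh = good ↔ ∀ a ∈ l, a = none := by
  induction l with
  | nil => simp [encComps, step, foldl_good]
  | cons a l ih =>
    rw [encComps_cons]
    cases a with
    | none => simpa [encSym, step] using ih
    | some a =>
      have : (encSym (some a) ++ .sep :: (encComps l ++ .semi :: y)).foldl step fresh = bad := by
        rw [encSym]
        cases h : encNat a with
        | nil => simp [step, foldl_bad]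
        | cons t u =>
          rcases mem_encNat (n := a) (t := t) (by simp [h]) with rfl | rfl <;>
            simp [step, foldl_bad]
      simp [this]

end BlankLabels

/-! ### Locating states and transitions in the description -/

section Roles

/-- The role of a position in the description of an automaton; it is determined by the part of the
string to the left. Primed roles are for positions inside a word. -/
inductive Role where
  | arity | size | init | init' | fin | fin' | src | src' | lab | tgt | tgt'

instance : Finite Role :=
  Finite.of_surjective (![.arity, .size, .init, .init', .fin, .fin', .src, .src', .lab, .tgt,
    .tgt'] : Fin 11 → Role) (by
    rintro ⟨⟩
    exacts [⟨0, rfl⟩, ⟨1, rfl⟩, ⟨2, rfl⟩, ⟨3, rfl⟩, ⟨4, rfl⟩, ⟨5, rfl⟩, ⟨6, rfl⟩, ⟨7, rfl⟩, ⟨8, rfl⟩,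
      ⟨9, rfl⟩, ⟨10, rfl⟩])

def Role.step : Role → Tok → Role
  | arity, .sep => size
  | arity, _ => arity
  | size, .sep => init
  | size, _ => size
  | init, .sep => fin
  | init, _ => init'
  | init', .sep => fin
  | init', _ => init'
  | fin, .sep => fin
  | fin, .semi => src
  | fin, _ => fin'
  | fin', .sep => fin
  | fin', _ => fin'
  | src, .sep => lab
  | src, _ => src'
  | src', .sep => lab
  | src', _ => src'
  | lab, .eps => tgt
  | lab, .semi => tgt
  | lab, _ => lab
  | tgt, .sep => src
  | tgt, _ => tgt'
  | tgt', .sep => src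
  | tgt', _ => tgt'

/-- The suffix `v` of `x` begins at a position with role `r'`, if `x` begins with role `r`. -/
def Occ (r : Role) (x : List Tok) (r' : Role) (v : List Tok) : Prop :=
  ∃ u, x = u ++ v ∧ v ≠ [] ∧ u.foldl Role.step r = r'

theorem occ_nil {r r' : Role} {v : List Tok} : ¬ Occ r [] r' v := by
  rintro ⟨u, h, hv, -⟩
  exact hv (List.append_eq_nil_iff.1 h.symm).2

theorem occ_cons {r r' : Role} {t : Tok} {x v : List Tok} :
    Occ r (t :: x) r' v ↔ r = r' ∧ v = t :: x ∨ Occ (r.step t) x r' v := by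
  constructor
  · rintro ⟨u, h, hv, hr⟩
    cases u with
    | nil => exact .inl ⟨hr, h.symm⟩
    | cons t' u =>
      rw [List.cons_append, List.cons.injEq] at h
      obtain ⟨rfl, rfl⟩ := h
      exact .inr ⟨u, rfl, hv, hr⟩
  · rintro (⟨rfl, rfl⟩ | ⟨u, rfl, hv, hr⟩)
    · exact ⟨[], rfl, by simp, rfl⟩
    · exact ⟨t :: u, rfl, hv, hr⟩

theorem occ_inner {i r' : Role} {W : List Tok} (hi : ∀ t ∈ W, i.step t = i) (h : r' ≠ i)
    (y v : List Tok) : Occ i (W ++ y) r' v ↔ Occ i y r' v := by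
  induction W with
  | nil => rfl
  | cons t W ih =>
    rw [List.cons_append, occ_cons, hi t (by simp), ih fun t ht => hi t (by simp [ht])]
    simp [h.symm]

/-- `b` is the role at the beginning of a word and `i` the role inside it. Words may be empty, so a
beginning is recognized by what precedes it, not by its own token. -/
theorem occ_word {b i n r' : Role} {W : List Tok} (hb : ∀ t ∈ W, b.step t = i)
    (hi : ∀ t ∈ W, i.step t = i) (hbn : b.step .sep = n) (hin : i.step .sep = n)
    (h : r' ≠ i) (y v : List Tok) :
    Occ b (W ++ .sep :: y) r' v ↔ (b = r' ∧ v = W ++ .sep :: y) ∨ Occ n y r' v := by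
  cases W with
  | nil => rw [List.nil_append, occ_cons, hbn]
  | cons t W =>
    rw [List.cons_append, occ_cons, hb t (by simp), occ_inner (fun t ht => hi t (by simp [ht])) h,
      occ_cons, hin]
    simp [h.symm]

/-- The positions that begin an item. -/
def Role.IsItem (r : Role) : Prop := r = init ∨ r = fin ∨ r = src ∨ r = tgt

theorem occ_encNat_init {r' : Role} (h : r'.IsItem) (n : ℕ) (y v : List Tok) :
    Occ .init (encNat n ++ .sep :: y) r' v ↔
      (.init = r' ∧ v = encNat n ++ .sep :: y) ∨ Occ .fin y r' v := by
  refine occ_word (b := .init) (i := .init') (n := .fin) ?_ ?_ rfl rfl ?_ _ _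
  iterate 2
    intro t ht
    rcases mem_encNat ht with rfl | rfl <;> rfl
  rcases h with rfl | rfl | rfl | rfl <;> simp

theorem occ_encNat_fin {r' : Role} (h : r'.IsItem) (n : ℕ) (y v : List Tok) :
    Occ .fin (encNat n ++ .sep :: y) r' v ↔
      (.fin = r' ∧ v = encNat n ++ .sep :: y) ∨ Occ .fin y r' v := by
  refine occ_word (b := .fin) (i := .fin') (n := .fin) ?_ ?_ rfl rfl ?_ _ _
  iterate 2
    intro t ht
    rcases mem_encNat ht with rfl | rfl <;> rfl
  rcases h with rfl | rfl | rfl | rfl <;> simp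

theorem occ_encNat_src {r' : Role} (h : r'.IsItem) (n : ℕ) (y v : List Tok) :
    Occ .src (encNat n ++ .sep :: y) r' v ↔
      (.src = r' ∧ v = encNat n ++ .sep :: y) ∨ Occ .lab y r' v := by
  refine occ_word (b := .src) (i := .src') (n := .lab) ?_ ?_ rfl rfl ?_ _ _
  iterate 2
    intro t ht
    rcases mem_encNat ht with rfl | rfl <;> rfl
  rcases h with rfl | rfl | rfl | rfl <;> simp

theorem occ_encNat_tgt {r' : Role} (h : r'.IsItem) (n : ℕ) (y v : List Tok) :
    Occ .tgt (encNat n ++ .sep :: y) r' v ↔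
      (.tgt = r' ∧ v = encNat n ++ .sep :: y) ∨ Occ .src y r' v := by
  refine occ_word (b := .tgt) (i := .tgt') (n := .src) ?_ ?_ rfl rfl ?_ _ _
  iterate 2
    intro t ht
    rcases mem_encNat ht with rfl | rfl <;> rfl
  rcases h with rfl | rfl | rfl | rfl <;> simp

theorem occ_encLabel {r' : Role} (h : r'.IsItem) {s r : ℕ} (L : Option (Fin r → Option (Fin s)))
    (y v : List Tok) : Occ .lab (encLabel L ++ y) r' v ↔ Occ .tgt y r' v := by
  have hr : Role.lab ≠ r' := by rcases h with rfl | rfl | rfl | rfl <;> simp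
  cases L with
  | none => simp [encLabel, occ_cons, hr, Role.step]
  | some v =>
    rw [encLabel_some, occ_inner _ hr.symm, occ_cons]
    · simp [hr, Role.step]
    · intro t ht
      have := isInner_of_mem_encComps t ht
      cases t <;> first | rfl | exact absurd this (by decide)

section

variable {s k : ℕ} {A : FinNFA (Fin k → Option (Fin s))}

def encFinals {N : ℕ} (l : List (Fin N)) : List Tok :=
  l.flatMap fun q : Fin N => encNat q ++ [Tok.sep]

def encTrans {N : ℕ} (l : List (Fin N × Option (Fin k → Option (Fin s)) × Fin N)) : List Tok :=
  l.flatMap fun e => encNat e.1 ++ [Tok.sep] ++ encLabel e.2.1 ++ encNat e.2.2 ++ [Tok.sep]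

/-- The rest of the description behind the two numbers in unary. -/
def encRest (A : FinNFA (Fin k → Option (Fin s))) : List Tok :=
  encNat A.start ++ .sep :: (encFinals A.final ++ .semi :: encTrans A.trans)

theorem encNFA_eq (A : FinNFA (Fin k → Option (Fin s))) :
    encNFA A = List.replicate k .tick ++ .sep :: (List.replicate A.numStates .tick ++ .sep ::
      encRest A) := by
  -- In `encNFA` the list of final states is converted to a list of numbers before it is written.
  have h : (A.final >>= fun q : Fin A.numStates => pure (q : ℕ)).flatMap
      (fun q => encNat q ++ [Tok.sep]) = encFinals A.final := by
    rw [List.bind_eq_flatMap, List.flatMap_assoc, encFinals]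
    simp
  rw [encNFA, h]
  simp [encRest, encTrans]

def encEdge {N : ℕ} (e : Fin N × Option (Fin k → Option (Fin s)) × Fin N) (y : List Tok) :
    List Tok :=
  encNat e.1 ++ .sep :: (encLabel e.2.1 ++ (encNat e.2.2 ++ .sep :: y))

theorem encTrans_cons {N : ℕ} (e : Fin N × Option (Fin k → Option (Fin s)) × Fin N)
    (l : List (Fin N × Option (Fin k → Option (Fin s)) × Fin N)) :
    encTrans (e :: l) = encEdge e (encTrans l) := by
  simp [encTrans, encEdge]

theorem encFinals_cons {N : ℕ} (q : Fin N) (l : List (Fin N)) (y : List Tok) :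
    encFinals (q :: l) ++ y = encNat q ++ .sep :: (encFinals l ++ y) := by
  simp [encFinals]

theorem occ_encEdge {r' : Role} (h : r'.IsItem) {N : ℕ}
    (e : Fin N × Option (Fin k → Option (Fin s)) × Fin N) (y v : List Tok) :
    Occ .src (encEdge e y) r' v ↔ (.src = r' ∧ v = encEdge e y) ∨
      (.tgt = r' ∧ v = encNat e.2.2 ++ .sep :: y) ∨ Occ .src y r' v := by
  rw [encEdge, occ_encNat_src h, occ_encLabel h, occ_encNat_tgt h]

theorem occ_trans {r' : Role} (h : r'.IsItem) {N : ℕ}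
    (l : List (Fin N × Option (Fin k → Option (Fin s)) × Fin N)) {v : List Tok}
    (hv : Occ .src (encTrans l) r' v) :
    ∃ e ∈ l, ∃ y, (.src = r' ∧ v = encEdge e y) ∨ (.tgt = r' ∧ v = encNat e.2.2 ++ .sep :: y) := by
  induction l with
  | nil => exact absurd hv occ_nil
  | cons e l ih =>
    rw [encTrans_cons] at hv
    rcases (occ_encEdge h e _ v).1 hv with h₁ | h₁ | h₁
    · exact ⟨e, by simp, _, .inl h₁⟩
    · exact ⟨e, by simp, _, .inr h₁⟩
    · obtain ⟨e', he', h₂⟩ := ih (by simpa using h₁)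
      exact ⟨e', by simp [he'], h₂⟩

theorem occ_trans_of_mem {N : ℕ} {l : List (Fin N × Option (Fin k → Option (Fin s)) × Fin N)}
    {e : Fin N × Option (Fin k → Option (Fin s)) × Fin N} (he : e ∈ l) :
    ∃ y, Occ .src (encTrans l) .src (encEdge e y) ∧
      Occ .src (encTrans l) .tgt
          (encNat e.2.2 ++ .sep :: y) := by
  induction l with
  | nil => simp at he
  | cons e' l ih =>
    have key : ∀ r' : Role, r'.IsItem → ∀ v, _ := fun r' h v => occ_encEdge (r' := r') h e'
      (encTrans l) v
    have heq : encTrans (e' :: l) = encEdge e' (encTrans l) := encTrans_cons e' l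
    rw [heq]
    rcases List.mem_cons.1 he with rfl | he
    · exact ⟨_, (key _ (by simp [Role.IsItem]) _).2 (.inl ⟨rfl, rfl⟩),
        (key _ (by simp [Role.IsItem]) _).2 (.inr (.inl ⟨rfl, rfl⟩))⟩
    · obtain ⟨y, h₁, h₂⟩ := ih he
      exact ⟨y, (key _ (by simp [Role.IsItem]) _).2 (.inr (.inr h₁)),
        (key _ (by simp [Role.IsItem]) _).2 (.inr (.inr h₂))⟩

theorem occ_final {r' : Role} (h : r'.IsItem) {N : ℕ} (l : List (Fin N)) {x v : List Tok} :
    Occ .fin (encFinals l ++ .semi :: x) r' v →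
      (.fin = r' ∧ ((∃ q ∈ l, ∃ y, v = encNat q ++ .sep :: y) ∨ v = .semi :: x)) ∨
        Occ .src x r' v := by
  induction l with
  | nil =>
    rw [encFinals, List.flatMap_nil, List.nil_append, occ_cons]
    exact Or.imp (And.imp_right .inr) _root_.id
  | cons q l ih =>
    intro hv
    rw [encFinals_cons] at hv
    rcases (occ_encNat_fin h q _ v).1 hv with ⟨h₁, h₂⟩ | h₁
    · exact .inl ⟨h₁, .inl ⟨q, by simp, _, h₂⟩⟩
    · rcases ih h₁ with ⟨h₂, ⟨q', hq', h₃⟩ | h₃⟩ | h₂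
      · exact .inl ⟨h₂, .inl ⟨q', by simp [hq'], h₃⟩⟩
      · exact .inl ⟨h₂, .inr h₃⟩
      · exact .inr h₂

theorem occ_final_of_occ {r' : Role} (h : r'.IsItem) {N : ℕ} (l : List (Fin N)) {x v : List Tok}
    (hv : Occ .src x r' v) :
    Occ .fin (encFinals l ++ .semi :: x) r' v := by
  induction l with
  | nil => exact occ_cons.2 (.inr hv)
  | cons q l ih =>
    rw [encFinals_cons]
    exact (occ_encNat_fin h q _ v).2 (.inr ih)

theorem occ_final_of_mem {N : ℕ} {l : List (Fin N)} {q : Fin N} (hq : q ∈ l) (x : List Tok) :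
    ∃ y, Occ .fin (encFinals l ++ .semi :: x) .fin
      (encNat q ++ .sep :: y) := by
  induction l with
  | nil => simp at hq
  | cons q' l ih =>
    rw [encFinals_cons]
    rcases List.mem_cons.1 hq with rfl | hq
    · exact ⟨_, (occ_encNat_fin (by simp [Role.IsItem]) _ _ _).2 (.inl ⟨rfl, rfl⟩)⟩
    · obtain ⟨y, hy⟩ := ih hq
      exact ⟨y, (occ_encNat_fin (by simp [Role.IsItem]) _ _ _).2 (.inr hy)⟩

theorem occ_encNFA {r' : Role} (h : r'.IsItem) {v : List Tok} :
    Occ .arity (encNFA A) r' v ↔ (.init = r' ∧ v = encRest A) ∨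
      Occ .fin (encFinals A.final ++ .semi ::
        encTrans A.trans) r' v := by
  have h₁ : Role.arity ≠ r' := by rcases h with rfl | rfl | rfl | rfl <;> simp
  have h₂ : Role.size ≠ r' := by rcases h with rfl | rfl | rfl | rfl <;> simp
  rw [encNFA_eq, occ_inner _ h₁.symm, occ_cons]
  · simp only [h₁, false_and, false_or, Role.step]
    rw [occ_inner _ h₂.symm, occ_cons]
    · simp only [h₂, false_and, false_or, Role.step]
      rw [encRest, occ_encNat_init h]
    · intro t ht
      rw [List.eq_of_mem_replicate ht]
      rfl
  · intro t ht
    rw [List.eq_of_mem_replicate ht]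
    rfl

/-- The suffix `v` of the description begins with the given transition, or with its source if it
is a loop that stands for a state. -/
def Reads (A : FinNFA (Fin k → Option (Fin s))) (b : Bool) (v : List Tok)
    (e : Fin A.numStates × Option (Fin k → Option (Fin s)) × Fin A.numStates) : Prop :=
  A.Edge b e ∧ ∃ y, v = if b then encEdge e y else encNat e.1 ++ .sep :: y

/-- Thus a position determines the transition, or the state, that begins there. -/
theorem reads_unique {b : Bool} {v : List Tok}
    {e e' : Fin A.numStates × Option (Fin k → Option (Fin s)) × Fin A.numStates}
    (h : Reads A b v e) (h' : Reads A b v e') : e = e' := by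
  obtain ⟨h₁, y, rfl⟩ := h
  obtain ⟨h₂, y', h₃⟩ := h'
  obtain ⟨p, L, q⟩ := e
  obtain ⟨p', L', q'⟩ := e'
  cases b with
  | false =>
    obtain ⟨-, h₁⟩ := h₁
    obtain ⟨-, h₂⟩ := h₂
    have := Fin.ext (encNat_injective (word_inj isWord_of_mem_encNat isWord_of_mem_encNat h₃).1)
    simp_all
  | true =>
    obtain ⟨h₄, h₅⟩ := word_inj isWord_of_mem_encNat isWord_of_mem_encNat h₃
    obtain ⟨h₆, h₇⟩ := encLabel_inj h₅
    have h₈ := (word_inj isWord_of_mem_encNat isWord_of_mem_encNat h₇).1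
    rw [Prod.mk.injEq, Prod.mk.injEq]
    exact ⟨Fin.ext (encNat_injective h₄), h₆, Fin.ext (encNat_injective h₈)⟩

def roleAt (x : List Tok) (p : ℕ) : Role := (x.take p).foldl Role.step .arity

theorem occ_roleAt {x : List Tok} {p : ℕ} (hp : p < x.length) :
    Occ .arity x (roleAt x p) (x.drop p) :=
  ⟨x.take p, (List.take_append_drop _ _).symm, by simpa using hp, rfl⟩

theorem exists_of_occ {x v : List Tok} {r : Role} (h : Occ .arity x r v) :
    ∃ p < x.length, roleAt x p = r ∧ x.drop p = v := by
  obtain ⟨u, rfl, hv, hr⟩ := h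
  refine ⟨u.length, ?_, ?_, ?_⟩
  · have := List.length_pos_iff.2 hv
    simp only [List.length_append]
    omega
  · simpa [roleAt] using hr
  · simp

/-- The positions where a transition begins (for `true`), or some state. -/
def EdgeMark (b : Bool) (x : List Tok) (p : ℕ) : Prop :=
  x[p]? ≠ none ∧ (roleAt x p = .src ∨ b = false ∧ (roleAt x p = .init ∨ roleAt x p = .tgt))

/-- The semicolon behind the final states also has the role `fin` and must be excluded. -/
def FinalMark (x : List Tok) (p : ℕ) : Prop :=
  x[p]? ≠ none ∧ x[p]? ≠ some .semi ∧ roleAt x p = .fin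

/-- Together with `exists_edgeMark` this replaces quantification over transitions and states by
quantification over positions. -/
theorem EdgeMark.reads {b : Bool} {p : ℕ} (h : EdgeMark b (encNFA A) p) :
    ∃ e, Reads A b ((encNFA A).drop p) e := by
  obtain ⟨h₁, h₂⟩ := h
  have hocc := occ_roleAt (x := encNFA A) (p := p) (by simpa using h₁)
  have hst : ∀ {q : Fin A.numStates}, A.Mentioned q → b = false → ∀ {y},
      (encNFA A).drop p = encNat q ++ .sep :: y → ∃ e, Reads A b ((encNFA A).drop p) e := by
    rintro q hq rfl y hy
    exact ⟨(q, none, q), FinNFA.edge_false hq, y, hy⟩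
  have hitem : (roleAt (encNFA A) p).IsItem := by
    rcases h₂ with h | ⟨-, h | h⟩ <;> simp [h, Role.IsItem]
  rcases (occ_encNFA hitem).1 hocc with ⟨h₃, h₄⟩ | h₃
  · have hb : b = false := by
      rcases h₂ with h | ⟨h, -⟩
      · rw [h] at h₃; simp at h₃
      · exact h
    exact hst A.mentioned_start hb h₄
  · rcases occ_final hitem _ h₃ with ⟨h₄, -⟩ | h₄
    · rcases h₂ with h | ⟨-, h | h⟩ <;> rw [h] at h₄ <;> simp at h₄
    · obtain ⟨e, he, y, ⟨h₅, h₆⟩ | ⟨h₅, h₆⟩⟩ := occ_trans hitem _ h₄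
      · cases b with
        | true => exact ⟨e, he, y, h₆⟩
        | false => exact hst (.inr ⟨e, he, .inl rfl⟩) rfl h₆
      · have hb : b = false := by
          rcases h₂ with h | ⟨h, -⟩
          · rw [h] at h₅; simp at h₅
          · exact h
        exact hst (.inr ⟨e, he, .inr rfl⟩) hb h₆

theorem exists_edgeMark {b : Bool}
    {e : Fin A.numStates × Option (Fin k → Option (Fin s)) × Fin A.numStates} (h : A.Edge b e) :
    ∃ p < (encNFA A).length, EdgeMark b (encNFA A) p ∧ Reads A b ((encNFA A).drop p) e := by
  have key : ∀ {r : Role} {v : List Tok}, Occ .arity (encNFA A) r v →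
      (r = .src ∨ b = false ∧ (r = .init ∨ r = .tgt)) →
      (∃ y, v = if b then encEdge e y else encNat e.1 ++ .sep :: y) →
      ∃ p < (encNFA A).length, EdgeMark b (encNFA A) p ∧ Reads A b ((encNFA A).drop p) e := by
    rintro r v hocc hr hv
    obtain ⟨p, hp, rfl, rfl⟩ := exists_of_occ hocc
    exact ⟨p, hp, ⟨by simpa using hp, hr⟩, h, hv⟩
  have lift : ∀ {r : Role} {v : List Tok}, r.IsItem → Occ .src (encTrans A.trans) r v →
      Occ .arity (encNFA A) r v := fun hr hocc =>
    (occ_encNFA hr).2 (.inr (occ_final_of_occ hr _ hocc))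
  cases b with
  | true =>
    obtain ⟨y, h₁, -⟩ := occ_trans_of_mem (show e ∈ A.trans from h)
    exact key (lift (by simp [Role.IsItem]) h₁) (.inl rfl) ⟨y, rfl⟩
  | false =>
    obtain ⟨p, l⟩ := e
    obtain ⟨h₁ | ⟨e', he', h₁ | h₁⟩, -⟩ := h
    · dsimp only at h₁
      subst h₁
      exact key ((occ_encNFA (by simp [Role.IsItem])).2 (.inl ⟨rfl, rfl⟩)) (by simp) ⟨_, rfl⟩
    · obtain ⟨y, h₂, -⟩ := occ_trans_of_mem he'
      exact key (lift (by simp [Role.IsItem]) h₂) (.inl rfl) ⟨_, by rw [← h₁]; rfl⟩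
    · obtain ⟨y, -, h₂⟩ := occ_trans_of_mem he'
      exact key (lift (by simp [Role.IsItem]) h₂) (by simp) ⟨_, by rw [← h₁]; rfl⟩

theorem FinalMark.exists {p : ℕ} (h : FinalMark (encNFA A) p) :
    ∃ q ∈ A.final, ∃ y, (encNFA A).drop p = encNat q ++ .sep :: y := by
  obtain ⟨h₁, h₂, h₃⟩ := h
  have hocc := occ_roleAt (x := encNFA A) (p := p) (by simpa using h₁)
  have hitem : (roleAt (encNFA A) p).IsItem := by simp [h₃, Role.IsItem]
  rw [occ_encNFA hitem, h₃] at hocc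
  rcases hocc with ⟨h, -⟩ | hocc
  · simp at h
  · rcases occ_final (by simp [Role.IsItem]) _ hocc with ⟨-, ⟨q, hq, hy⟩ | h⟩ | h
    · exact ⟨q, hq, hy⟩
    · refine absurd ?_ h₂
      have := congrArg List.head? h
      rwa [List.head?_drop] at this
    · obtain ⟨e, -, y, ⟨h, -⟩ | ⟨h, -⟩⟩ := occ_trans (by simp [Role.IsItem]) _ h <;> simp at h

theorem exists_finalMark {q : Fin A.numStates} (hq : q ∈ A.final) :
    ∃ p < (encNFA A).length, FinalMark (encNFA A) p ∧
      ∃ y, (encNFA A).drop p = encNat q ++ .sep :: y := by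
  obtain ⟨y, hy⟩ := occ_final_of_mem hq (encTrans A.trans)
  obtain ⟨p, hp, h₁, h₂⟩ := exists_of_occ ((occ_encNFA (by simp [Role.IsItem])).2 (.inr hy))
  refine ⟨p, hp, ⟨by simpa using hp, ?_, h₁⟩, y, h₂⟩
  rw [← List.head?_drop, h₂, List.head?_append]
  cases h : encNat q with
  | nil => simp
  | cons t u =>
    rcases mem_encNat (n := q) (t := t) (by simp [h]) with rfl | rfl <;> simp

end

end Roles

end RamseyWords

namespace RamseyWords

/-! ### Moves in terms of positions -/

section Guards

open scoped Classical

def SameWord (x : List Tok) (p q : ℕ) : Prop :=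
  (x.drop p).takeWhile Tok.isWord = (x.drop q).takeWhile Tok.isWord

/-- For a position where a transition begins: the positions of the first two components of its
label, of the other components, and of its target. -/
def compOne (x : List Tok) (p : ℕ) : ℕ := after Tok.isWord x p

def compTwo (x : List Tok) (p : ℕ) : ℕ := after Tok.isWord x (compOne x p)

def compRest (x : List Tok) (p : ℕ) : ℕ := after Tok.isWord x (compTwo x p)

def targetPos (b : Bool) (x : List Tok) (p : ℕ) : ℕ :=
  if b then after Tok.isInner x p else min p x.length

def EpsAt (x : List Tok) (p : ℕ) : Prop := x[compOne x p]? = some .eps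

def BlankAt (x : List Tok) (p : ℕ) : Prop :=
  (x.drop (compRest x p)).foldl BotScan.step .fresh = .good

/-- The label is a letter with padding behind the first two components. -/
def PairAt (x : List Tok) (p : ℕ) : Prop := ¬ EpsAt x p ∧ BlankAt x p

def BotAt (x : List Tok) (p : ℕ) : Prop := x[compOne x p]? = some .bot

theorem PosFun.compOne : PosFun compOne := PosFun.after _

theorem PosFun.compTwo : PosFun compTwo := (PosFun.after _).comp PosFun.compOne

theorem PosFun.compRest : PosFun compRest := (PosFun.after _).comp PosFun.compTwo

theorem PosFun.targetPos (b : Bool) : PosFun (targetPos b) := by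
  cases b
  · exact PosFun.id
  · exact PosFun.after _

theorem PosRel.sameWord : PosRel SameWord := PosRel.takeWhile_eq _

theorem PosPred.epsAt : PosPred EpsAt := (PosPred.read (· = some Tok.eps)).comp PosFun.compOne

theorem PosPred.botAt : PosPred BotAt := (PosPred.read (· = some Tok.bot)).comp PosFun.compOne

theorem PosPred.blankAt : PosPred BlankAt := by
  refine PosPred.comp (P := fun x n => (x.drop n).foldl BotScan.step .fresh = .good) ?_
    PosFun.compRest
  intro E _ p hp
  refine (LFun.pred (LFun.foldl_select BotScan.step .fresh (Q := fun _ e v => p e ≤ v)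
    (LPred.le (Ptr.fst hp) Ptr.last)) (· = .good)).congr fun x e => ?_
  dsimp only
  rw [select_drop]

theorem PosPred.pairAt : PosPred PairAt := fun E _ p hp =>
  (PosPred.epsAt E p hp).not.and (PosPred.blankAt E p hp)

theorem LFun.roleAt {E : Type} [PEnv E] {p : E → ℕ} (hp : Ptr p) :
    LFun fun x e => roleAt x (p e) := by
  convert LFun.foldl_select Role.step .arity (Q := fun _ e v => v < p e)
    (LPred.lt Ptr.last (Ptr.fst hp)) using 3 with x e
  rw [select_take, RamseyWords.roleAt]

theorem PosPred.edgeMark (b : Bool) : PosPred (EdgeMark b) := fun E _ p hp =>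
  (PosPred.read (· ≠ none) E p hp).and
    (LFun.pred (LFun.roleAt hp) fun r => r = .src ∨ b = false ∧ (r = .init ∨ r = .tgt))

theorem PosPred.finalMark : PosPred FinalMark := fun E _ p hp =>
  (PosPred.read (· ≠ none) E p hp).and ((PosPred.read (· ≠ some Tok.semi) E p hp).and
    (LFun.pred (LFun.roleAt hp) (· = .fin)))

/-- The condition on the labels, in terms of the positions where the transitions begin. -/
def MoveKind.Guard (x : List Tok) (z : Fin 6 → ℕ) : MoveKind → Prop
  | silent => EpsAt x (z 0)
  | blank => ¬ EpsAt x (z 0) ∧ SameWord x (compOne x (z 0)) (compTwo x (z 0)) ∧ BlankAt x (z 0)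
  | letter => ¬ EpsAt x (z 0) ∧ SameWord x (compOne x (z 0)) (compTwo x (z 0)) ∧ ¬ BlankAt x (z 0)
  | guess => True
  | eps _ g => (∀ i, g i = true → EpsAt x (z i)) ∧ g 0 = false ∧ g 1 = false
  | read _ => (PairAt x (z 2) ∧ PairAt x (z 3) ∧ PairAt x (z 4) ∧ PairAt x (z 5)) ∧
      SameWord x (compOne x (z 2)) (compTwo x (z 2)) ∧
      SameWord x (compTwo x (z 2)) (compTwo x (z 3)) ∧
      SameWord x (compTwo x (z 2)) (compTwo x (z 4)) ∧
      SameWord x (compOne x (z 3)) (compTwo x (z 5)) ∧ BotAt x (z 4) ∧ BotAt x (z 5)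
  | tail _ => (PairAt x (z 2) ∧ PairAt x (z 3) ∧ PairAt x (z 4)) ∧
      SameWord x (compOne x (z 2)) (compTwo x (z 2)) ∧
      SameWord x (compTwo x (z 2)) (compTwo x (z 3)) ∧
      SameWord x (compTwo x (z 2)) (compTwo x (z 4)) ∧ BotAt x (z 3) ∧ BotAt x (z 4)

/-- The positions `z` describe a move of the given kind. -/
def MoveKind.Enters (m : MoveKind) (x : List Tok) (z : Fin 6 → ℕ) : Prop :=
  (∀ i, EdgeMark (m.go i) x (z i)) ∧ m.Guard x z

theorem LPred.guard {E : Type} [PEnv E] {z : E → Fin 6 → ℕ} (hz : ∀ i, Ptr fun e => z e i)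
    (m : MoveKind) : LPred fun x e => m.Guard x (z e) := by
  have he := fun i => PosPred.epsAt E _ (hz i)
  have hb := fun i => PosPred.botAt E _ (hz i)
  have hp := fun i => PosPred.pairAt E _ (hz i)
  have h₁₂ := fun i j => (PosRel.sameWord.comp PosFun.compOne PosFun.compTwo) E _ _ (hz i) (hz j)
  have h₂₂ := fun i j => (PosRel.sameWord.comp PosFun.compTwo PosFun.compTwo) E _ _ (hz i) (hz j)
  cases m with
  | silent => exact he 0
  | blank => exact (he 0).not.and ((h₁₂ 0 0).and (PosPred.blankAt E _ (hz 0)))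
  | letter => exact (he 0).not.and ((h₁₂ 0 0).and (PosPred.blankAt E _ (hz 0)).not)
  | guess => exact LPred.const True
  | eps b g =>
    exact (LPred.forall fun i => (LPred.const (g i = true)).imp (he i)).and
      ((LPred.const (g 0 = false)).and (LPred.const (g 1 = false)))
  | read b =>
    exact ((hp 2).and ((hp 3).and ((hp 4).and (hp 5)))).and ((h₁₂ 2 2).and ((h₂₂ 2 3).and
      ((h₂₂ 2 4).and ((h₁₂ 3 5).and ((hb 4).and (hb 5))))))
  | tail b =>
    exact ((hp 2).and ((hp 3).and (hp 4))).and ((h₁₂ 2 2).and ((h₂₂ 2 3).and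
      ((h₂₂ 2 4).and ((hb 3).and (hb 4)))))

theorem LPred.enters {E : Type} [PEnv E] {z : E → Fin 6 → ℕ} (hz : ∀ i, Ptr fun e => z e i)
    (m : MoveKind) : LPred fun x e => m.Enters x (z e) :=
  (LPred.forall fun i => PosPred.edgeMark (m.go i) E _ (hz i)).and (LPred.guard hz m)

end Guards

section GuardSemantics

variable {s k : ℕ} {A : FinNFA (Fin k → Option (Fin s))} {x : List Tok} {p : ℕ}
  {e : Fin A.numStates × Option (Fin k → Option (Fin s)) × Fin A.numStates}

theorem Reads.source {b : Bool} (h : Reads A b (x.drop p) e) :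
    (x.drop p).takeWhile Tok.isWord = encNat e.1 := by
  obtain ⟨-, y, h⟩ := h
  rw [h]
  cases b <;> exact takeWhile_word isWord_of_mem_encNat _

theorem isInner_of_isWord {t : Tok} (h : t.isWord) : t.isInner := by
  cases t <;> first | rfl | exact absurd h (by decide)

theorem Reads.drop_targetPos (h : Reads A true (x.drop p) e) :
    ∃ y, x.drop (targetPos true x p) = encNat e.2.2 ++ .sep :: y := by
  obtain ⟨-, y, h⟩ := h
  refine ⟨y, ?_⟩
  rw [targetPos, if_pos rfl, drop_after, h, if_pos rfl, encEdge, List.dropWhile_append_of_pos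
    fun t ht => isInner_of_isWord (isWord_of_mem_encNat t ht),
    List.dropWhile_cons_of_pos (by rfl), dropWhile_label]

theorem Reads.drop_compOne (h : Reads A true (x.drop p) e) :
    x.drop (compOne x p) = encLabel e.2.1 ++ x.drop (targetPos true x p) := by
  rw [targetPos, if_pos rfl, compOne, drop_after, drop_after]
  obtain ⟨-, y, h⟩ := h
  rw [h, if_pos rfl, encEdge, dropWhile_word isWord_of_mem_encNat, List.dropWhile_append_of_pos
    fun t ht => isInner_of_isWord (isWord_of_mem_encNat t ht),
    List.dropWhile_cons_of_pos (by rfl), dropWhile_label]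

theorem Reads.target {b : Bool} (h : Reads A b (x.drop p) e) :
    (x.drop (targetPos b x p)).takeWhile Tok.isWord = encNat e.2.2 := by
  cases b with
  | true =>
    obtain ⟨y, hy⟩ := h.drop_targetPos
    rw [hy, takeWhile_word isWord_of_mem_encNat]
  | false =>
    have : e.2.2 = e.1 := by rw [h.1.2]
    rw [this, ← h.source, targetPos, if_neg (by simp), drop_min_length]

theorem Reads.epsAt_iff (h : Reads A true (x.drop p) e) : EpsAt x p ↔ e.2.1 = none := by
  rw [EpsAt, ← List.head?_drop, h.drop_compOne]
  cases hl : e.2.1 with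
  | none => simp [encLabel]
  | some l =>
    simp only [reduceCtorEq, iff_false]
    exact head_encLabel_some l _

end GuardSemantics

section LetterSemantics

variable {s k : ℕ} {A : FinNFA (Fin (k + 2) → Option (Fin s))} {x : List Tok} {p q : ℕ}
  {e : Fin A.numStates × Option (Fin (k + 2) → Option (Fin s)) × Fin A.numStates}
  {a b : Option (Fin s)} {v : Fin k → Option (Fin s)}

theorem ofFn_pairLetter (a b : Option (Fin s)) (v : Fin k → Option (Fin s)) :
    List.ofFn (pairLetter a b v) = a :: b :: List.ofFn v := by
  rw [List.ofFn_succ, List.ofFn_succ]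
  rfl

theorem Reads.drop_comp (h : Reads A true (x.drop p) e) (hl : e.2.1 = some (pairLetter a b v)) :
    x.drop (compOne x p) = encSym a ++ .sep :: (encSym b ++ .sep ::
        (encComps (List.ofFn v) ++ .semi :: x.drop (targetPos true x p))) ∧
      x.drop (compTwo x p) = encSym b ++ .sep ::
        (encComps (List.ofFn v) ++ .semi :: x.drop (targetPos true x p)) ∧
      x.drop (compRest x p) = encComps (List.ofFn v) ++ .semi :: x.drop (targetPos true x p) := by
  have hy := h.drop_compOne
  rw [hl, encLabel_some, ofFn_pairLetter, encComps_cons, encComps_cons] at hy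
  have h₂ : x.drop (compTwo x p) = encSym b ++ .sep ::
      (encComps (List.ofFn v) ++ .semi :: x.drop (targetPos true x p)) := by
    rw [compTwo, drop_after, hy, dropWhile_word isWord_of_mem_encSym]
  refine ⟨hy, h₂, ?_⟩
  rw [compRest, drop_after, h₂, dropWhile_word isWord_of_mem_encSym]

/-- The words at the first two components of the label. -/
def LabelWords (x : List Tok) (p : ℕ) (a b : Option (Fin s)) : Prop :=
  (x.drop (compOne x p)).takeWhile Tok.isWord = encSym a ∧
    (x.drop (compTwo x p)).takeWhile Tok.isWord = encSym b ∧ (BotAt x p ↔ a = none)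

theorem Reads.labelWords (h : Reads A true (x.drop p) e)
    (hl : e.2.1 = some (pairLetter a b v)) : LabelWords x p a b := by
  obtain ⟨h₁, h₂, -⟩ := h.drop_comp hl
  refine ⟨by rw [h₁, takeWhile_word isWord_of_mem_encSym],
    by rw [h₂, takeWhile_word isWord_of_mem_encSym], ?_⟩
  rw [BotAt, ← List.head?_drop, h₁]
  cases a with
  | none => simp [encSym]
  | some a =>
    rw [encSym, List.head?_append]
    cases ha : encNat a with
    | nil => simp
    | cons t u =>
      rcases mem_encNat (n := a) (t := t) (by simp [ha]) with rfl | rfl <;> simp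

theorem Reads.blankAt_iff (h : Reads A true (x.drop p) e)
    (hl : e.2.1 = some (pairLetter a b v)) : BlankAt x p ↔ v = noLetter := by
  obtain ⟨-, -, h₃⟩ := h.drop_comp hl
  rw [BlankAt, h₃, BotScan.foldl_encComps]
  simp only [List.mem_ofFn, forall_exists_index, forall_apply_eq_imp_iff]
  exact funext_iff.symm

theorem Reads.exists_pairLetter (h : Reads A true (x.drop p) e) (h' : ¬ EpsAt x p) :
    ∃ a b v, e.2.1 = some (pairLetter a b v) := by
  rw [h.epsAt_iff] at h'
  obtain ⟨l, hl⟩ := Option.ne_none_iff_exists'.1 h'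
  exact ⟨_, _, _, hl.trans (congrArg some (eq_pairLetter l))⟩

theorem Reads.exists_pair (h : Reads A true (x.drop p) e) (h' : PairAt x p) :
    ∃ a b, e.2.1 = some (pairLetter a b noLetter) := by
  obtain ⟨a, b, v, hl⟩ := h.exists_pairLetter h'.1
  obtain rfl := (h.blankAt_iff hl).1 h'.2
  exact ⟨a, b, hl⟩

theorem Reads.pairAt (h : Reads A true (x.drop p) e)
    (hl : e.2.1 = some (pairLetter a b noLetter)) : PairAt x p :=
  ⟨by rw [h.epsAt_iff, hl]; simp, (h.blankAt_iff hl).2 rfl⟩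

theorem sameWord_iff {u w : ℕ} (h : (x.drop u).takeWhile Tok.isWord = encSym a)
    (h' : (x.drop w).takeWhile Tok.isWord = encSym b) : SameWord x u w ↔ a = b := by
  rw [SameWord, h, h', encSym_injective.eq_iff]

/-- The conditions on labels only involve padding and equality of components, and by
`encSym_injective` components are equal if and only if the words that denote them are. -/
theorem guard_iff {m : MoveKind} {z : Fin 6 → ℕ}
    {e : Fin 6 → Fin A.numStates × Option (Fin (k + 2) → Option (Fin s)) × Fin A.numStates}
    (h : ∀ i, Reads A (m.go i) (x.drop (z i)) (e i)) :
    m.Guard x z ↔ ∃ l, m.Fits (fun i => (e i).2.1) l := by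
  cases m with
  | silent =>
    have h₀ : Reads A true (x.drop (z 0)) (e 0) := h 0
    simp only [MoveKind.Guard, MoveKind.Fits, h₀.epsAt_iff]
    exact ⟨fun h => ⟨none, h, rfl⟩, fun ⟨_, h, _⟩ => h⟩
  | blank =>
    have h₀ : Reads A true (x.drop (z 0)) (e 0) := h 0
    constructor
    · rintro ⟨h₁, h₂, h₃⟩
      obtain ⟨a, b, hl⟩ := h₀.exists_pair ⟨h₁, h₃⟩
      have hw := h₀.labelWords hl
      rw [sameWord_iff hw.1 hw.2.1] at h₂
      exact ⟨none, ⟨a, by dsimp only; rw [hl, h₂]⟩, rfl⟩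
    · rintro ⟨_, ⟨a, hl⟩, -⟩
      dsimp only at hl
      have hw := h₀.labelWords hl
      exact ⟨(h₀.pairAt hl).1, (sameWord_iff hw.1 hw.2.1).2 rfl, (h₀.pairAt hl).2⟩
  | letter =>
    have h₀ : Reads A true (x.drop (z 0)) (e 0) := h 0
    constructor
    · rintro ⟨h₁, h₂, h₃⟩
      obtain ⟨a, b, v, hl⟩ := h₀.exists_pairLetter h₁
      have hw := h₀.labelWords hl
      rw [sameWord_iff hw.1 hw.2.1] at h₂
      rw [h₀.blankAt_iff hl] at h₃
      exact ⟨some v, a, v, by dsimp only; rw [hl, h₂], h₃, rfl⟩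
    · rintro ⟨_, a, v, hl, hv, -⟩
      dsimp only at hl
      have hw := h₀.labelWords hl
      exact ⟨by rw [h₀.epsAt_iff, hl]; simp, (sameWord_iff hw.1 hw.2.1).2 rfl,
        by rwa [h₀.blankAt_iff hl]⟩
  | guess => exact ⟨fun _ => ⟨none, rfl⟩, fun _ => trivial⟩
  | eps b g =>
    have key : (∀ i, g i = true → EpsAt x (z i)) ↔ ∀ i, (e i).2.1 = none := by
      refine forall_congr' fun i => ?_
      have hi := h i
      simp only [MoveKind.go] at hi
      cases hg : g i with
      | true =>
        rw [hg] at hi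
        simp [hi.epsAt_iff]
      | false =>
        rw [hg] at hi
        have := hi.1.2
        simp [this]
    simp only [MoveKind.Guard, MoveKind.Fits, key]
    exact ⟨fun ⟨h₁, h₂, h₃⟩ => ⟨none, h₁, h₂, h₃, rfl⟩, fun ⟨_, h₁, h₂, h₃, _⟩ => ⟨h₁, h₂, h₃⟩⟩
  | read b =>
    have h₂ : Reads A true (x.drop (z 2)) (e 2) := h 2
    have h₃ : Reads A true (x.drop (z 3)) (e 3) := h 3
    have h₄ : Reads A true (x.drop (z 4)) (e 4) := h 4
    have h₅ : Reads A true (x.drop (z 5)) (e 5) := h 5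
    constructor
    · rintro ⟨⟨p₂, p₃, p₄, p₅⟩, s₁, s₂, s₃, s₄, b₁, b₂⟩
      obtain ⟨a₂, c₂, l₂⟩ := h₂.exists_pair p₂
      obtain ⟨a₃, c₃, l₃⟩ := h₃.exists_pair p₃
      obtain ⟨a₄, c₄, l₄⟩ := h₄.exists_pair p₄
      obtain ⟨a₅, c₅, l₅⟩ := h₅.exists_pair p₅
      have w₂ := h₂.labelWords l₂
      have w₃ := h₃.labelWords l₃
      have w₄ := h₄.labelWords l₄
      have w₅ := h₅.labelWords l₅
      rw [sameWord_iff w₂.1 w₂.2.1] at s₁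
      rw [sameWord_iff w₂.2.1 w₃.2.1] at s₂
      rw [sameWord_iff w₂.2.1 w₄.2.1] at s₃
      rw [sameWord_iff w₃.1 w₅.2.1] at s₄
      rw [w₄.2.2] at b₁
      rw [w₅.2.2] at b₂
      subst s₁ s₂ s₃ s₄ b₁ b₂
      exact ⟨none, ⟨_, _, l₂, l₃, l₄, l₅⟩, rfl⟩
    · rintro ⟨_, ⟨a, c, l₂, l₃, l₄, l₅⟩, -⟩
      dsimp only at l₂ l₃ l₄ l₅
      have w₂ := h₂.labelWords l₂
      have w₃ := h₃.labelWords l₃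
      have w₄ := h₄.labelWords l₄
      have w₅ := h₅.labelWords l₅
      exact ⟨⟨h₂.pairAt l₂, h₃.pairAt l₃, h₄.pairAt l₄, h₅.pairAt l₅⟩,
        (sameWord_iff w₂.1 w₂.2.1).2 rfl, (sameWord_iff w₂.2.1 w₃.2.1).2 rfl,
        (sameWord_iff w₂.2.1 w₄.2.1).2 rfl, (sameWord_iff w₃.1 w₅.2.1).2 rfl, w₄.2.2.2 rfl,
        w₅.2.2.2 rfl⟩
  | tail b =>
    have h₂ : Reads A true (x.drop (z 2)) (e 2) := h 2
    have h₃ : Reads A true (x.drop (z 3)) (e 3) := h 3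
    have h₄ : Reads A true (x.drop (z 4)) (e 4) := h 4
    constructor
    · rintro ⟨⟨p₂, p₃, p₄⟩, s₁, s₂, s₃, b₁, b₂⟩
      obtain ⟨a₂, c₂, l₂⟩ := h₂.exists_pair p₂
      obtain ⟨a₃, c₃, l₃⟩ := h₃.exists_pair p₃
      obtain ⟨a₄, c₄, l₄⟩ := h₄.exists_pair p₄
      have w₂ := h₂.labelWords l₂
      have w₃ := h₃.labelWords l₃
      have w₄ := h₄.labelWords l₄
      rw [sameWord_iff w₂.1 w₂.2.1] at s₁
      rw [sameWord_iff w₂.2.1 w₃.2.1] at s₂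
      rw [sameWord_iff w₂.2.1 w₄.2.1] at s₃
      rw [w₃.2.2] at b₁
      rw [w₄.2.2] at b₂
      subst s₁ s₂ s₃ b₁ b₂
      exact ⟨none, ⟨_, l₂, l₃, l₄⟩, rfl⟩
    · rintro ⟨_, ⟨c, l₂, l₃, l₄⟩, -⟩
      dsimp only at l₂ l₃ l₄
      have w₂ := h₂.labelWords l₂
      have w₃ := h₃.labelWords l₃
      have w₄ := h₄.labelWords l₄
      exact ⟨⟨h₂.pairAt l₂, h₃.pairAt l₃, h₄.pairAt l₄⟩,
        (sameWord_iff w₂.1 w₂.2.1).2 rfl, (sameWord_iff w₂.2.1 w₃.2.1).2 rfl,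
        (sameWord_iff w₂.2.1 w₄.2.1).2 rfl, w₃.2.2.2 rfl, w₄.2.2.2 rfl⟩

theorem MoveKind.Enters.exists_reads {m : MoveKind} {z : Fin 6 → ℕ}
    (h : m.Enters (encNFA A) z) :
    ∃ (e : Fin 6 → Fin A.numStates × Option (Fin (k + 2) → Option (Fin s)) × Fin A.numStates) (l : _),
      (∀ i, Reads A (m.go i) ((encNFA A).drop (z i)) (e i)) ∧ m.Fits (fun i => (e i).2.1) l := by
  choose e he using fun i => (h.1 i).reads
  obtain ⟨l, hl⟩ := (guard_iff he).1 h.2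
  exact ⟨e, l, he, hl⟩

theorem exists_enters {m : MoveKind}
    {e : Fin 6 → Fin A.numStates × Option (Fin (k + 2) → Option (Fin s)) × Fin A.numStates}
    {l : Option (Fin k → Option (Fin s))} (h : ∀ i, A.Edge (m.go i) (e i))
    (hl : m.Fits (fun i => (e i).2.1) l) :
    ∃ z : Fin 6 → ℕ, (∀ i, z i < (encNFA A).length) ∧ m.Enters (encNFA A) z ∧
      ∀ i, Reads A (m.go i) ((encNFA A).drop (z i)) (e i) := by
  choose z hz hm hr using fun i => exists_edgeMark (h i)
  exact ⟨z, hz, ⟨hm, (guard_iff hr).2 ⟨l, hl⟩⟩, hr⟩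

end LetterSemantics

end RamseyWords

namespace RamseyWords

/-! ### Numerals for the states of the new automaton -/

section StateNumbers

/-- A self-delimiting code: `bit1` announces another token, and `bit0` ends the word. It can be
written while the word is being copied from the input. -/
def compText (w : List Tok) : List Tok := w.flatMap (fun t => [.bit1, t]) ++ [.bit0]

def flagText : Option Bool → List Tok
  | none => [.bit0, .bit0]
  | some false => [.bit1, .bit0]
  | some true => [.bit1, .bit1]

/-- The binary number of a state of the automaton for the Ramsey quantifier. -/
def stateText (f : Option Bool) (w : Fin 6 → List Tok) : List Tok :=
  .bit1 :: (flagText f ++ (List.finRange 6).flatMap fun i => compText (w i))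

theorem compText_inj {w w' r r' : List Tok} (h : compText w ++ r = compText w' ++ r') :
    w = w' ∧ r = r' := by
  induction w generalizing w' with
  | nil => cases w' <;> simp_all [compText]
  | cons t w ih =>
    cases w' with
    | nil => simp [compText] at h
    | cons t' w' =>
      simp only [compText, List.flatMap_cons, List.cons_append, List.nil_append,
        List.append_assoc, List.cons.injEq, true_and] at h ih
      obtain ⟨h₁, h₂⟩ := ih h.2
      simp [h.1, h₁, h₂]

theorem flatMap_compText_inj {ι : Type} {l : List ι} {w w' : ι → List Tok}
    (h : l.flatMap (fun i => compText (w i)) = l.flatMap fun i => compText (w' i)) :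
    ∀ i ∈ l, w i = w' i := by
  induction l with
  | nil => simp
  | cons i l ih =>
    rw [List.flatMap_cons, List.flatMap_cons] at h
    obtain ⟨h₁, h₂⟩ := compText_inj h
    simpa [h₁] using ih h₂

theorem stateText_inj {f f' : Option Bool} {w w' : Fin 6 → List Tok}
    (h : stateText f w = stateText f' w') : f = f' ∧ w = w' := by
  simp only [stateText, List.cons.injEq, true_and] at h
  have hf : f = f' := by
    rcases f with _ | _ | _ <;> rcases f' with _ | _ | _ <;> simp_all [flagText]
  subst hf
  exact ⟨rfl, funext fun i => flatMap_compText_inj (List.append_cancel_left h) i (by simp)⟩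

/-- Because of the leading `bit1`, no zeros are lost and every bit string becomes the numeral of a
number. -/
theorem exists_encNat (l : List Tok) (hl : ∀ t ∈ l, t = .bit0 ∨ t = .bit1) :
    ∃ n, encNat n = .bit1 :: l ∧ n < 2 ^ (l.length + 1) := by
  induction l using List.reverseRecOn with
  | nil => exact ⟨1, by simp [encNat], by simp⟩
  | append_singleton l t ih =>
    obtain ⟨n, hn, hlt⟩ := ih fun t ht => hl t (by simp [ht])
    have hn₀ : n ≠ 0 := by
      rintro rfl
      simp [encNat] at hn
    obtain ⟨b, rfl⟩ : ∃ b : Bool, t = if b then Tok.bit1 else Tok.bit0 := by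
      rcases hl t (by simp) with rfl | rfl
      exacts [⟨false, rfl⟩, ⟨true, rfl⟩]
    refine ⟨Nat.bit b n, ?_, ?_⟩
    · rw [encNat, Nat.bits_append_bit n b fun h => absurd h hn₀, List.reverse_cons,
        List.map_append, ← List.cons_append, ← hn, encNat]
      rfl
    · rw [List.length_append, List.length_singleton, pow_succ]
      cases b <;> simp only [Nat.bit, cond_true, cond_false] <;> omega

theorem length_encNat (n : ℕ) : (encNat n).length = n.size := by
  rw [encNat, List.length_map, List.length_reverse, Nat.size_eq_bits_len]

/-- Each of six numbers below `N` takes at most `2 * N.size + 1` tokens, the flag takes two and the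
leading bit one, in total at most `12 * N.size + 9`. Since `2 ^ N.size ≤ 2 * N`, the number is below
`N ^ 12 * 2 ^ 21`, which explains the exponent `33 = 12 + 21`. -/
theorem exists_stateNum {N : ℕ} (s : CliqueState N) (M : ℕ) (hM : N + 2 ≤ M) :
    ∃ n < M ^ 33, encNat n = stateText s.1 fun i => encNat (s.2 i) := by
  obtain ⟨n, hn, hlt⟩ := exists_encNat (flagText s.1 ++ (List.finRange 6).flatMap fun i =>
    compText (encNat (s.2 i))) (by
    intro t ht
    rw [List.mem_append, List.mem_flatMap] at ht
    rcases ht with ht | ⟨i, -, ht⟩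
    · revert ht
      rcases s.1 with _ | _ | _ <;> simp [flagText] <;> tauto
    · simp only [compText, List.mem_append, List.mem_flatMap, List.mem_cons, List.not_mem_nil,
        or_false] at ht
      rcases ht with ⟨u, hu, rfl | rfl⟩ | rfl
      · exact .inr rfl
      · exact mem_encNat hu
      · exact .inl rfl)
  refine ⟨n, hlt.trans_le ?_, hn⟩
  have hw : ∀ i, (compText (encNat (s.2 i))).length ≤ 2 * N.size + 1 := fun i => by
    have : (encNat (s.2 i)).length ≤ N.size := by
      rw [length_encNat]
      exact Nat.size_le_size (s.2 i).2.le
    simp only [compText, List.length_append, List.length_flatMap, List.length_cons,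
      List.length_nil, List.map_const', List.sum_replicate, smul_eq_mul]
    omega
  have hlen : (flagText s.1 ++ (List.finRange 6).flatMap fun i =>
      compText (encNat (s.2 i))).length ≤ 12 * N.size + 8 := by
    have h₁ : (flagText s.1).length = 2 := by rcases s.1 with _ | _ | _ <;> rfl
    have h₂ := List.sum_le_card_nsmul ((List.finRange 6).map fun i =>
      (compText (encNat (s.2 i))).length) (2 * N.size + 1) (by
      intro m hm
      obtain ⟨i, -, rfl⟩ := List.mem_map.1 hm
      exact hw i)
    rw [List.length_append, h₁, List.length_flatMap]
    simp only [List.length_map, List.length_finRange, smul_eq_mul] at h₂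
    omega
  have hN : 0 < N := (Nat.zero_le _).trans_lt (s.2 0).2
  have hsize : 2 ^ N.size ≤ 2 * N := by
    have h : N.size ≠ 0 := by rw [Ne, Nat.size_eq_zero]; omega
    obtain ⟨m, hm⟩ := Nat.exists_eq_succ_of_ne_zero h
    have := Nat.lt_size.1 (show m < N.size by omega)
    rw [hm, Nat.succ_eq_add_one, pow_succ]
    omega
  calc 2 ^ _ ≤ 2 ^ (12 * N.size + 9) := Nat.pow_le_pow_right (by norm_num) (by omega)
    _ = (2 ^ N.size) ^ 12 * 2 ^ 9 := by rw [pow_add, mul_comm 12, pow_mul]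
    _ ≤ (2 * N) ^ 12 * 2 ^ 9 := Nat.mul_le_mul_right _ (Nat.pow_le_pow_left hsize _)
    _ = N ^ 12 * 2 ^ 21 := by ring
    _ ≤ M ^ 12 * M ^ 21 := Nat.mul_le_mul (Nat.pow_le_pow_left (by omega) _)
        (Nat.pow_le_pow_left (by omega) _)
    _ = M ^ 33 := by rw [← pow_add]

noncomputable def stateNum {N M : ℕ} (hM : N + 2 ≤ M) (s : CliqueState N) : Fin (M ^ 33) :=
  ⟨(exists_stateNum s M hM).choose, (exists_stateNum s M hM).choose_spec.1⟩

theorem encNat_stateNum {N M : ℕ} (hM : N + 2 ≤ M) (s : CliqueState N) :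
    encNat (stateNum hM s) = stateText s.1 fun i => encNat (s.2 i) :=
  (exists_stateNum s M hM).choose_spec.2

theorem stateNum_injective {N M : ℕ} (hM : N + 2 ≤ M) :
    Function.Injective (stateNum (N := N) hM) := by
  intro s s' h
  have := congrArg (fun n : Fin (M ^ 33) => encNat n) h
  simp only [encNat_stateNum] at this
  obtain ⟨h₁, h₂⟩ := stateText_inj this
  exact Prod.ext h₁ (funext fun i => Fin.ext (encNat_injective (congrFun h₂ i)))

end StateNumbers

/-! ### The logarithmic-space transducer -/

section Text

open scoped Classical

def wordAt (x : List Tok) (p : ℕ) : List Tok := (x.drop p).takeWhile Tok.isWord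

/-- The position of the initial state. -/
def initPos (x : List Tok) : ℕ := after Tok.notSep x (after Tok.notSep x 0)

/-- The positions with indices `0`, `1`, `2` stand for `p`, `q` and the final state; compare
`CliqueFinal`. -/
def finalTracks : Fin 6 → Fin 6 := ![0, 1, 0, 1, 1, 2]

/-- The positions `z` describe a final state. -/
def FinalEnters (x : List Tok) (z : Fin 6 → ℕ) : Prop :=
  EdgeMark false x (z 0) ∧ EdgeMark false x (z 1) ∧ FinalMark x (z 2)

/-- The label of a reading move is the text of the old label behind its first two components,
closing semicolon included. -/
noncomputable def MoveKind.labelText (x : List Tok) (z : Fin 6 → ℕ) : MoveKind → List Tok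
  | letter => select x fun v => compRest x (z 0) ≤ v ∧ v < targetPos true x (z 0)
  | _ => [.eps]

noncomputable def MoveKind.moveText (x : List Tok) (m : MoveKind) (z : Fin 6 → ℕ) : List Tok :=
  stateText m.srcFlag (fun i => wordAt x (z (m.src i))) ++ [.sep] ++ m.labelText x z ++
    stateText m.tgtFlag (fun i => wordAt x (targetPos (m.go (m.tgt i)) x (z (m.tgt i)))) ++ [.sep]

/-- The arity loses its first two ticks. The number of states is `(x.length + 1) ^ 33`, one tick per
33-tuple of positions; numbers that denote no state remain unused. The nested `min` is the form in
which the successor is available on positions. -/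
noncomputable def cliqueText (x : List Tok) : List Tok :=
  (select x fun v => min (min (0 + 1) x.length + 1) x.length ≤ v ∧ v < skip Tok.isTick x 0) ++ [.sep] ++
  (tuples (x.length + 1) 33).flatMap (fun _ => [.tick]) ++ [.sep] ++
  stateText none (fun _ => wordAt x (initPos x)) ++ [.sep] ++
  (tuples (x.length + 1) 6).flatMap (fun z => if FinalEnters x z then
    stateText (some true) (fun i => wordAt x (z (finalTracks i))) ++ [.sep] else []) ++ [.semi] ++
  (Finset.univ : Finset MoveKind).toList.flatMap fun m =>
    (tuples (x.length + 1) 6).flatMap fun z => if m.Enters x z then m.moveText x z else []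

variable {E : Type} [PEnv E]

theorem LOut.compText {p : E → ℕ} (hp : Ptr p) : LOut fun x e => compText (wordAt x (p e)) := by
  have := LOut.flatMap_select (E := E) (fun t => [Tok.bit1, t]) (Q := fun x e v => p e ≤ v ∧
    v < skip Tok.isWord x (p e)) ((LPred.le (Ptr.fst hp) Ptr.last).and
      (LPred.at_ptr (P := fun x e w => e.2 < w) (LPred.lt (Ptr.fst Ptr.last) Ptr.last)
        ((PosFun.skip Tok.isWord).lptr (Ptr.fst hp))))
  simp only [select_word] at this
  exact this.append (.const _)

theorem LOut.compText_at {π : List Tok → E → ℕ} (hπ : LPtr π) :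
    LOut fun x e => RamseyWords.compText (wordAt x (π x e)) :=
  LOut.at_ptr (F := fun x _ n => RamseyWords.compText (wordAt x n)) (LOut.compText Ptr.last) hπ

theorem LOut.stateText (f : Option Bool) {w : Fin 6 → List Tok → E → List Tok}
    (hw : ∀ i, LOut fun x e => RamseyWords.compText (w i x e)) :
    LOut fun x e => stateText f fun i => w i x e := by
  unfold RamseyWords.stateText
  exact LOut.append (LOut.const (.bit1 :: flagText f)) (LOut.flatMap_list _ hw)

theorem LOut.moveText (m : MoveKind) {z : E → Fin 6 → ℕ} (hz : ∀ i, Ptr fun e => z e i) :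
    LOut fun x e => m.moveText x (z e) := by
  have h₁ : LOut fun x e => m.labelText x (z e) := by
    cases m with
    | letter =>
      have := LOut.flatMap_select (E := E) (fun t => [t]) (Q := fun x e v =>
        compRest x (z e 0) ≤ v ∧ v < targetPos true x (z e 0))
        ((LPred.at_ptr (P := fun x e w => w ≤ e.2) (LPred.le Ptr.last (Ptr.fst Ptr.last))
          (PosFun.compRest.lptr (Ptr.fst (hz 0)))).and
        (LPred.at_ptr (P := fun x e w => e.2 < w) (LPred.lt (Ptr.fst Ptr.last) Ptr.last)
          ((PosFun.targetPos true).lptr (Ptr.fst (hz 0)))))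
      simp only [List.flatMap_singleton'] at this
      exact this
    | _ => exact .const [Tok.eps]
  exact ((((LOut.stateText _ fun i => LOut.compText (hz (m.src i))).append (.const _)).append
    h₁).append (LOut.stateText _ fun i => LOut.compText_at
      ((PosFun.targetPos _).lptr (hz (m.tgt i))))).append (.const _)

theorem LPred.finalEnters {z : E → Fin 6 → ℕ} (hz : ∀ i, Ptr fun e => z e i) :
    LPred fun x e => FinalEnters x (z e) :=
  (PosPred.edgeMark _ E _ (hz 0)).and ((PosPred.edgeMark _ E _ (hz 1)).and
    (PosPred.finalMark E _ (hz 2)))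

/-- Zero is definable as the number below all positions. -/
theorem LPtr.zero : LPtr fun (_ : List Tok) (_ : E) => 0 :=
  ⟨fun _ _ => Nat.zero_le _, (LPred.all (P := fun (_ : List Tok) (e : E × ℕ) v => e.2 ≤ v)
    (LPred.le (Ptr.fst Ptr.last) Ptr.last)).congr fun _ _ =>
      ⟨fun h v _ => by dsimp only at h; omega, fun h => by simpa using h 0 (Nat.zero_le _)⟩⟩

theorem PosFun.at_zero {g : List Tok → ℕ → ℕ} (hg : PosFun g) : LPtr fun x (_ : E) => g x 0 :=
  ⟨fun _ _ => hg.1 _ _, LPred.at_ptr (P := fun x (e : E × ℕ) v => e.2 = g x v)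
    (hg.2 _ _ _ Ptr.last (Ptr.fst Ptr.last)) LPtr.zero⟩

theorem lptr_initPos : LPtr fun x (_ : E) => initPos x :=
  ((PosFun.after Tok.notSep).comp (PosFun.after Tok.notSep)).at_zero

theorem logSpaceComputable_cliqueText : LogSpaceComputable cliqueText := by
  refine LOut.logSpaceComputable ?_
  unfold cliqueText
  refine (((((((((?_ : LOut _).append (.const _)).append ?_).append (.const _)).append
    (LOut.stateText _ fun _ => LOut.compText_at lptr_initPos)).append
    (.const _)).append ?_).append (.const _)).append ?_)
  · have := LOut.flatMap_select (E := Unit) (fun t => [t]) (Q := fun x e v =>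
        min (min (0 + 1) x.length + 1) x.length ≤ v ∧ v < skip Tok.isTick x 0)
        ((LPred.at_ptr (P := fun x (e : Unit × ℕ) w => w ≤ e.2)
          (LPred.le Ptr.last (Ptr.fst Ptr.last)) (PosFun.succ.comp PosFun.succ).at_zero).and
        (LPred.at_ptr (P := fun x (e : Unit × ℕ) w => e.2 < w) (LPred.lt (Ptr.fst Ptr.last) Ptr.last)
          (PosFun.skip Tok.isTick).at_zero))
    simpa only [List.flatMap_singleton'] using this
  · exact LOut.tuples fun _ _ _ _ _ _ => .const _
  · exact LOut.tuples fun _ _ _ _ _ hz => .ite (LPred.finalEnters hz)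
      (.append (LOut.stateText _ fun i => LOut.compText (hz (finalTracks i))) (.const _)) .nil
  · exact LOut.flatMap_list _ fun m => LOut.tuples fun _ _ _ _ _ hz =>
      .ite (LPred.enters hz m) (LOut.moveText m hz) .nil

end Text

end RamseyWords

namespace RamseyWords

/-! ### The output is the encoding of a correct automaton -/

section TextSemantics

open scoped Classical

/-- A loop that writes text for each good `z` writes the encoding of a list of objects. An object
may be described by several `z` and then occurs repeatedly, which is harmless for lists of
transitions and final states. -/
theorem exists_list_of_text {Z S : Type} (l : List Z) (G : Z → Prop) (F : Z → List Tok)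
    (Rel : Z → S → Prop) (enc : S → List Tok) (hex : ∀ z, G z → ∃ s, Rel z s)
    (huniq : ∀ z s s', Rel z s → Rel z s' → s = s') (henc : ∀ z s, Rel z s → F z = enc s) :
    ∃ L : List S, (l.flatMap fun z => if G z then F z else []) = L.flatMap enc ∧
      ∀ s, s ∈ L ↔ ∃ z ∈ l, G z ∧ Rel z s := by
  induction l with
  | nil => exact ⟨[], rfl, by simp⟩
  | cons z l ih =>
    obtain ⟨L, h₁, h₂⟩ := ih
    by_cases hz : G z
    · obtain ⟨s, hs⟩ := hex z hz
      refine ⟨s :: L, by rw [List.flatMap_cons, List.flatMap_cons, h₁, if_pos hz, henc z s hs],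
        fun s' => ?_⟩
      simp only [List.mem_cons, h₂, exists_eq_or_imp]
      refine or_congr ⟨fun h => ⟨hz, h ▸ hs⟩, fun h => huniq _ _ _ h.2 hs⟩ Iff.rfl
    · refine ⟨L, by rw [List.flatMap_cons, h₁, if_neg hz, List.nil_append], fun s' => ?_⟩
      simp only [List.mem_cons, h₂, exists_eq_or_imp, hz, false_and, false_or]

/-- Numbers outside the range of `φ` have no transitions, so runs between numbered states never
leave that range. -/
theorem LRun.image {S T α : Type} {step : S → Option α → S → Prop}
    {step' : T → Option α → T → Prop} {φ : S → T} (hφ : Function.Injective φ)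
    (h : ∀ a l b, step' a l b ↔ ∃ s s', step s l s' ∧ a = φ s ∧ b = φ s') {s s' : S} {w : List α} :
    LRun step' (φ s) w (φ s') ↔ LRun step s w s' := by
  constructor
  · intro hr
    have key : ∀ a w b, LRun step' a w b → ∀ s, a = φ s → ∃ s', b = φ s' ∧ LRun step s w s' := by
      clear hr
      intro a w b hr
      induction hr with
      | nil => exact fun s hs => ⟨s, hs, .nil s⟩
      | cons hst hr ih =>
        rintro s rfl
        obtain ⟨t, t', ht, hs, rfl⟩ := (h _ _ _).1 hst
        obtain rfl := hφ hs
        obtain ⟨s', hs', hr'⟩ := ih t' rfl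
        exact ⟨s', hs', .cons ht hr'⟩
    obtain ⟨t, ht, hr'⟩ := key _ _ _ hr s rfl
    rwa [hφ ht]
  · intro hr
    induction hr with
    | nil => exact .nil _
    | cons hst _ ih => exact .cons ((h _ _ _).2 ⟨_, _, hst, rfl, rfl⟩) ih

/-- Hence the six positions together with the kind determine the whole move, including its label. -/
theorem MoveKind.fits_unique {α : Type} {k : ℕ} {L : Fin 6 → Option (Fin (k + 2) → Option α)}
    {l l' : Option (Fin k → Option α)} {m : MoveKind} (h : m.Fits L l) (h' : m.Fits L l') :
    l = l' := by
  cases m with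
  | letter =>
    obtain ⟨x, v, h₁, -, rfl⟩ := h
    obtain ⟨x', v', h₂, -, rfl⟩ := h'
    rw [h₁, Option.some.injEq] at h₂
    exact congrArg some (funext fun i => congrFun h₂ i.succ.succ)
  | silent => exact h.2.trans h'.2.symm
  | blank => exact h.2.trans h'.2.symm
  | guess => exact h.trans (Eq.symm h')
  | eps => exact h.2.2.2.trans h'.2.2.2.symm
  | read => exact h.2.trans h'.2.symm
  | tail => exact h.2.trans h'.2.symm

variable {s k : ℕ} {A : FinNFA (Fin (k + 2) → Option (Fin s))}

/-- A move that is described by the positions `z`. -/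
def MoveReads (A : FinNFA (Fin (k + 2) → Option (Fin s))) (m : MoveKind) (z : Fin 6 → ℕ)
    (t : CliqueState A.numStates × Option (Fin k → Option (Fin s)) × CliqueState A.numStates) :
    Prop :=
  ∃ e : Fin 6 → Fin A.numStates × Option (Fin (k + 2) → Option (Fin s)) × Fin A.numStates,
    (∀ i, Reads A (m.go i) ((encNFA A).drop (z i)) (e i)) ∧
    m.Fits (fun i => (e i).2.1) t.2.1 ∧ t.1 = (m.srcFlag, fun i => (e (m.src i)).1) ∧
    t.2.2 = (m.tgtFlag, fun i => (e (m.tgt i)).2.2)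

theorem MoveReads.cliqueStep {m : MoveKind} {z : Fin 6 → ℕ}
    {t : CliqueState A.numStates × Option (Fin k → Option (Fin s)) × CliqueState A.numStates}
    (h : MoveReads A m z t) : CliqueStep A t.1 t.2.1 t.2.2 := by
  obtain ⟨e, he, hf, h₁, h₂⟩ := h
  exact ⟨m, e, fun i => (he i).1, hf, h₁, h₂⟩

theorem MoveReads.unique {m : MoveKind} {z : Fin 6 → ℕ}
    {t t' : CliqueState A.numStates × Option (Fin k → Option (Fin s)) × CliqueState A.numStates}
    (h : MoveReads A m z t) (h' : MoveReads A m z t') : t = t' := by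
  obtain ⟨e, he, hf, h₁, h₂⟩ := h
  obtain ⟨e', he', hf', h₁', h₂'⟩ := h'
  obtain rfl : e = e' := funext fun i => reads_unique (he i) (he' i)
  exact Prod.ext (h₁.trans h₁'.symm) (Prod.ext (MoveKind.fits_unique hf hf') (h₂.trans h₂'.symm))

theorem MoveKind.Enters.moveReads {m : MoveKind} {z : Fin 6 → ℕ} (h : m.Enters (encNFA A) z) :
    ∃ t, MoveReads A m z t := by
  obtain ⟨e, l, he, hl⟩ := h.exists_reads
  exact ⟨(_, l, _), e, he, hl, rfl, rfl⟩

theorem exists_moveReads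
    {t : CliqueState A.numStates × Option (Fin k → Option (Fin s)) × CliqueState A.numStates}
    (h : CliqueStep A t.1 t.2.1 t.2.2) :
    ∃ m z, (∀ i, z i < (encNFA A).length) ∧ m.Enters (encNFA A) z ∧ MoveReads A m z t := by
  obtain ⟨m, e, he, hf, h₁, h₂⟩ := h
  obtain ⟨z, hz, hm, hr⟩ := exists_enters he hf
  exact ⟨m, z, hz, hm, e, hr, hf, h₁, h₂⟩

theorem MoveReads.source {m : MoveKind} {z : Fin 6 → ℕ}
    {t : CliqueState A.numStates × Option (Fin k → Option (Fin s)) × CliqueState A.numStates}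
    (h : MoveReads A m z t) :
    m.srcFlag = t.1.1 ∧ ∀ i, wordAt (encNFA A) (z (m.src i)) = encNat (t.1.2 i) := by
  obtain ⟨e, he, -, h₁, -⟩ := h
  rw [h₁]
  exact ⟨rfl, fun i => (he _).source⟩

theorem MoveReads.target {m : MoveKind} {z : Fin 6 → ℕ}
    {t : CliqueState A.numStates × Option (Fin k → Option (Fin s)) × CliqueState A.numStates}
    (h : MoveReads A m z t) : m.tgtFlag = t.2.2.1 ∧ ∀ i,
      wordAt (encNFA A) (targetPos (m.go (m.tgt i)) (encNFA A) (z (m.tgt i))) =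
        encNat (t.2.2.2 i) := by
  obtain ⟨e, he, -, -, h₁⟩ := h
  rw [h₁]
  exact ⟨rfl, fun i => (he _).target⟩

theorem slice_eq {x u : List Tok} {a b : ℕ} (ha : a ≤ x.length) (hb : b ≤ x.length)
    (h : x.drop a = u ++ x.drop b) : (x.take b).drop a = u := by
  have hl := congrArg List.length h
  simp only [List.length_drop, List.length_append] at hl
  rw [List.drop_take, h, List.take_left' (by omega)]

theorem MoveReads.labelText_eq {m : MoveKind} {z : Fin 6 → ℕ}
    {t : CliqueState A.numStates × Option (Fin k → Option (Fin s)) × CliqueState A.numStates}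
    (h : MoveReads A m z t) : m.labelText (encNFA A) z = encLabel t.2.1 := by
  obtain ⟨e, he, hf, -, -⟩ := h
  cases m with
  | letter =>
    obtain ⟨x, v, h₁, -, h₂⟩ := hf
    dsimp only at h₁
    have h₀ : Reads A true ((encNFA A).drop (z 0)) (e 0) := he 0
    obtain ⟨-, -, hy⟩ := h₀.drop_comp h₁
    rw [MoveKind.labelText, select_slice, h₂]
    refine slice_eq (PosFun.compRest.1 _ _) ((PosFun.targetPos true).1 _ _) ?_
    rw [hy]
    simp [encLabel, encComps]
  | silent => rw [hf.2]; rfl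
  | blank => rw [hf.2]; rfl
  | guess => rw [show t.2.1 = none from hf]; rfl
  | eps => rw [hf.2.2.2]; rfl
  | read => rw [hf.2]; rfl
  | tail => rw [hf.2]; rfl

theorem MoveReads.moveText_eq {M : ℕ} (hM : A.numStates + 2 ≤ M) {m : MoveKind} {z : Fin 6 → ℕ}
    {t : CliqueState A.numStates × Option (Fin k → Option (Fin s)) × CliqueState A.numStates}
    (h : MoveReads A m z t) : m.moveText (encNFA A) z =
      encNat (stateNum hM t.1) ++ [Tok.sep] ++ encLabel t.2.1 ++ encNat (stateNum hM t.2.2) ++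
        [Tok.sep] := by
  rw [MoveKind.moveText, h.labelText_eq, encNat_stateNum, encNat_stateNum, h.source.1, h.target.1,
    funext h.source.2, funext h.target.2]

/-- A final state that is described by the positions `z`. -/
def FinalReads (A : FinNFA (Fin (k + 2) → Option (Fin s))) (z : Fin 6 → ℕ)
    (t : CliqueState A.numStates) : Prop :=
  ∃ p q f, Reads A false ((encNFA A).drop (z 0)) (p, none, p) ∧
    Reads A false ((encNFA A).drop (z 1)) (q, none, q) ∧
    f ∈ A.final ∧ wordAt (encNFA A) (z 2) = encNat f ∧ t = (some true, ![p, q, p, q, q, f])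

theorem Reads.eq_loop {v : List Tok}
    {e : Fin A.numStates × Option (Fin (k + 2) → Option (Fin s)) × Fin A.numStates}
    (h : Reads A false v e) : e = (e.1, none, e.1) := Prod.ext rfl h.1.2

theorem FinalEnters.finalReads {z : Fin 6 → ℕ} (h : FinalEnters (encNFA A) z) :
    ∃ t, FinalReads A z t := by
  obtain ⟨h₀, h₁, h₂⟩ := h
  obtain ⟨e₀, h₀⟩ := h₀.reads
  obtain ⟨e₁, h₁⟩ := h₁.reads
  obtain ⟨f, hf, y, hy⟩ := h₂.exists
  rw [h₀.eq_loop] at h₀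
  rw [h₁.eq_loop] at h₁
  exact ⟨_, _, _, f, h₀, h₁, hf, by rw [wordAt, hy, takeWhile_word isWord_of_mem_encNat], rfl⟩

theorem FinalReads.words {z : Fin 6 → ℕ} {t : CliqueState A.numStates} (h : FinalReads A z t) :
    t.1 = some true ∧ ∀ i, wordAt (encNFA A) (z (finalTracks i)) = encNat (t.2 i) := by
  obtain ⟨p, q, f, h₀, h₁, -, h₂, rfl⟩ := h
  refine ⟨rfl, fun i => ?_⟩
  fin_cases i
  exacts [h₀.source, h₁.source, h₀.source, h₁.source, h₁.source, h₂]

theorem FinalReads.cliqueFinal {z : Fin 6 → ℕ} {t : CliqueState A.numStates}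
    (h : FinalReads A z t) : CliqueFinal A t := by
  obtain ⟨p, q, f, h₀, h₁, hf, -, rfl⟩ := h
  exact ⟨p, q, f, h₀.1.1, h₁.1.1, hf, rfl⟩

theorem exists_finalReads {t : CliqueState A.numStates} (h : CliqueFinal A t) :
    ∃ z, (∀ i, z i < (encNFA A).length) ∧ FinalEnters (encNFA A) z ∧ FinalReads A z t := by
  obtain ⟨p, q, f, hp, hq, hf, rfl⟩ := h
  obtain ⟨a, ha, ha₁, ha₂⟩ := exists_edgeMark (FinNFA.edge_false hp)
  obtain ⟨b, hb, hb₁, hb₂⟩ := exists_edgeMark (FinNFA.edge_false hq)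
  obtain ⟨c, hc, hc₁, y, hc₂⟩ := exists_finalMark hf
  refine ⟨![a, b, c, a, a, a], fun i => by fin_cases i <;> assumption, ⟨ha₁, hb₁, hc₁⟩,
    p, q, f, ha₂, hb₂, hf, ?_, rfl⟩
  change ((encNFA A).drop c).takeWhile Tok.isWord = _
  rw [hc₂, takeWhile_word isWord_of_mem_encNat]

theorem FinalReads.unique {z : Fin 6 → ℕ} {t t' : CliqueState A.numStates}
    (h : FinalReads A z t) (h' : FinalReads A z t') : t = t' := by
  refine Prod.ext (h.words.1.trans h'.words.1.symm) (funext fun i => Fin.ext (encNat_injective ?_))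
  rw [← h.words.2, h'.words.2]

theorem takeWhile_notSep_ticks (n : ℕ) (y : List Tok) :
    ((List.replicate n Tok.tick ++ Tok.sep :: y).dropWhile Tok.notSep).tail = y := by
  rw [List.dropWhile_append_of_pos]
  · simp [Tok.notSep]
  · intro t ht
    rw [List.eq_of_mem_replicate ht]
    rfl

theorem drop_initPos (A : FinNFA (Fin (k + 2) → Option (Fin s))) :
    (encNFA A).drop (initPos (encNFA A)) = encRest A := by
  rw [initPos, drop_after, drop_after, List.drop_zero, encNFA_eq, takeWhile_notSep_ticks,
    takeWhile_notSep_ticks]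

theorem wordAt_initPos (A : FinNFA (Fin (k + 2) → Option (Fin s))) :
    wordAt (encNFA A) (initPos (encNFA A)) = encNat A.start := by
  rw [wordAt, drop_initPos, encRest, takeWhile_word isWord_of_mem_encNat]

theorem length_encNFA (A : FinNFA (Fin (k + 2) → Option (Fin s))) :
    k + 2 + A.numStates + 2 ≤ (encNFA A).length := by
  simp only [encNFA_eq, List.length_append, List.length_cons, List.length_replicate]
  omega

theorem select_arity (A : FinNFA (Fin (k + 2) → Option (Fin s))) :
    (select (encNFA A) fun v => min (min (0 + 1) (encNFA A).length + 1) (encNFA A).length ≤ v ∧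
      v < skip Tok.isTick (encNFA A) 0) = List.replicate k .tick := by
  have h := length_encNFA A
  have hs : skip Tok.isTick (encNFA A) 0 = k + 2 := by
    rw [skip, List.drop_zero]
    nth_rw 2 [encNFA_eq]
    rw [List.takeWhile_append_of_pos]
    · simp [Tok.isTick]
    · intro t ht
      rw [List.eq_of_mem_replicate ht]
      rfl
  rw [select_slice, hs, show min (min (0 + 1) (encNFA A).length + 1) (encNFA A).length = 2 by omega,
    encNFA_eq, List.take_left' (by simp)]
  simp

/-- The transducer writes down an automaton with the language of the Ramsey quantifier. -/
theorem exists_cliqueText_eq (A : FinNFA (Fin (k + 2) → Option (Fin s)))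
    {R : Set (Fin (k + 2) → List (Fin s))} (hA : Recognizes A R) :
    ∃ B : FinNFA (Fin k → Option (Fin s)), cliqueText (encNFA A) = encNFA B ∧
      Recognizes B (ramsey R) := by
  have hM : A.numStates + 2 ≤ (encNFA A).length + 1 := by
    have := length_encNFA A
    omega
  obtain ⟨F, hF₁, hF₂⟩ := exists_list_of_text (tuples ((encNFA A).length + 1) 6)
    (FinalEnters (encNFA A)) (fun z => stateText (some true) (fun i =>
      wordAt (encNFA A) (z (finalTracks i))) ++ [.sep]) (FinalReads A)
    (fun t => encNat (stateNum hM t) ++ [.sep]) (fun z => FinalEnters.finalReads)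
    (fun _ _ _ h h' => h.unique h') (fun z t h => by
      rw [encNat_stateNum, funext h.words.2, h.words.1])
  obtain ⟨T, hT₁, hT₂⟩ := exists_list_of_text
    ((Finset.univ : Finset MoveKind).toList.flatMap fun m =>
      (tuples ((encNFA A).length + 1) 6).map fun z => (m, z))
    (fun z => z.1.Enters (encNFA A) z.2) (fun z => z.1.moveText (encNFA A) z.2)
    (fun z t => MoveReads A z.1 z.2 t)
    (fun t => encNat (stateNum hM t.1) ++ [Tok.sep] ++ encLabel t.2.1 ++
      encNat (stateNum hM t.2.2) ++ [Tok.sep]) (fun z => MoveKind.Enters.moveReads)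
    (fun _ _ _ h h' => h.unique h') (fun z t h => h.moveText_eq hM)
  have hF : ∀ t, t ∈ F ↔ CliqueFinal A t := fun t => by
    rw [hF₂]
    constructor
    · rintro ⟨z, -, -, h⟩
      exact h.cliqueFinal
    · intro h
      obtain ⟨z, hz, h₁, h₂⟩ := exists_finalReads h
      exact ⟨z, mem_tuples.2 fun i => (hz i).trans (Nat.lt_succ_self _), h₁, h₂⟩
  have hT : ∀ t, t ∈ T ↔ CliqueStep A t.1 t.2.1 t.2.2 := fun t => by
    rw [hT₂]
    constructor
    · rintro ⟨z, -, -, h⟩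
      exact h.cliqueStep
    · intro h
      obtain ⟨m, z, hz, h₁, h₂⟩ := exists_moveReads h
      refine ⟨(m, z), ?_, h₁, h₂⟩
      rw [List.mem_flatMap]
      exact ⟨m, by simp, List.mem_map.2 ⟨z, mem_tuples.2 fun i =>
        (hz i).trans (Nat.lt_succ_self _), rfl⟩⟩
  -- The number of states is dictated by the type of `stateNum hM`.
  refine ⟨⟨_, stateNum hM (none, fun _ => A.start), F.map (stateNum hM),
    T.map fun t => (stateNum hM t.1, t.2.1, stateNum hM t.2.2)⟩, ?_, ?_⟩
  · have hT' : ((Finset.univ : Finset MoveKind).toList.flatMap fun m =>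
        (tuples ((encNFA A).length + 1) 6).flatMap fun z =>
          if m.Enters (encNFA A) z then m.moveText (encNFA A) z else []) =
        encTrans (T.map fun t => (stateNum hM t.1, t.2.1, stateNum hM t.2.2)) := by
      rw [List.flatMap_assoc] at hT₁
      simp only [List.flatMap_map] at hT₁
      rw [hT₁, encTrans, List.flatMap_map]
    have htick : (tuples ((encNFA A).length + 1) 33).flatMap (fun _ => [Tok.tick]) =
        List.replicate (((encNFA A).length + 1) ^ 33) Tok.tick := by
      rw [← length_tuples]
      induction tuples ((encNFA A).length + 1) 33 with
      | nil => rfl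
      | cons z l ih => rw [List.flatMap_cons, ih]; rfl
    refine Eq.trans ?_ (encNFA_eq _).symm
    rw [cliqueText, select_arity, htick, hF₁, hT', wordAt_initPos, encRest,
      encNat_stateNum, encFinals, List.flatMap_map]
    simp
  · have himage := fun s s' w => LRun.image (stateNum_injective hM) (step := CliqueStep A)
      (step' := FinNFA.step ⟨_, stateNum hM (none, fun _ => A.start), F.map (stateNum hM),
        T.map fun t => (stateNum hM t.1, t.2.1, stateNum hM t.2.2)⟩) (s := s) (s' := s') (w := w)
      (fun a l b => by
        simp only [FinNFA.step, List.mem_map, hT, Prod.mk.injEq]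
        constructor
        · rintro ⟨t, h, rfl, rfl, rfl⟩
          exact ⟨_, _, h, rfl, rfl⟩
        · rintro ⟨s, s', h, rfl, rfl⟩
          exact ⟨(s, l, s'), h, rfl, rfl, rfl⟩)
    refine Set.ext fun w => ?_
    rw [FinNFA.mem_language_iff, ← exists_lrun_cliqueStep_iff hA]
    constructor
    · rintro ⟨f, hf, h⟩
      obtain ⟨t, ht, rfl⟩ := List.mem_map.1 hf
      exact ⟨t, (hF t).1 ht, (himage _ _ _).1 h⟩
    · rintro ⟨t, ht, h⟩
      exact ⟨_, List.mem_map.2 ⟨t, (hF t).2 ht, rfl⟩, (himage _ _ _).2 h⟩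

end TextSemantics

end RamseyWords

namespace RamseyWords

/-! ### The infinite clique problem in nondeterministic logarithmic space -/

section Search

open Relation

/-- The moves between the nodes of the search for an accepting run on the empty word: an initial
node, a node for each move that is described by positions, and final nodes. -/
def CliqueSearch : Option (Option MoveKind) → Option (Option MoveKind) → List Tok →
    (Fin 6 → ℕ) × (Fin 6 → ℕ) → Prop
  | none, some (some m), x, z => m.Enters x z.2 ∧ m.srcFlag = none ∧
      ∀ i, SameWord x (initPos x) (z.2 (m.src i))
  | some (some m), some (some m'), x, z => m'.Enters x z.2 ∧ m'.srcFlag = m.tgtFlag ∧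
      ∀ i, SameWord x (targetPos (m.go (m.tgt i)) x (z.1 (m.tgt i))) (z.2 (m'.src i))
  | some (some m), some none, x, z => FinalEnters x z.2 ∧ m.tgtFlag = some true ∧
      ∀ i, SameWord x (targetPos (m.go (m.tgt i)) x (z.1 (m.tgt i))) (z.2 (finalTracks i))
  | _, _, _, _ => False

theorem LPred.cliqueSearch (t t' : Option (Option MoveKind)) : LPred (CliqueSearch t t') := by
  have h₁ := fun i => Ptr.fst (E' := Fin 6 → ℕ) (Ptr.coord (m := 6) i)
  have h₂ := fun i => Ptr.snd (E := Fin 6 → ℕ) (Ptr.coord (m := 6) i)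
  have hw := fun b i j => (PosRel.sameWord.comp_left (PosFun.targetPos b)) _ _ _ (h₁ i) (h₂ j)
  rcases t with _ | _ | m <;> rcases t' with _ | _ | m'
  · exact .const False
  · exact .const False
  · exact (LPred.enters h₂ m').and ((LPred.const (m'.srcFlag = none)).and (LPred.forall fun i =>
      LPred.at_ptr (P := fun x (e : (Fin 6 → ℕ) × (Fin 6 → ℕ)) n => SameWord x n (e.2 (m'.src i)))
        (PosRel.sameWord _ _ _ Ptr.last (Ptr.fst (h₂ _))) lptr_initPos))
  · exact .const False
  · exact .const False
  · exact .const False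
  · exact .const False
  · exact (LPred.finalEnters h₂).and ((LPred.const (m.tgtFlag = some true)).and
      (LPred.forall fun i => hw _ _ _))
  · exact (LPred.enters h₂ m').and ((LPred.const (m'.srcFlag = m.tgtFlag)).and
      (LPred.forall fun i => hw _ _ _))

/-- There is only one tuple of length zero, and a `letter` move must not read it. -/
theorem MoveKind.Fits.eq_none {α : Type} {L : Fin 6 → Option (Fin (0 + 2) → Option α)}
    {l : Option (Fin 0 → Option α)} {m : MoveKind} (h : m.Fits L l) : l = none := by
  cases m with
  | letter =>
    obtain ⟨_, v, -, hv, -⟩ := h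
    exact absurd (Subsingleton.elim _ _) hv
  | silent => exact h.2
  | blank => exact h.2
  | guess => exact h
  | eps => exact h.2.2.2
  | read => exact h.2
  | tail => exact h.2

variable {s : ℕ} {A : FinNFA (Fin (0 + 2) → Option (Fin s))}

theorem MoveReads.label_eq_none {m : MoveKind} {z : Fin 6 → ℕ}
    {t : CliqueState A.numStates × Option (Fin 0 → Option (Fin s)) × CliqueState A.numStates}
    (h : MoveReads A m z t) : t.2.1 = none := by
  obtain ⟨_, _, h, -⟩ := h
  exact h.eq_none

theorem eq_of_words {N : ℕ} {x : List Tok} {u v : CliqueState N} {a b : Fin 6 → ℕ}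
    (h₁ : u.1 = v.1) (hu : ∀ i, wordAt x (a i) = encNat (u.2 i))
    (hv : ∀ i, wordAt x (b i) = encNat (v.2 i)) (h : ∀ i, SameWord x (a i) (b i)) : u = v :=
  Prod.ext h₁ (funext fun i => Fin.ext (encNat_injective
    ((hu i).symm.trans ((h i : wordAt x (a i) = wordAt x (b i)).trans (hv i)))))

theorem sameWord_of_words {x : List Tok} {a b n : ℕ} (ha : wordAt x a = encNat n)
    (hb : wordAt x b = encNat n) : SameWord x a b :=
  (ha.trans hb.symm : wordAt x a = wordAt x b)

/-- A node of the search is a move, not a state. Consecutive moves fit if the flags agree and, on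
each track, the target of one and the source of the next are written as the same word. -/
theorem exists_final_of_search {z₀ z : Fin 6 → ℕ}
    (h : ReflTransGen (PathStep CliqueSearch (encNFA A)) (none, z₀) (some none, z)) :
    ∃ t, CliqueFinal A t ∧ LRun (CliqueStep A) (none, fun _ => A.start) [] t := by
  have key : ∀ b, ReflTransGen (PathStep CliqueSearch (encNFA A)) (none, z₀) b →
      (∀ m, b.1 = some (some m) → ∃ t, MoveReads A m b.2 t ∧
        LRun (CliqueStep A) (none, fun _ => A.start) [] t.2.2) ∧
      (b.1 = some none → ∃ t, CliqueFinal A t ∧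
        LRun (CliqueStep A) (none, fun _ => A.start) [] t) := by
    intro b hb
    induction hb with
    | refl => exact ⟨by simp, by simp⟩
    | @tail b c _ hs ih =>
      obtain ⟨-, hs⟩ := hs
      obtain ⟨b₁, b₂⟩ := b
      obtain ⟨c₁, c₂⟩ := c
      rcases b₁ with _ | _ | m <;> rcases c₁ with _ | _ | m'
      · exact hs.elim
      · exact hs.elim
      · refine ⟨fun m h => ?_, by simp⟩
        obtain rfl : m' = m := by simpa using h
        obtain ⟨hm, hf, hw⟩ := hs
        obtain ⟨t, ht⟩ := hm.moveReads
        refine ⟨t, ht, ?_⟩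
        have : (none, fun _ => A.start) = t.1 :=
          eq_of_words (hf.symm.trans ht.source.1) (fun _ => wordAt_initPos A) ht.source.2 hw
        have hst := ht.cliqueStep
        rw [ht.label_eq_none, ← this] at hst
        exact .single hst
      · exact hs.elim
      · exact hs.elim
      · exact hs.elim
      · exact hs.elim
      · refine ⟨by simp, fun _ => ?_⟩
        obtain ⟨hm, hf, hw⟩ := hs
        obtain ⟨t, ht, hr⟩ := ih.1 m rfl
        obtain ⟨u, hu⟩ := hm.finalReads
        have : t.2.2 = u := eq_of_words (ht.target.1.symm.trans (hf.trans hu.words.1.symm))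
          ht.target.2 hu.words.2 hw
        exact ⟨u, hu.cliqueFinal, this ▸ hr⟩
      · refine ⟨fun m'' h => ?_, by simp⟩
        obtain rfl : m' = m'' := by simpa using h
        obtain ⟨hm, hf, hw⟩ := hs
        obtain ⟨t, ht, hr⟩ := ih.1 m rfl
        obtain ⟨u, hu⟩ := hm.moveReads
        refine ⟨u, hu, ?_⟩
        have : t.2.2 = u.1 := eq_of_words (ht.target.1.symm.trans (hf.symm.trans hu.source.1))
          ht.target.2 hu.source.2 hw
        have hst := hu.cliqueStep
        rw [hu.label_eq_none, ← this] at hst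
        exact hr.snoc hst
  exact (key _ h).2 rfl

theorem exists_search_of_final {t : CliqueState A.numStates} (ht : CliqueFinal A t)
    (h : LRun (CliqueStep A) (none, fun _ => A.start) [] t) (z₀ : Fin 6 → ℕ) :
    ∃ z, ReflTransGen (PathStep CliqueSearch (encNFA A)) (none, z₀) (some none, z) := by
  have key : t = (none, fun _ => A.start) ∨ ∃ m z u, MoveReads A m z u ∧ u.2.2 = t ∧
      ReflTransGen (PathStep CliqueSearch (encNFA A)) (none, z₀) (some (some m), z) := by
    refine LRun.snoc_induction (fun _ t => t = (none, fun _ => A.start) ∨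
      ∃ m z u, MoveReads A m z u ∧ u.2.2 = t ∧
        ReflTransGen (PathStep CliqueSearch (encNFA A)) (none, z₀) (some (some m), z)) (.inl rfl) ?_ h
    intro w t l t' ih hst
    obtain ⟨m', z', hz', hm', hr'⟩ := exists_moveReads (t := (t, l, t')) hst
    refine .inr ⟨m', z', _, hr', rfl, ?_⟩
    rcases ih with rfl | ⟨m, z, u, hu, rfl, hp⟩
    · exact .single ⟨fun i => (hz' i).le, hm', hr'.source.1, fun i =>
        sameWord_of_words (wordAt_initPos A) (hr'.source.2 i)⟩
    · exact hp.tail ⟨fun i => (hz' i).le, hm', hr'.source.1.trans hu.target.1.symm, fun i =>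
        sameWord_of_words (hu.target.2 i) (hr'.source.2 i)⟩
  obtain ⟨z', hz', hm', hr'⟩ := exists_finalReads ht
  rcases key with rfl | ⟨m, z, u, hu, rfl, hp⟩
  -- The initial state is not final because its flag is `none`, so an accepting run contains a move.
  · exact absurd hr'.words.1 (by simp)
  · exact ⟨z', hp.tail ⟨fun i => (hz' i).le, hm', hu.target.1.trans hr'.words.1, fun i =>
      sameWord_of_words (hu.target.2 i) (hr'.words.2 i)⟩⟩

/-- Without parameters, the only convolution is the empty word. -/
theorem ramsey_nonempty_iff {α : Type} (R : Set (Fin (0 + 2) → List α)) :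
    [] ∈ conv '' ramsey R ↔ HasInfiniteClique R := by
  have hc : ∀ c : Fin 0 → List α, c = ![] := fun c => Subsingleton.elim _ _
  constructor
  · rintro ⟨c, ⟨a, ha, h⟩, -⟩
    refine ⟨a, ha, fun i j hij => ?_⟩
    have := h i j hij
    rwa [hc c] at this
  · rintro ⟨a, ha, h⟩
    exact ⟨![], ⟨a, ha, h⟩, rfl⟩

theorem exists_inNL_hasInfiniteClique : ∃ L : Set (List Tok), InNL L ∧
    ∀ (s : ℕ) (A : FinNFA (Fin 2 → Option (Fin s))) (R : Set (Fin 2 → List (Fin s))),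
      Recognizes A R → (encNFA A ∈ L ↔ HasInfiniteClique R) := by
  refine ⟨_, inNL_of_path CliqueSearch none (some none) LPred.cliqueSearch, fun s A R hA => ?_⟩
  have h₁ := exists_lrun_cliqueStep_iff (k := 0) (A := A) (R := R) hA []
  have h₂ := ramsey_nonempty_iff R
  rw [← h₂, ← h₁]
  constructor
  · rintro ⟨z, h⟩
    exact exists_final_of_search h
  · rintro ⟨t, ht, h⟩
    exact exists_search_of_final ht h _

end Search

end RamseyWords

theorem theorem1 :
    (∃ f : List RamseyWords.Tok → List RamseyWords.Tok,
      RamseyWords.LogSpaceComputable f ∧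
      ∀ (s k : ℕ) (A : RamseyWords.FinNFA (Fin (k + 2) → Option (Fin s)))
        (R : Set (Fin (k + 2) → List (Fin s))),
        RamseyWords.Recognizes A R →
        ∃ B : RamseyWords.FinNFA (Fin k → Option (Fin s)),
          f (RamseyWords.encNFA A) = RamseyWords.encNFA B ∧
          RamseyWords.Recognizes B (RamseyWords.ramsey R)) ∧
    (∃ L : Set (List RamseyWords.Tok),
      RamseyWords.InNL L ∧
      ∀ (s : ℕ) (A : RamseyWords.FinNFA (Fin 2 → Option (Fin s)))
        (R : Set (Fin 2 → List (Fin s))),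
        RamseyWords.Recognizes A R →
        (RamseyWords.encNFA A ∈ L ↔ RamseyWords.HasInfiniteClique R)) :=
  ⟨⟨RamseyWords.cliqueText, RamseyWords.logSpaceComputable_cliqueText,
    fun _ _ A _ hA => RamseyWords.exists_cliqueText_eq A hA⟩,
    RamseyWords.exists_inNL_hasInfiniteClique⟩
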